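/- Setting. Let $d\in\{2,3\}$, $T>0$, and let $\Omega\subset\mathbb R^d$ be a bounded connected Lipschitz polygon ($d=2$) or polyhedron ($d=3$). Data: a measurable porosity $\varphi$ with $0<\varphi_{\min}\le\varphi\le\varphi_{\max}$, piecewise constant in space; continuous nonnegative mobilities $\eta_w$ (increasing) and $\eta_o$ (decreasing) on $[0,1]$ with $\eta_w+\eta_o\ge\eta_*>0$; a capillary pressure $p_c$, continuous and strictly decreasing on $[0,1]$, $p_c\in W^{1,1}(0,1)$; flow rates $\bar q,\underline q\in L^2(\Omega\times]0,T[)$, $\bar q,\underline q\ge0$, $\int_\Omega\bar q=\int_\Omega\underline q$ for a.e. $t$; an input saturation $0\le s_{\rm in}\le1$ and an initial saturation $0\le s_w^0\le1$. Put $f_w=\eta_w/(\eta_w+\eta_o)$, $f_o=1-f_w$, extend $p_c,\eta_\alpha,f_\alpha$ ($\alpha=w,o$) by constants from $[0,1]$ to $\mathbb R$, and let $$g(x)=-\int_0^x\frac{\eta_w(s)\eta_o(s)}{\eta_w(s)+\eta_o(s)}\,p_c'(s)\,ds,\qquad x\in[0,1].$$ Power-law assumptions: $\eta_w(0)=\eta_o(1)=0$,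 $\eta_w,\eta_o\in W^{1,\infty}(0,1)$, and there are $\theta_w,\theta_o\ge1$, $\beta_3,\beta_4>0$, $\alpha_w,\alpha_o,\alpha_3\in]0,1]$ such that for almost every $x\in]0,1[$ $$\alpha_w x^{\theta_w-1}\le\eta_w'(x)\le\tfrac1{\alpha_w}x^{\theta_w-1},\qquad \alpha_o(1-x)^{\theta_o-1}\le-\eta_o'(x)\le\tfrac1{\alpha_o}(1-x)^{\theta_o-1},$$ $$\alpha_3x^{\beta_3-1}(1-x)^{\beta_4-1}\le-p_c'(x)\le\tfrac1{\alpha_3}x^{\beta_3-1}(1-x)^{\beta_4-1}.$$ Scheme. Let $\mathcal T_h$ be a conforming simplicial mesh of $\overline\Omega$ with nodes $\boldsymbol x_1,\dots,\boldsymbol x_M$, all of whose (dihedral) angles are at most $\pi/2$, such that $\varphi$ is constant on each element, and which is regular: $h_K\le\sigma\rho_K$ for each element $K$, with $h_K$ its diameter and $\rho_K$ the diameter of its inscribed ball. Let $\phi_i$ be the continuous piecewise linear Lagrange basis functions, $I_hv=\sum_iv(\boldsymbol x_i)\phi_i$, $\Delta_i$ the union of the elements with vertex $\boldsymbol x_i$,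 and $$c_{ij}=\int_{\Delta_i\cap\Delta_j}|\nabla\phi_i\cdot\nabla\phi_j|,\qquad m_i=\frac{|\Delta_i|}{d+1},\qquad \tilde m_i=\frac1{d+1}\sum_{K\subset\Delta_i}\varphi|_K|K|.$$ Let $\tau=T/N$ with $N\ge1$, $t_n=n\tau$, $\rho_\tau(f)^n=\frac1\tau\int_{t_{n-1}}^{t_n}f$, and let $r_h(f)$ be the continuous piecewise linear function with $r_h(f)(\boldsymbol x_i)=\frac1{|\Delta_i|}\int_{\Delta_i}f$. Let $S^{0,i}=r_h(s_w^0)(\boldsymbol x_i)$, and let $s_{\rm in}^{n,i},\bar q^{n,i},\underline q^{n,i}$ be the values at $\boldsymbol x_i$ of $\rho_\tau(r_h(s_{\rm in}))^n$, $\rho_\tau\big(r_h(\bar q)-\frac1{|\Omega|}\int_\Omega(r_h(\bar q)-\bar q)\big)^n$ and $\rho_\tau\big(r_h(\underline q)-\frac1{|\Omega|}\int_\Omega(r_h(\underline q)-\underline q)\big)^n$. A discrete solution consists of reals $S^{n,i},P_w^{n,i},P_o^{n,i}$ such that for $1\le n\le N$, $1\le i\le M$, $$\frac{\tilde m_i}\tau(S^{n,i}-S^{n-1,i})-\sum_jc_{ij}\,\eta_w(S_w^{n,ij})(P_w^{n,j}-P_w^{n,i})=m_i\big(f_w(s_{\rm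 in}^{n,i})\bar q^{n,i}-f_w(S^{n,i})\underline q^{n,i}\big),$$ $$-\frac{\tilde m_i}\tau(S^{n,i}-S^{n-1,i})-\sum_jc_{ij}\,\eta_o(S_o^{n,ij})(P_o^{n,j}-P_o^{n,i})=m_i\big(f_o(s_{\rm in}^{n,i})\bar q^{n,i}-f_o(S^{n,i})\underline q^{n,i}\big),$$ $$P_o^{n,i}-P_w^{n,i}=p_c(S^{n,i}),\qquad \sum_im_iP_w^{n,i}=0,$$ where, for $\alpha=w,o$, $S_\alpha^{n,ij}$ is $S^{n,i}$ if $P_\alpha^{n,i}>P_\alpha^{n,j}$, $S^{n,j}$ if $P_\alpha^{n,i}<P_\alpha^{n,j}$, and, in case of equality, $\max(S^{n,i},S^{n,j})$ for $\alpha=w$ and $\min(S^{n,i},S^{n,j})$ for $\alpha=o$. Put $S_{h,\tau}(t)=\sum_iS^{n,i}\phi_i$ for $t\in]t_{n-1},t_n]$. Theorem. Under these assumptions there is a constant $C$, depending only on the data and on $\sigma$ (in particular independent of $h$ and $\tau$), such that for every such mesh, every $N\ge1$, every discrete solution and every real $\delta$ with $0<\delta<T$, $$\int_0^{T-\delta}\big\|g(S_{h,\tau}(t+\delta))-g(S_{h,\tau}(t))\big\|_{L^2(\Omega)}^2\,dt\le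 C\delta$$ and $$\int_0^{T-\delta}\big\|I_h\big(g(S_{h,\tau}(t+\delta))-g(S_{h,\tau}(t))\big)\big\|_{L^2(\Omega)}^2\,dt\le C\delta.$$ -/

import Mathlib

open MeasureTheory Set
open scoped RealInnerProductSpace NNReal ENNReal

noncomputable section

namespace TwoPhase

/-- The space `ℝᵈ` with its Euclidean norm. -/
abbrev E (d : ℕ) := EuclideanSpace ℝ (Fin d)

/-! ### The continuous problem -/

/-- Lipschitz boundary: near each of its boundary points, `Ω` is the strict epigraph, in some unit
direction `ν`, of a Lipschitz function of the variables orthogonal to `ν`. -/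
def HasLipschitzBoundary {d : ℕ} (Ω : Set (E d)) : Prop :=
  ∀ x ∈ frontier Ω, ∃ (ν : E d) (L : ℝ≥0) (ψ : E d → ℝ) (r : ℝ),
    ‖ν‖ = 1 ∧ 0 < r ∧ LipschitzWith L ψ ∧ (∀ (y : E d) (t : ℝ), ψ (y + t • ν) = ψ y) ∧
      ∀ y ∈ Metric.ball x r, (y ∈ Ω ↔ ψ y < ⟪ν, y⟫)

/-- The data of the two-phase flow problem. Functions of the saturation only matter on `[0,1]`, and
functions of `(t, x)` only on `]0,T[ × Ω`. -/
structure Data (d : ℕ) where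
  /-- the spatial domain -/
  Ω : Set (E d)
  /-- the final time -/
  T : ℝ
  /-- the porosity -/
  φ : E d → ℝ
  /-- the mobility of the wetting phase -/
  ηw : ℝ → ℝ
  /-- the mobility of the non-wetting phase -/
  ηo : ℝ → ℝ
  /-- the capillary pressure -/
  pc : ℝ → ℝ
  /-- the flow rate at the injection wells -/
  qIn : ℝ → E d → ℝ
  /-- the flow rate at the production wells -/
  qOut : ℝ → E d → ℝ
  /-- the input saturation -/
  sIn : ℝ → E d → ℝ
  /-- the initial wetting phase saturation -/
  s0 : E d → ℝ

namespace Data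

variable {d : ℕ} (D : Data d)

/-- Lebesgue measure on the space-time cylinder `]0,T[ × Ω`. -/
def cylMeasure : Measure (ℝ × E d) :=
  (volume.restrict (Ioo 0 D.T)).prod (volume.restrict D.Ω)

/-- The standing assumptions on the data. Piecewise constancy of the porosity is part of its
compatibility with the mesh, `Mesh.PorosityCompatible`. -/
structure BasicAssumptions : Prop where
  isOpen : IsOpen D.Ω
  isConnected : IsConnected D.Ω
  isBounded : Bornology.IsBounded D.Ω
  lipschitz : HasLipschitzBoundary D.Ω
  T_pos : 0 < D.T
  φ_meas : AEStronglyMeasurable D.φ (volume.restrict D.Ω)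
  φ_bounds : ∃ φmin φmax : ℝ, 0 < φmin ∧
    ∀ᵐ x ∂(volume.restrict D.Ω), φmin ≤ D.φ x ∧ D.φ x ≤ φmax
  ηw_cont : ContinuousOn D.ηw (Icc 0 1)
  ηw_nonneg : ∀ s ∈ Icc (0 : ℝ) 1, 0 ≤ D.ηw s
  ηw_mono : MonotoneOn D.ηw (Icc 0 1)
  ηo_cont : ContinuousOn D.ηo (Icc 0 1)
  ηo_nonneg : ∀ s ∈ Icc (0 : ℝ) 1, 0 ≤ D.ηo s
  ηo_anti : AntitoneOn D.ηo (Icc 0 1)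
  η_lower : ∃ ηstar : ℝ, 0 < ηstar ∧ ∀ s ∈ Icc (0 : ℝ) 1, ηstar ≤ D.ηw s + D.ηo s
  /-- `p_c` is continuous on `[0,1]` and belongs to `W^{1,1}(0,1)` -/
  pc_ac : AbsolutelyContinuousOnInterval D.pc 0 1
  pc_strictAnti : StrictAntiOn D.pc (Icc 0 1)
  qIn_memLp : MemLp (fun p : ℝ × E d => D.qIn p.1 p.2) 2 D.cylMeasure
  qOut_memLp : MemLp (fun p : ℝ × E d => D.qOut p.1 p.2) 2 D.cylMeasure
  qIn_nonneg : ∀ᵐ p ∂D.cylMeasure, 0 ≤ D.qIn p.1 p.2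
  qOut_nonneg : ∀ᵐ p ∂D.cylMeasure, 0 ≤ D.qOut p.1 p.2
  q_balance : ∀ᵐ t ∂(volume.restrict (Ioo 0 D.T)),
    ∫ x in D.Ω, D.qIn t x = ∫ x in D.Ω, D.qOut t x
  sIn_meas : AEStronglyMeasurable (fun p : ℝ × E d => D.sIn p.1 p.2) D.cylMeasure
  sIn_mem : ∀ᵐ p ∂D.cylMeasure, D.sIn p.1 p.2 ∈ Icc (0 : ℝ) 1
  s0_meas : AEStronglyMeasurable D.s0 (volume.restrict D.Ω)
  s0_mem : ∀ᵐ x ∂(volume.restrict D.Ω), D.s0 x ∈ Icc (0 : ℝ) 1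

/-- The power-law assumptions on the mobilities, which are in `W^{1,∞}(0,1)`, i.e. Lipschitz on
`[0,1]`, and on the capillary pressure. The bounds on the derivatives are only required almost
everywhere in `]0,1[`. -/
structure PowerLaw : Prop where
  ηw_zero : D.ηw 0 = 0
  ηo_one : D.ηo 1 = 0
  ηw_lipschitz : ∃ L : ℝ≥0, LipschitzOnWith L D.ηw (Icc 0 1)
  ηo_lipschitz : ∃ L : ℝ≥0, LipschitzOnWith L D.ηo (Icc 0 1)
  ηw_deriv : ∃ αw θw : ℝ, 0 < αw ∧ αw ≤ 1 ∧ 1 ≤ θw ∧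
    ∀ᵐ x ∂(volume.restrict (Ioo (0 : ℝ) 1)),
      αw * x ^ (θw - 1) ≤ deriv D.ηw x ∧ deriv D.ηw x ≤ 1 / αw * x ^ (θw - 1)
  ηo_deriv : ∃ αo θo : ℝ, 0 < αo ∧ αo ≤ 1 ∧ 1 ≤ θo ∧
    ∀ᵐ x ∂(volume.restrict (Ioo (0 : ℝ) 1)),
      αo * (1 - x) ^ (θo - 1) ≤ -deriv D.ηo x ∧
        -deriv D.ηo x ≤ 1 / αo * (1 - x) ^ (θo - 1)
  pc_deriv : ∃ α₃ β₃ β₄ : ℝ, 0 < α₃ ∧ α₃ ≤ 1 ∧ 0 < β₃ ∧ 0 < β₄ ∧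
    ∀ᵐ x ∂(volume.restrict (Ioo (0 : ℝ) 1)),
      α₃ * (x ^ (β₃ - 1) * (1 - x) ^ (β₄ - 1)) ≤ -deriv D.pc x ∧
        -deriv D.pc x ≤ 1 / α₃ * (x ^ (β₃ - 1) * (1 - x) ^ (β₄ - 1))

/-- `g(x) = -∫₀ˣ η_w η_o / (η_w + η_o) p_c'`, for `x` in `[0,1]`. -/
def g (x : ℝ) : ℝ :=
  -∫ s in (0 : ℝ)..x, D.ηw s * D.ηo s / (D.ηw s + D.ηo s) * deriv D.pc s

end Data

/-- Extension by constants, from `[0,1]` to `ℝ`. -/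
def ext (f : ℝ → ℝ) (s : ℝ) : ℝ := f (projIcc (0 : ℝ) 1 zero_le_one s)

namespace Data

variable {d : ℕ} (D : Data d)

/-- The fractional flow of the wetting phase, extended by constants to `ℝ`. -/
def fw (s : ℝ) : ℝ := ext D.ηw s / (ext D.ηw s + ext D.ηo s)

/-- The fractional flow of the non-wetting phase, extended by constants to `ℝ`. -/
def fo (s : ℝ) : ℝ := 1 - D.fw s

end Data

/-! ### Meshes and piecewise linear finite elements -/

/-- A conforming simplicial mesh of `Ω`, given by its nodes and its connectivity table. The
closed elements cover exactly the closure of `Ω`; in particular `Ω` is polygonal or polyhedral. -/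
structure Mesh {d : ℕ} (Ω : Set (E d)) where
  /-- the number of nodes -/
  M : ℕ
  /-- the number of elements -/
  nElt : ℕ
  /-- the nodes -/
  node : Fin M → E d
  /-- `vert K a` is the global number of the vertex of `K` with local number `a` -/
  vert : Fin nElt → Fin (d + 1) → Fin M
  node_injective : Function.Injective node
  affineIndependent : ∀ K, AffineIndependent ℝ (fun a => node (vert K a))
  /-- distinct elements have distinct sets of vertices -/
  vert_distinct : ∀ K K', range (vert K) = range (vert K') → K = K'
  /-- each node is a vertex of some element -/
  node_used : ∀ i, ∃ K a, vert K a = i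
  cover : ⋃ K, convexHull ℝ (range fun a => node (vert K a)) = closure Ω
  /-- two elements intersect at most along their common face -/
  conforming : ∀ K K',
    convexHull ℝ (range fun a => node (vert K a)) ∩
        convexHull ℝ (range fun a => node (vert K' a)) ⊆
      convexHull ℝ (node '' (range (vert K) ∩ range (vert K')))

/-- The (interior) dihedral angle of a simplex between its facets opposite to the vertices `i` and
`j`: the supplement of the angle between the inward normals of these facets, which are directed
from the foot of the altitude to the opposite vertex. In a triangle, this is the angle at the third
vertex. -/
def dihedralAngle {d : ℕ} [NeZero d] (s : Affine.Simplex ℝ (E d) d) (i j : Fin (d + 1)) : ℝ :=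
  Real.pi - InnerProductGeometry.angle
    (s.points i -ᵥ s.altitudeFoot i) (s.points j -ᵥ s.altitudeFoot j)

namespace Mesh

variable {d : ℕ} {Ω : Set (E d)} (m : Mesh Ω)

/-- The element `K` as a simplex. -/
def simplex (K : Fin m.nElt) : Affine.Simplex ℝ (E d) d :=
  ⟨fun a => m.node (m.vert K a), m.affineIndependent K⟩

/-- The element `K` as a closed set. -/
def elt (K : Fin m.nElt) : Set (E d) := convexHull ℝ (range fun a => m.node (m.vert K a))

/-- The vertices of `K`, as an affine basis of `ℝᵈ`. -/
def basis (K : Fin m.nElt) : AffineBasis (Fin (d + 1)) ℝ (E d) :=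
  ⟨fun a => m.node (m.vert K a), m.affineIndependent K, by
    rw [(m.affineIndependent K).affineSpan_eq_top_iff_card_eq_finrank_add_one]
    simp⟩

/-- Shape regularity with constant `σ`: `h_K ≤ σ ρ_K` for each element, where `h_K` is its diameter
and `ρ_K` the diameter of its inscribed ball. -/
def Regular [NeZero d] (σ : ℝ) : Prop :=
  ∀ K, Metric.diam (m.elt K) ≤ σ * (2 * (m.simplex K).inradius)

/-- Each angle of each element is at most `π/2`. -/
def Nonobtuse [NeZero d] : Prop :=
  ∀ K, ∀ a b : Fin (d + 1), a ≠ b → dihedralAngle (m.simplex K) a b ≤ Real.pi / 2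

/-- The porosity is (almost everywhere) equal to a constant on each element. -/
def PorosityCompatible (φ : E d → ℝ) : Prop :=
  ∀ K, ∃ c : ℝ, ∀ᵐ x ∂(volume.restrict (m.elt K)), φ x = c

open Classical in
/-- The Lagrange basis function `φ_i`: on an element `K`, it is the barycentric coordinate of the
node `i` if `i` is a vertex of `K`, and zero otherwise (on a face shared by several elements, these
all give the same value). It is set to zero outside of the mesh. -/
def hat (i : Fin m.M) (x : E d) : ℝ :=
  if h : ∃ K, x ∈ m.elt K then
    ∑ a, if m.vert h.choose a = i then (m.basis h.choose).coord a x else 0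
  else 0

/-- The function `∑ U^i φ_i` of `X_h` with nodal values `U^i`. -/
def fn (U : Fin m.M → ℝ) (x : E d) : ℝ := ∑ i, U i * m.hat i x

/-- The Lagrange interpolation operator `I_h`. -/
def interp (v : E d → ℝ) : E d → ℝ := m.fn fun i => v (m.node i)

open Classical in
/-- The elements which have `i` as a vertex. -/
def elts (i : Fin m.M) : Finset (Fin m.nElt) := Finset.univ.filter fun K => i ∈ range (m.vert K)

/-- `Δ_i`, the union of the elements sharing the node `i`. -/
def patch (i : Fin m.M) : Set (E d) := ⋃ K ∈ m.elts i, m.elt K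

/-- `c_ij = ∫_{Δ_i ∩ Δ_j} |∇φ_i · ∇φ_j|`. -/
def c (i j : Fin m.M) : ℝ :=
  ∫ x in m.patch i ∩ m.patch j, |⟪gradient (m.hat i) x, gradient (m.hat j) x⟫|

/-- `m̃_i(φ) = 1/(d+1) ∑_{K ∈ Δ_i} φ|_K |K|`, where the constant `φ|_K` is obtained as the mean value
of `φ` in `K`. -/
def mTilde (φ : E d → ℝ) (i : Fin m.M) : ℝ :=
  1 / ((d : ℝ) + 1) * ∑ K ∈ m.elts i, (⨍ x in m.elt K, φ x) * volume.real (m.elt K)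

/-- `m_i = |Δ_i| / (d+1)`. -/
def mass (i : Fin m.M) : ℝ := 1 / ((d : ℝ) + 1) * ∑ K ∈ m.elts i, volume.real (m.elt K)

/-- `(U_h, V_h)_h`. -/
def ip (U V : Fin m.M → ℝ) : ℝ := ∑ i, m.mass i * U i * V i

/-- `(U_h, V_h)_h^φ`. -/
def ipφ (φ : E d → ℝ) (U V : Fin m.M → ℝ) : ℝ := ∑ i, m.mTilde φ i * U i * V i

/-- The upwinded form `∑_{i,j} U^i c_ij W^{ij} (V^j - V^i)`. -/
def form (W : Fin m.M → Fin m.M → ℝ) (V U : Fin m.M → ℝ) : ℝ :=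
  ∑ i, ∑ j, U i * m.c i j * W i j * (V j - V i)

/-- The nodal values of `r_h f`: mean values in the patches `Δ_i`. -/
def rh (f : E d → ℝ) (i : Fin m.M) : ℝ := ⨍ x in m.patch i, f x

/-- The nodal values of `r_h f - 1/|Ω| ∫_Ω (r_h f - f)`. -/
def rhCorr (f : E d → ℝ) (i : Fin m.M) : ℝ :=
  m.rh f i - 1 / volume.real Ω * ∫ x in Ω, (m.fn (m.rh f) x - f x)

end Mesh

/-- `ρ_τ(f)^n`, the mean value of `f` in `]t_{n-1}, t_n]`, where `t_n = n τ`. -/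
def rhoTau (τ : ℝ) (f : ℝ → ℝ) (n : ℕ) : ℝ := 1 / τ * ∫ t in (((n : ℝ) - 1) * τ)..(n * τ), f t

/-! ### The numerical scheme -/

/-- The upwind value `S_w^{ij}`. -/
def upW {M : ℕ} (S P : Fin M → ℝ) (i j : Fin M) : ℝ :=
  if P j < P i then S i else if P i < P j then S j else max (S i) (S j)

/-- The upwind value `S_o^{ij}`. -/
def upO {M : ℕ} (S P : Fin M → ℝ) (i j : Fin M) : ℝ :=
  if P j < P i then S i else if P i < P j then S j else min (S i) (S j)

namespace Data

variable {d : ℕ} (D : Data d)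

/-- The nodal values, at time level `n`, of the discrete input saturation. -/
def sInH (m : Mesh D.Ω) (τ : ℝ) (n : ℕ) (i : Fin m.M) : ℝ :=
  rhoTau τ (fun t => m.rh (D.sIn t) i) n

/-- The nodal values, at time level `n`, of the discrete injection rate. -/
def qInH (m : Mesh D.Ω) (τ : ℝ) (n : ℕ) (i : Fin m.M) : ℝ :=
  rhoTau τ (fun t => m.rhCorr (D.qIn t) i) n

/-- The nodal values, at time level `n`, of the discrete production rate. -/
def qOutH (m : Mesh D.Ω) (τ : ℝ) (n : ℕ) (i : Fin m.M) : ℝ :=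
  rhoTau τ (fun t => m.rhCorr (D.qOut t) i) n

/-- `S n`, `Pw n`, `Po n` are the nodal values at time `t_n = n τ`, `τ = T / N`, of a solution of the
fully discrete scheme (for the pressures, `1 ≤ n ≤ N`). -/
structure IsDiscreteSolution (m : Mesh D.Ω) (N : ℕ) (S Pw Po : ℕ → Fin m.M → ℝ) : Prop where
  init : S 0 = m.rh D.s0
  wetting : ∀ n, 1 ≤ n → n ≤ N → ∀ θ : Fin m.M → ℝ,
    1 / (D.T / N) * m.ipφ D.φ (fun i => S n i - S (n - 1) i) θ
        - m.form (fun i j => ext D.ηw (upW (S n) (Pw n) i j)) (Pw n) θ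
      = m.ip (fun i => D.fw (D.sInH m (D.T / N) n i) * D.qInH m (D.T / N) n i
          - D.fw (S n i) * D.qOutH m (D.T / N) n i) θ
  nonwetting : ∀ n, 1 ≤ n → n ≤ N → ∀ θ : Fin m.M → ℝ,
    -(1 / (D.T / N) * m.ipφ D.φ (fun i => S n i - S (n - 1) i) θ)
        - m.form (fun i j => ext D.ηo (upO (S n) (Po n) i j)) (Po n) θ
      = m.ip (fun i => D.fo (D.sInH m (D.T / N) n i) * D.qInH m (D.T / N) n i
          - D.fo (S n i) * D.qOutH m (D.T / N) n i) θ
  capillary : ∀ n, 1 ≤ n → n ≤ N → ∀ i, Po n i - Pw n i = ext D.pc (S n i)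
  mean_zero : ∀ n, 1 ≤ n → n ≤ N → m.ip (Pw n) (fun _ => 1) = 0

/-- The function `S_{h,τ}`, with value `S_h^n` for `t` in `]t_{n-1}, t_n]`. -/
def Shτ (m : Mesh D.Ω) (N : ℕ) (S : ℕ → Fin m.M → ℝ) (t : ℝ) : E d → ℝ :=
  m.fn (S ⌈t / (D.T / N)⌉₊)

end Data

end TwoPhase

end

/-! The increments of a degenerate parabolic quantity are controlled by testing the equation, summed
over the time steps between two levels, with the increment itself. Put θ = g(S^{k+p}) - g(S^k). On
[0,1] the function g is nondecreasing and Lipschitz, the vanishing mobilities absorbing the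
singularities of p_c' (`exists_g_lipschitz`), so θ² ≤ L θ (S^{k+p} - S^k). The wetting equation
expresses the weighted sum of the right-hand side as p steps of fluxes and sources tested with θ;
each step costs at most τ times the dissipation Σ c_ij (η_w |δP_w|² + η_o |δP_o|²), the flow rates,
and the Dirichlet integral of I_h θ. Summed over k, the total is O(p) once dissipation, rates and
the Dirichlet integral of I_h g(S^n) are summable in time with weight τ (`sum_mass_mul_sq_le`,
`sum_window_le`). The lumped norm dominates the L² norm of a piecewise linear function, whence the
second estimate.

Summability is the energy estimate `exists_energy_bound`: each phase equation is tested with its own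
pressure. The accumulation term telescopes because the primitive of p_c is concave. The sources
involve the pressures, whose gradients are not controlled where the mobilities degenerate; the
global pressure P_w + ∫_0^S f_o p_c' replaces them. On every edge, upwinding makes the squared
increments of this pressure and of g at most a constant times the edge dissipation
(`upwind_global_pressure`, `upwind_g`). Nonobtuse angles identify the sums over edges with Dirichlet
integrals (`Nonobtuse.sum_c_mul_sq`), and a Poincaré inequality with a constant depending on Ω alone
(`exists_discrete_poincare`) bounds the global pressure up to an additive constant, which the
balance of the flow rates makes harmless. The maximum principle `saturation_mem` keeps S in [0,1]
throughout.

The function g(S_h) is not piecewise linear, and each element K is treated according to its size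
(`exists_increment_bound`). If h_K² ≤ pτ, replacing g(S_h) by a nodal value costs h_K |∇I_h g(S)|,
whose square is paid by pτ times the Dirichlet integral. If h_K² > pτ, the fluxes themselves bound
the increment of S at the vertices, by Cauchy-Schwarz and the scaling c_ij ≲ h^{d-2}, m_i ~ h^d
(`mass_mul_sub_sq_le`, `Regular.diam_sq_mul_sum_c_le`).

Finally, for functions piecewise constant in time, averaging over the position of t in its time step
turns the O(p) bounds into a bound linear in δ, also for δ < τ (`lintegral_time_translate_le`). -/

namespace TwoPhase

namespace Mesh

variable {d : ℕ} {Ω : Set (E d)} (m : Mesh Ω)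

/-! ### Barycentric coordinates and piecewise linear functions -/

/-- The affine function which coincides on `K` with the finite element function of nodal values
`U`. -/
noncomputable def lin (K : Fin m.nElt) (U : Fin m.M → ℝ) : E d →ᵃ[ℝ] ℝ :=
  ∑ a, U (m.vert K a) • (m.basis K).coord a

/-- The gradient of the barycentric coordinate of local number `a`. -/
noncomputable def gradCoord (K : Fin m.nElt) (a : Fin (d + 1)) : E d :=
  (InnerProductSpace.toDual ℝ (E d)).symm
    (LinearMap.toContinuousLinearMap ((m.basis K).coord a).linear)

/-- The gradient on `K` of the finite element function of nodal values `U`. -/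
noncomputable def grad (K : Fin m.nElt) (U : Fin m.M → ℝ) : E d :=
  ∑ a, U (m.vert K a) • m.gradCoord K a

/-- The volume of an element. -/
noncomputable def vol (K : Fin m.nElt) : ℝ := volume.real (m.elt K)

lemma vol_nonneg (K : Fin m.nElt) : 0 ≤ m.vol K := measureReal_nonneg

lemma basis_apply (K : Fin m.nElt) (a : Fin (d + 1)) :
    m.basis K a = m.node (m.vert K a) := rfl

lemma vert_injective (K : Fin m.nElt) : Function.Injective (m.vert K) := fun a b h =>
  (m.affineIndependent K).injective (by simp [h])

lemma lin_apply (K : Fin m.nElt) (U : Fin m.M → ℝ) (x : E d) :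
    m.lin K U x = ∑ a, U (m.vert K a) * (m.basis K).coord a x := by
  have h : ∀ s : Finset (Fin (d + 1)), (∑ a ∈ s, U (m.vert K a) • (m.basis K).coord a) x =
      ∑ a ∈ s, U (m.vert K a) * (m.basis K).coord a x := by
    intro s
    induction s using Finset.cons_induction with
    | empty => simp
    | cons a s ha ih =>
      rw [Finset.sum_cons, Finset.sum_cons, AffineMap.coe_add, Pi.add_apply, ih,
        AffineMap.coe_smul, Pi.smul_apply, smul_eq_mul]
  exact h _

lemma lin_node (K : Fin m.nElt) (U : Fin m.M → ℝ) (a : Fin (d + 1)) :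
    m.lin K U (m.node (m.vert K a)) = U (m.vert K a) := by
  rw [lin_apply, Finset.sum_eq_single a]
  · rw [← basis_apply, AffineBasis.coord_apply_eq, mul_one]
  · intro b _ hb
    rw [← basis_apply, AffineBasis.coord_apply_ne _ hb, mul_zero]
  · simp

lemma coord_sub (K : Fin m.nElt) (a : Fin (d + 1)) (x y : E d) :
    (m.basis K).coord a y - (m.basis K).coord a x = ⟪m.gradCoord K a, y - x⟫ := by
  rw [gradCoord, InnerProductSpace.toDual_symm_apply, LinearMap.coe_toContinuousLinearMap',
    ← vsub_eq_sub y x, AffineMap.linearMap_vsub, vsub_eq_sub]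

lemma lin_sub (K : Fin m.nElt) (U : Fin m.M → ℝ) (x y : E d) :
    m.lin K U y - m.lin K U x = ⟪m.grad K U, y - x⟫ := by
  simp only [lin_apply, grad, sum_inner, real_inner_smul_left, ← Finset.sum_sub_distrib,
    ← coord_sub, mul_sub]

lemma continuous_lin (K : Fin m.nElt) (U : Fin m.M → ℝ) : Continuous (m.lin K U) :=
  (m.lin K U).continuous_of_finiteDimensional

lemma continuous_coord (K : Fin m.nElt) (a : Fin (d + 1)) : Continuous ((m.basis K).coord a) :=
  ((m.basis K).coord a).continuous_of_finiteDimensional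

lemma elt_eq (K : Fin m.nElt) : m.elt K = convexHull ℝ (range (m.basis K)) := rfl

lemma mem_elt_iff {K : Fin m.nElt} {x : E d} :
    x ∈ m.elt K ↔ ∀ a, 0 ≤ (m.basis K).coord a x := by
  rw [elt_eq, AffineBasis.convexHull_eq_nonneg_coord]; rfl

lemma mem_interior_elt_iff {K : Fin m.nElt} {x : E d} :
    x ∈ interior (m.elt K) ↔ ∀ a, 0 < (m.basis K).coord a x := by
  rw [elt_eq, AffineBasis.interior_convexHull]; rfl

lemma convex_elt (K : Fin m.nElt) : Convex ℝ (m.elt K) := convex_convexHull _ _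

lemma isCompact_elt (K : Fin m.nElt) : IsCompact (m.elt K) :=
  (finite_range fun a => m.node (m.vert K a)).isCompact_convexHull ℝ

lemma isClosed_elt (K : Fin m.nElt) : IsClosed (m.elt K) := (m.isCompact_elt K).isClosed

lemma measurableSet_elt (K : Fin m.nElt) : MeasurableSet (m.elt K) :=
  (m.isClosed_elt K).measurableSet

lemma node_mem_elt (K : Fin m.nElt) (a : Fin (d + 1)) : m.node (m.vert K a) ∈ m.elt K :=
  subset_convexHull _ _ (mem_range_self a)

lemma volume_frontier_elt (K : Fin m.nElt) : volume (frontier (m.elt K)) = 0 :=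
  (m.convex_elt K).addHaar_frontier volume

lemma volume_elt_ne_top (K : Fin m.nElt) : volume (m.elt K) ≠ ∞ :=
  (m.isCompact_elt K).measure_lt_top.ne

lemma vol_pos (K : Fin m.nElt) : 0 < m.vol K := by
  have h : (interior (m.elt K)).Nonempty := by
    rw [elt_eq]; exact ⟨_, (m.basis K).centroid_mem_interior_convexHull⟩
  have : 0 < volume (m.elt K) :=
    (isOpen_interior.measure_pos volume h).trans_le (measure_mono interior_subset)
  exact ENNReal.toReal_pos this.ne' (m.volume_elt_ne_top K)

lemma interior_ae_eq_elt (K : Fin m.nElt) :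
    (interior (m.elt K) : Set (E d)) =ᵐ[volume] m.elt K :=
  interior_ae_eq_of_null_frontier (m.volume_frontier_elt K)

lemma sum_coord (K : Fin m.nElt) (x : E d) : ∑ a, (m.basis K).coord a x = 1 :=
  (m.basis K).sum_coord_apply_eq_one x

lemma elt_subset_closure (K : Fin m.nElt) : m.elt K ⊆ closure Ω := by
  rw [← m.cover]; exact subset_iUnion (fun K => m.elt K) K

lemma iUnion_elt : ⋃ K, m.elt K = closure Ω := m.cover

lemma exists_mem_elt {x : E d} (hx : x ∈ closure Ω) : ∃ K, x ∈ m.elt K := by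
  rw [← m.cover] at hx; exact mem_iUnion.1 hx

/-- Conformity: the affine functions of two elements coincide on their intersection. -/
lemma lin_eq_of_mem {K K' : Fin m.nElt} {x : E d} (hK : x ∈ m.elt K) (hK' : x ∈ m.elt K')
    (U : Fin m.M → ℝ) : m.lin K U x = m.lin K' U x := by
  have h := m.conforming K K' ⟨hK, hK'⟩
  have hconv : Convex ℝ {y | m.lin K U y - m.lin K' U y = 0} := by
    have := (convex_singleton (𝕜 := ℝ) (0 : ℝ)).affine_preimage (m.lin K U - m.lin K' U)
    exact this
  have : m.node '' (range (m.vert K) ∩ range (m.vert K')) ⊆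
      {y | m.lin K U y - m.lin K' U y = 0} := by
    rintro _ ⟨i, ⟨⟨a, rfl⟩, ⟨b, hb⟩⟩, rfl⟩
    have h1 := m.lin_node K U a
    have h2 := m.lin_node K' U b
    rw [hb] at h2
    simp [h1, h2]
  exact sub_eq_zero.1 (convexHull_min this hconv h)

/-- The restriction of a finite element function to an element. -/
lemma fn_eq_lin {K : Fin m.nElt} {x : E d} (hK : x ∈ m.elt K) (U : Fin m.M → ℝ) :
    m.fn U x = m.lin K U x := by
  classical
  have h : ∃ K, x ∈ m.elt K := ⟨K, hK⟩
  -- Conformity makes the element chosen in the definition of `hat` irrelevant.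
  rw [m.lin_eq_of_mem hK h.choose_spec]
  simp only [fn, hat, h, dite_true, lin_apply, Finset.mul_sum]
  rw [Finset.sum_comm]
  refine Finset.sum_congr rfl fun a _ => ?_
  rw [Finset.sum_eq_single (m.vert h.choose a)]
  · congr
    rw [if_pos]
    congr
  · intro i _ hi
    rw [if_neg (fun h => hi h.symm), mul_zero]
  · simp

lemma fn_node (U : Fin m.M → ℝ) (i : Fin m.M) : m.fn U (m.node i) = U i := by
  obtain ⟨K, a, rfl⟩ := m.node_used i
  rw [m.fn_eq_lin (m.node_mem_elt K a), lin_node]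

lemma continuousOn_fn (U : Fin m.M → ℝ) : ContinuousOn (m.fn U) (closure Ω) := by
  rw [← m.iUnion_elt]
  refine LocallyFinite.continuousOn_iUnion (locallyFinite_of_finite _)
    (fun K => m.isClosed_elt K) fun K => ?_
  exact (m.continuous_lin K U).continuousOn.congr fun x hx => m.fn_eq_lin hx U

/-- Distinct elements have equally many vertices, so some vertex of K is not in K'. By conformity
its barycentric coordinate vanishes on the intersection, which therefore lies in the boundary of K,
a null set. -/
lemma volume_elt_inter {K K' : Fin m.nElt} (h : K ≠ K') :
    volume (m.elt K ∩ m.elt K') = 0 := by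
  have hsub : ¬ range (m.vert K) ⊆ range (m.vert K') := by
    intro hs
    refine h (m.vert_distinct K K' (Set.eq_of_subset_of_ncard_le hs ?_ (finite_range _)))
    rw [ncard_range_of_injective (m.vert_injective K), ncard_range_of_injective (m.vert_injective K')]
  obtain ⟨i, ⟨a, rfl⟩, hi⟩ := not_subset.1 hsub
  refine measure_mono_null (t := frontier (m.elt K)) ?_ (m.volume_frontier_elt K)
  rintro x ⟨hx, hx'⟩
  rw [(m.isClosed_elt K).frontier_eq]
  refine ⟨hx, fun hint => ?_⟩
  have h0 : (m.basis K).coord a x = 0 := by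
    have hc := m.conforming K K' ⟨hx, hx'⟩
    have hconv : Convex ℝ {y | (m.basis K).coord a y = 0} :=
      (convex_singleton (𝕜 := ℝ) (0 : ℝ)).affine_preimage ((m.basis K).coord a)
    refine convexHull_min ?_ hconv hc
    rintro _ ⟨i, ⟨⟨b, rfl⟩, hb⟩, rfl⟩
    have : a ≠ b := by rintro rfl; exact hi hb
    exact AffineBasis.coord_apply_ne (m.basis K) this
  have := m.mem_interior_elt_iff.1 hint a
  linarith

/-! ### Integrals over unions of elements -/

lemma setIntegral_biUnion_elt (s : Finset (Fin m.nElt)) {f : E d → ℝ}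
    (hf : ∀ K ∈ s, IntegrableOn f (m.elt K)) :
    ∫ x in ⋃ K ∈ s, m.elt K, f x = ∑ K ∈ s, ∫ x in m.elt K, f x := by
  classical
  induction s using Finset.induction_on with
  | empty => simp
  | insert K s hK ih =>
    rw [Finset.set_biUnion_insert, setIntegral_union₀, Finset.sum_insert hK, ih]
    · exact fun K' hK' => hf K' (Finset.mem_insert_of_mem hK')
    · refine measure_mono_null (t := ⋃ K' ∈ s, m.elt K ∩ m.elt K') ?_ ?_
      · rw [inter_iUnion₂]
      · refine (measure_biUnion_null_iff s.countable_toSet).2 fun K' hK' => ?_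
        exact m.volume_elt_inter (by rintro rfl; exact hK hK')
    · exact (Finset.measurableSet_biUnion s fun K _ => m.measurableSet_elt K).nullMeasurableSet
    · exact hf K (Finset.mem_insert_self _ _)
    · exact integrableOn_finset_iUnion.2 fun K' hK' => hf K' (Finset.mem_insert_of_mem hK')

lemma setIntegral_closure {f : E d → ℝ} (hf : IntegrableOn f (closure Ω)) :
    ∫ x in closure Ω, f x = ∑ K, ∫ x in m.elt K, f x := by
  have := m.setIntegral_biUnion_elt Finset.univ (f := f)
    (fun K _ => hf.mono_set (m.elt_subset_closure K))
  rw [← this, ← m.iUnion_elt]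
  simp

lemma lintegral_closure (f : E d → ℝ≥0∞) :
    ∫⁻ x in closure Ω, f x ≤ ∑ K, ∫⁻ x in m.elt K, f x := by
  rw [← m.iUnion_elt]
  exact (lintegral_iUnion_le _ f).trans (by rw [tsum_fintype])

lemma isCompact_closure (m : Mesh Ω) : IsCompact (closure Ω) := by
  rw [← m.iUnion_elt]
  exact isCompact_iUnion fun K => m.isCompact_elt K

end Mesh

/-! ### The boundary of a Lipschitz domain -/

/-- A Lipschitz domain has no cracks. A boundary point interior to the closure could be moved by
-ν/2 times a small ε and stay in the closure, where ψ ≤ ⟪ν, ·⟫; but ⟪ν, ·⟫ - ψ is nonpositive at the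
point and decreases strictly along the move. -/
lemma HasLipschitzBoundary.interior_closure {d : ℕ} {Ω : Set (E d)} (hL : HasLipschitzBoundary Ω)
    (ho : IsOpen Ω) : interior (closure Ω) = Ω := by
  refine Subset.antisymm (fun x hx => ?_) (interior_maximal subset_closure ho)
  by_contra hxΩ
  have hfr : x ∈ frontier Ω := by
    rw [ho.frontier_eq]; exact ⟨interior_subset hx, hxΩ⟩
  obtain ⟨ν, L, ψ, r, hν, hr, hψ, hinv, hmem⟩ := hL x hfr
  have hxψ : ⟪ν, x⟫ ≤ ψ x := by
    by_contra h
    exact hxΩ ((hmem x (Metric.mem_ball_self hr)).2 (not_le.1 h))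
  have hopen : IsOpen (interior (closure Ω) ∩ Metric.ball x r) :=
    isOpen_interior.inter Metric.isOpen_ball
  obtain ⟨ε, hε, hball⟩ := Metric.isOpen_iff.1 hopen x ⟨hx, Metric.mem_ball_self hr⟩
  set y := x + (-(ε / 2)) • ν with hy
  have hyb : y ∈ Metric.ball x ε := by
    simp only [hy, Metric.mem_ball, dist_self_add_left, norm_smul, hν, mul_one, norm_neg,
      Real.norm_eq_abs, abs_of_pos (half_pos hε)]
    linarith
  have hyc := hball hyb
  -- points of `Ω` near `y` lie in the epigraph
  have hcl : y ∈ closure (Ω ∩ Metric.ball x r) :=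
    Metric.isOpen_ball.closure_inter ⟨interior_subset hyc.1, hyc.2⟩
  have hcle : y ∈ {z | ψ z ≤ ⟪ν, z⟫} := by
    refine closure_minimal (fun z hz => ((hmem z hz.2).1 hz.1).le)
      (isClosed_le hψ.continuous (by fun_prop)) hcl
  have h1 : ψ y ≤ ⟪ν, y⟫ := hcle
  rw [hy, hinv, inner_add_right, real_inner_smul_right, real_inner_self_eq_norm_sq, hν] at h1
  linarith

namespace Mesh

variable {d : ℕ} {Ω : Set (E d)} (m : Mesh Ω)

/-- The domain and its closure only differ by a null set. -/
lemma closure_ae_eq (m : Mesh Ω) (hL : HasLipschitzBoundary Ω) (ho : IsOpen Ω) :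
    (closure Ω : Set (E d)) =ᵐ[volume] Ω := by
  refine LE.le.eventuallyLE (subset_closure : Ω ⊆ closure Ω) |>.antisymm ?_ |>.symm
  · rw [ae_le_set]
    -- A point interior to an element is interior to the closure of Ω, hence in Ω; the points of the
    -- closure outside Ω thus lie on faces.
    refine measure_mono_null (t := ⋃ K, frontier (m.elt K)) ?_
      (measure_iUnion_null fun K => m.volume_frontier_elt K)
    rintro x ⟨hx, hxΩ⟩
    obtain ⟨K, hK⟩ := m.exists_mem_elt hx
    refine mem_iUnion.2 ⟨K, ?_⟩
    rw [(m.isClosed_elt K).frontier_eq]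
    refine ⟨hK, fun hint => hxΩ ?_⟩
    rw [← hL.interior_closure ho]
    exact interior_mono (m.elt_subset_closure K) hint

end Mesh

end TwoPhase

namespace TwoPhase

namespace Mesh

variable {d : ℕ} {Ω : Set (E d)} (m : Mesh Ω)

/-! ### Integrals of piecewise linear functions -/

/-- The affine involution which exchanges two vertices of an element and fixes the others. -/
noncomputable def swap (K : Fin m.nElt) (a b : Fin (d + 1)) (x : E d) : E d :=
  x + ((m.basis K).coord a x - (m.basis K).coord b x) •
    (m.node (m.vert K b) - m.node (m.vert K a))

lemma coord_add_smul (K : Fin m.nElt) (c : Fin (d + 1)) (x p q : E d) (t : ℝ) :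
    (m.basis K).coord c (x + t • (q - p)) =
      (m.basis K).coord c x + t * ((m.basis K).coord c q - (m.basis K).coord c p) := by
  have h1 := m.coord_sub K c x (x + t • (q - p))
  rw [add_sub_cancel_left, real_inner_smul_right, ← m.coord_sub K c p q] at h1
  linarith

lemma coord_swap {K : Fin m.nElt} {a b : Fin (d + 1)} (hab : a ≠ b) (c : Fin (d + 1)) (x : E d) :
    (m.basis K).coord c (m.swap K a b x) = (m.basis K).coord (Equiv.swap a b c) x := by
  have hn : ∀ c', m.node (m.vert K c') = m.basis K c' := fun _ => rfl
  rw [swap, coord_add_smul, hn, hn]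
  rcases eq_or_ne c a with rfl | hca
  · rw [AffineBasis.coord_apply_eq, AffineBasis.coord_apply_ne _ hab, Equiv.swap_apply_left]; ring
  rcases eq_or_ne c b with rfl | hcb
  · rw [AffineBasis.coord_apply_eq, AffineBasis.coord_apply_ne _ hca, Equiv.swap_apply_right]; ring
  · rw [AffineBasis.coord_apply_ne _ hcb, AffineBasis.coord_apply_ne _ hca,
      Equiv.swap_apply_of_ne_of_ne hca hcb]; ring

lemma swap_involutive {K : Fin m.nElt} {a b : Fin (d + 1)} (hab : a ≠ b) :
    Function.Involutive (m.swap K a b) := fun x => by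
  conv_lhs => rw [swap, coord_swap m hab, coord_swap m hab, Equiv.swap_apply_left,
    Equiv.swap_apply_right, swap]
  rw [add_assoc, ← add_smul]
  simp

/-- The linear part of `swap`. -/
noncomputable def swapLin (K : Fin m.nElt) (a b : Fin (d + 1)) : E d →ₗ[ℝ] E d :=
  LinearMap.id + (((m.basis K).coord a).linear - ((m.basis K).coord b).linear).smulRight
    (m.node (m.vert K b) - m.node (m.vert K a))

lemma swap_eq (K : Fin m.nElt) (a b : Fin (d + 1)) (x : E d) :
    m.swap K a b x = m.swapLin K a b x + m.swap K a b 0 := by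
  have h : ∀ c, (m.basis K).coord c x = ((m.basis K).coord c).linear x + (m.basis K).coord c 0 := by
    intro c
    have := ((m.basis K).coord c).linearMap_vsub x 0
    simp only [vsub_eq_sub, sub_zero] at this
    rw [this]; ring
  simp only [swap, swapLin, LinearMap.add_apply, LinearMap.id_apply, LinearMap.smulRight_apply,
    LinearMap.sub_apply, h a, h b, zero_add]
  rw [add_assoc, ← add_smul]
  congr 2
  ring

/-- The linear part of an affine involution is an involution, so its determinant has square 1. -/
lemma abs_det_swapLin {K : Fin m.nElt} {a b : Fin (d + 1)} (hab : a ≠ b) :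
    |LinearMap.det (m.swapLin K a b)| = 1 := by
  have hinv : m.swapLin K a b ∘ₗ m.swapLin K a b = LinearMap.id := by
    ext1 x
    have h0 := m.swap_involutive hab (K := K) 0
    have hx := m.swap_involutive hab (K := K) x
    rw [swap_eq] at h0
    rw [swap_eq, swap_eq m K a b x, map_add, add_assoc, h0, add_zero] at hx
    exact hx
  have : LinearMap.det (m.swapLin K a b) * LinearMap.det (m.swapLin K a b) = 1 := by
    rw [← LinearMap.det_comp, hinv, LinearMap.det_id]
  rw [← abs_mul_abs_self] at this
  nlinarith [abs_nonneg (LinearMap.det (m.swapLin K a b))]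

lemma continuous_swap (K : Fin m.nElt) (a b : Fin (d + 1)) : Continuous (m.swap K a b) := by
  have h1 := m.continuous_coord K a
  have h2 := m.continuous_coord K b
  unfold swap
  fun_prop

lemma measurePreserving_swap {K : Fin m.nElt} {a b : Fin (d + 1)} (hab : a ≠ b) :
    MeasurePreserving (m.swap K a b) (volume : Measure (E d)) volume := by
  have hdet := m.abs_det_swapLin (K := K) hab
  have hne : LinearMap.det (m.swapLin K a b) ≠ 0 := by
    intro h; rw [h] at hdet; simp at hdet
  have h1 : MeasurePreserving (m.swapLin K a b) (volume : Measure (E d)) volume := by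
    refine ⟨(LinearMap.continuous_of_finiteDimensional _).measurable, ?_⟩
    rw [Measure.map_linearMap_addHaar_eq_smul_addHaar _ hne, abs_inv, hdet]
    simp
  have h2 := (measurePreserving_add_right (volume : Measure (E d)) (m.swap K a b 0)).comp h1
  have h3 : (fun x => x + m.swap K a b 0) ∘ (m.swapLin K a b) = m.swap K a b := by
    ext1 x; rw [Function.comp_apply, ← swap_eq]
  rwa [h3] at h2

/-- Exchanging two vertices preserves both the element and Lebesgue measure. All barycentric
coordinates then have the same integral, and as they sum to 1 it equals |K|/(d+1). -/
lemma integral_coord_eq {K : Fin m.nElt} {a b : Fin (d + 1)} (hab : a ≠ b) :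
    ∫ x in m.elt K, (m.basis K).coord a x = ∫ x in m.elt K, (m.basis K).coord b x := by
  let e : E d ≃ᵐ E d :=
    { toEquiv := (m.swap_involutive (K := K) hab).toPerm
      measurable_toFun := (m.continuous_swap K a b).measurable
      measurable_invFun := (m.continuous_swap K a b).measurable }
  have h := (m.measurePreserving_swap (K := K) hab).setIntegral_preimage_emb
    e.measurableEmbedding (fun x => (m.basis K).coord a x) (m.elt K)
  have hpre : m.swap K a b ⁻¹' m.elt K = m.elt K := by
    ext x
    simp only [mem_preimage, mem_elt_iff, coord_swap m hab]
    refine ⟨fun h c => ?_, fun h c => h _⟩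
    simpa using h (Equiv.swap a b c)
  rw [← h, hpre]
  refine integral_congr_ae (ae_of_all _ fun x => ?_)
  simp only [coord_swap m hab, Equiv.swap_apply_left]

lemma integrableOn_elt {f : E d → ℝ} (hf : Continuous f) (K : Fin m.nElt) :
    IntegrableOn f (m.elt K) :=
  hf.continuousOn.integrableOn_compact (m.isCompact_elt K)

lemma integral_coord (K : Fin m.nElt) (a : Fin (d + 1)) :
    ∫ x in m.elt K, (m.basis K).coord a x = m.vol K / (d + 1) := by
  have h : ∀ b, ∫ x in m.elt K, (m.basis K).coord b x = ∫ x in m.elt K, (m.basis K).coord a x := by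
    intro b
    rcases eq_or_ne b a with rfl | hb
    · rfl
    · exact m.integral_coord_eq hb
  have hsum : ∑ b, ∫ x in m.elt K, (m.basis K).coord b x = m.vol K := by
    rw [← integral_finsetSum _ fun b _ => m.integrableOn_elt (m.continuous_coord K b) K]
    simp [vol]
  rw [Finset.sum_congr rfl fun b _ => h b] at hsum
  simp only [Finset.sum_const, Finset.card_univ, Fintype.card_fin, nsmul_eq_mul, Nat.cast_add,
    Nat.cast_one] at hsum
  rw [← hsum]
  field_simp

lemma integral_lin (K : Fin m.nElt) (U : Fin m.M → ℝ) :
    ∫ x in m.elt K, m.lin K U x = m.vol K / (d + 1) * ∑ a, U (m.vert K a) := by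
  simp only [lin_apply]
  rw [integral_finsetSum _ fun a _ => (m.integrableOn_elt (m.continuous_coord K a) K).const_mul _]
  simp only [integral_const_mul, integral_coord]
  rw [Finset.mul_sum]
  exact Finset.sum_congr rfl fun a _ => mul_comm _ _

/-! ### Sums over nodes and sums over elements -/

lemma mem_elts {i : Fin m.M} {K : Fin m.nElt} : K ∈ m.elts i ↔ i ∈ range (m.vert K) := by
  simp [elts]

/-- Exchange of summation, each element being seen from its d+1 vertices. It is applied both to the
volumes and to the integrals of a function over the elements. -/
lemma sum_elts_mul (w : Fin m.nElt → ℝ) (f : Fin m.M → ℝ) :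
    ∑ i, (∑ K ∈ m.elts i, w K) * f i = ∑ K, w K * ∑ a, f (m.vert K a) := by
  classical
  simp only [elts, Finset.sum_filter, Finset.sum_mul]
  rw [Finset.sum_comm]
  refine Finset.sum_congr rfl fun K _ => ?_
  rw [Finset.mul_sum, ← Finset.sum_image (s := Finset.univ) (f := fun i => w K * f i)
    (m.vert_injective K).injOn, ← Finset.sum_subset (Finset.subset_univ (Finset.univ.image (m.vert K)))]
  · refine Finset.sum_congr rfl fun i hi => ?_
    rw [if_pos]
    simpa using hi
  · intro i _ hi
    rw [if_neg, zero_mul]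
    simpa using hi

lemma sum_mass_mul (f : Fin m.M → ℝ) :
    ∑ i, m.mass i * f i = 1 / ((d : ℝ) + 1) * ∑ K, m.vol K * ∑ a, f (m.vert K a) := by
  rw [← sum_elts_mul, Finset.mul_sum]
  exact Finset.sum_congr rfl fun i _ => by rw [mass, mul_assoc]; rfl

lemma mass_pos (i : Fin m.M) : 0 < m.mass i := by
  obtain ⟨K, a, h⟩ := m.node_used i
  have : 0 < ∑ K ∈ m.elts i, m.vol K :=
    Finset.sum_pos (fun K _ => m.vol_pos K) ⟨K, m.mem_elts.2 ⟨a, h⟩⟩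
  unfold mass vol at *
  positivity

lemma vol_le_mass {i : Fin m.M} {K : Fin m.nElt} (h : i ∈ range (m.vert K)) :
    m.vol K ≤ (d + 1) * m.mass i := by
  have : m.vol K ≤ ∑ K ∈ m.elts i, m.vol K :=
    Finset.single_le_sum (f := m.vol) (fun K _ => m.vol_nonneg K) (m.mem_elts.2 h)
  have h2 : (d + 1) * m.mass i = ∑ K ∈ m.elts i, m.vol K := by
    unfold mass vol
    field_simp
  linarith

lemma patch_subset_closure (i : Fin m.M) : m.patch i ⊆ closure Ω :=
  iUnion₂_subset fun K _ => m.elt_subset_closure K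

lemma volume_closure_ne_top (m : Mesh Ω) : volume (closure Ω) ≠ ∞ :=
  m.isCompact_closure.measure_lt_top.ne

lemma setIntegral_patch {f : E d → ℝ} (hf : IntegrableOn f (closure Ω)) (i : Fin m.M) :
    ∫ x in m.patch i, f x = ∑ K ∈ m.elts i, ∫ x in m.elt K, f x :=
  m.setIntegral_biUnion_elt _ fun K _ => hf.mono_set (m.elt_subset_closure K)

lemma volume_patch (i : Fin m.M) : volume.real (m.patch i) = (d + 1) * m.mass i := by
  have h := m.setIntegral_patch (f := fun _ => 1) (integrableOn_const m.volume_closure_ne_top) i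
  simp only [setIntegral_const, smul_eq_mul, mul_one] at h
  rw [h, mass]
  field_simp

lemma volume_real_closure (m : Mesh Ω) : volume.real (closure Ω) = ∑ K, m.vol K := by
  have h := m.setIntegral_closure (f := fun _ => 1) (integrableOn_const m.volume_closure_ne_top)
  simpa only [setIntegral_const, smul_eq_mul, mul_one, vol] using h

lemma sum_mass (m : Mesh Ω) : ∑ i, m.mass i = volume.real (closure Ω) := by
  have h := m.sum_mass_mul fun _ => 1
  simp only [mul_one] at h
  rw [h, m.volume_real_closure]
  simp only [Finset.sum_const, Finset.card_univ, Fintype.card_fin, nsmul_eq_mul, mul_one,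
    ← Finset.sum_mul]
  push_cast
  field_simp

lemma integrableOn_fn (U : Fin m.M → ℝ) : IntegrableOn (m.fn U) (closure Ω) :=
  (m.continuousOn_fn U).integrableOn_compact m.isCompact_closure

/-- Mass lumping is exact on piecewise linear functions. -/
lemma integral_fn (U : Fin m.M → ℝ) : ∫ x in closure Ω, m.fn U x = ∑ i, m.mass i * U i := by
  rw [m.setIntegral_closure (m.integrableOn_fn U), sum_mass_mul, Finset.mul_sum]
  refine Finset.sum_congr rfl fun K _ => ?_
  rw [setIntegral_congr_fun (m.measurableSet_elt K) fun x hx => m.fn_eq_lin hx U, integral_lin]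
  ring

lemma mass_mul_rh {f : E d → ℝ} (i : Fin m.M) :
    m.mass i * m.rh f i = 1 / ((d : ℝ) + 1) * ∫ x in m.patch i, f x := by
  have := m.mass_pos i
  rw [rh, setAverage_eq, volume_patch, smul_eq_mul]
  field_simp

/-- Almost every point lies in d+1 patches. Together with `mass_mul_rh` this shows that r_h
preserves the integral, so that the correction in the discrete flow rates is zero. -/
lemma sum_integral_patch {f : E d → ℝ} (hf : IntegrableOn f (closure Ω)) :
    ∑ i, ∫ x in m.patch i, f x = (d + 1) * ∫ x in closure Ω, f x := by
  have h := m.sum_elts_mul (fun K => ∫ x in m.elt K, f x) fun _ => 1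
  simp only [mul_one, Finset.sum_const, Finset.card_univ, Fintype.card_fin, nsmul_eq_mul] at h
  rw [Finset.sum_congr rfl fun i _ => m.setIntegral_patch hf i, h, ← Finset.sum_mul,
    m.setIntegral_closure hf]
  push_cast
  ring

lemma sum_mass_mul_rh {f : E d → ℝ} (hf : IntegrableOn f (closure Ω)) :
    ∑ i, m.mass i * m.rh f i = ∫ x in closure Ω, f x := by
  simp only [mass_mul_rh, ← Finset.mul_sum, m.sum_integral_patch hf]
  field_simp

/-- The correction of the discrete flow rates vanishes. -/
lemma rhCorr_eq_rh (hL : HasLipschitzBoundary Ω) (ho : IsOpen Ω) {f : E d → ℝ}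
    (hf : IntegrableOn f Ω) (i : Fin m.M) : m.rhCorr f i = m.rh f i := by
  have hae := m.closure_ae_eq hL ho
  have hf' : IntegrableOn f (closure Ω) := by rwa [integrableOn_congr_set_ae hae]
  rw [rhCorr, ← setIntegral_congr_set hae, integral_sub (m.integrableOn_fn _) hf', integral_fn,
    m.sum_mass_mul_rh hf', sub_self, mul_zero, sub_zero]

/-! ### The coefficients of the discrete Laplace operator -/

/-- The gradient on `K` of the basis function `φ_i`. -/
noncomputable def gradHat (K : Fin m.nElt) (i : Fin m.M) : E d := m.grad K (Pi.single i 1)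

lemma gradHat_vert (K : Fin m.nElt) (a : Fin (d + 1)) :
    m.gradHat K (m.vert K a) = m.gradCoord K a := by
  rw [gradHat, grad, Finset.sum_eq_single a]
  · simp
  · intro b _ hb
    rw [Pi.single_eq_of_ne fun h => hb (m.vert_injective K h), zero_smul]
  · simp

lemma gradHat_of_notMem {K : Fin m.nElt} {i : Fin m.M} (h : i ∉ range (m.vert K)) :
    m.gradHat K i = 0 := by
  rw [gradHat, grad]
  refine Finset.sum_eq_zero fun a _ => ?_
  rw [Pi.single_eq_of_ne fun h' => h ⟨a, h'⟩, zero_smul]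

lemma hat_eq_fn (i : Fin m.M) : m.hat i = m.fn (Pi.single i 1) := by
  ext x
  simp [fn, Pi.single_apply]

lemma gradient_hat {K : Fin m.nElt} {x : E d} (hx : x ∈ interior (m.elt K)) (i : Fin m.M) :
    gradient (m.hat i) x = m.gradHat K i := by
  have h1 : HasGradientAt (m.lin K (Pi.single i 1)) (m.gradHat K i) x := by
    have h : ∀ y, m.lin K (Pi.single i 1) y =
        ⟪m.gradHat K i, y⟫ + (m.lin K (Pi.single i 1) 0) := by
      intro y
      have := m.lin_sub K (Pi.single i 1) 0 y
      rw [sub_zero] at this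
      rw [gradHat, ← this]; ring
    rw [funext h, hasGradientAt_iff_hasFDerivAt]
    exact ((InnerProductSpace.toDual ℝ (E d)) (m.gradHat K i)).hasFDerivAt.add_const _
  rw [← h1.gradient]
  refine Filter.EventuallyEq.gradient_eq ?_
  filter_upwards [mem_interior_iff_mem_nhds.1 hx] with y hy
  rw [hat_eq_fn, m.fn_eq_lin hy]

/-- Gradients of basis functions are constant inside elements, faces are null sets, and outside Δ_i
∩ Δ_j one of the two gradients vanishes almost everywhere. -/
lemma c_eq (i j : Fin m.M) :
    m.c i j = ∑ K, m.vol K * |⟪m.gradHat K i, m.gradHat K j⟫| := by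
  have hae : ∀ K, ∀ᵐ x ∂(volume.restrict (m.elt K)), x ∈ interior (m.elt K) := by
    intro K
    rw [← Measure.restrict_congr_set (m.interior_ae_eq_elt K)]
    exact ae_restrict_mem isOpen_interior.measurableSet
  have hK : ∀ K, ∀ᵐ x ∂(volume.restrict (m.elt K)),
      |⟪gradient (m.hat i) x, gradient (m.hat j) x⟫| = |⟪m.gradHat K i, m.gradHat K j⟫| := by
    intro K
    filter_upwards [hae K] with x hx
    rw [m.gradient_hat hx, m.gradient_hat hx]
  have hint : ∀ K, IntegrableOn (fun x => |⟪gradient (m.hat i) x, gradient (m.hat j) x⟫|)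
      (m.elt K) := fun K =>
    (integrableOn_const (m.volume_elt_ne_top K)).congr_fun_ae ((hK K).mono fun x hx => hx.symm)
  have hcl : IntegrableOn (fun x => |⟪gradient (m.hat i) x, gradient (m.hat j) x⟫|)
      (closure Ω) := by
    rw [← m.iUnion_elt]
    exact integrableOn_finite_iUnion.2 hint
  have h0 : ∀ᵐ x, x ∈ closure Ω \ (m.patch i ∩ m.patch j) →
      |⟪gradient (m.hat i) x, gradient (m.hat j) x⟫| = 0 := by
    have : ∀ᵐ x, ∀ K, x ∉ frontier (m.elt K) :=
      ae_all_iff.2 fun K => measure_eq_zero_iff_ae_notMem.1 (m.volume_frontier_elt K)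
    filter_upwards [this] with x hx hx'
    obtain ⟨K, hK⟩ := m.exists_mem_elt hx'.1
    have hxi : x ∈ interior (m.elt K) := by
      by_contra h
      exact hx K (by rw [(m.isClosed_elt K).frontier_eq]; exact ⟨hK, h⟩)
    rw [m.gradient_hat hxi, m.gradient_hat hxi]
    by_cases hi : i ∈ range (m.vert K)
    · by_cases hj : j ∈ range (m.vert K)
      · exact absurd ⟨mem_biUnion (m.mem_elts.2 hi) hK, mem_biUnion (m.mem_elts.2 hj) hK⟩ hx'.2
      · rw [m.gradHat_of_notMem hj, inner_zero_right, abs_zero]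
    · rw [m.gradHat_of_notMem hi, inner_zero_left, abs_zero]
  rw [c, ← setIntegral_eq_of_subset_of_ae_sdiff_eq_zero isClosed_closure.nullMeasurableSet
    (inter_subset_left.trans (m.patch_subset_closure i)) h0, m.setIntegral_closure hcl]
  refine Finset.sum_congr rfl fun K _ => ?_
  rw [integral_congr_ae (hK K), setIntegral_const, smul_eq_mul, vol]

lemma c_nonneg (i j : Fin m.M) : 0 ≤ m.c i j := integral_nonneg fun _ => abs_nonneg _

lemma c_comm (i j : Fin m.M) : m.c i j = m.c j i := by
  simp only [c_eq, real_inner_comm]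

/-- A sum over all nodes of terms vanishing off `K`, as a sum over the vertices of `K`. -/
lemma sum_eq_sum_vert (K : Fin m.nElt) {f : Fin m.M → ℝ} (hf : ∀ i ∉ range (m.vert K), f i = 0) :
    ∑ i, f i = ∑ a, f (m.vert K a) := by
  classical
  rw [← Finset.sum_image (s := Finset.univ) (f := f) (m.vert_injective K).injOn]
  refine (Finset.sum_subset (Finset.subset_univ _) fun i _ hi => hf i ?_).symm
  simpa using hi

lemma sum_sum_c_mul (f : Fin m.M → Fin m.M → ℝ) :
    ∑ i, ∑ j, m.c i j * f i j = ∑ K, m.vol K *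
      ∑ a, ∑ b, |⟪m.gradCoord K a, m.gradCoord K b⟫| * f (m.vert K a) (m.vert K b) := by
  simp only [c_eq, Finset.sum_mul]
  rw [Finset.sum_congr rfl fun i _ => Finset.sum_comm, Finset.sum_comm]
  refine Finset.sum_congr rfl fun K _ => ?_
  rw [Finset.mul_sum, m.sum_eq_sum_vert K]
  · refine Finset.sum_congr rfl fun a _ => ?_
    rw [Finset.mul_sum, m.sum_eq_sum_vert K]
    · simp only [gradHat_vert, mul_assoc]
    · intro j hj
      rw [m.gradHat_of_notMem hj, inner_zero_right, abs_zero, mul_zero, zero_mul]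
  · intro i hi
    refine Finset.sum_eq_zero fun j _ => ?_
    rw [m.gradHat_of_notMem hi, inner_zero_left, abs_zero, mul_zero, zero_mul]

lemma sum_gradCoord (K : Fin m.nElt) : ∑ a, m.gradCoord K a = 0 := by
  refine ext_inner_right ℝ fun v => ?_
  rw [sum_inner, inner_zero_left]
  have : ∀ a, ⟪m.gradCoord K a, v⟫ = (m.basis K).coord a v - (m.basis K).coord a 0 := by
    intro a; rw [coord_sub, sub_zero]
  simp only [this, Finset.sum_sub_distrib, sum_coord, sub_self]

/-- The integral of the squared gradient of the finite element function of nodal values `U`. -/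
noncomputable def dirichlet (U : Fin m.M → ℝ) : ℝ := ∑ K, m.vol K * ‖m.grad K U‖ ^ 2

lemma dirichlet_nonneg (U : Fin m.M → ℝ) : 0 ≤ m.dirichlet U :=
  Finset.sum_nonneg fun K _ => mul_nonneg (m.vol_nonneg K) (sq_nonneg _)

/-- The barycentric gradients sum to zero, so the rows of their Gram matrix sum to zero and the
squared terms vanish when the differences are expanded. -/
lemma two_mul_norm_grad_sq (K : Fin m.nElt) (U : Fin m.M → ℝ) :
    2 * ‖m.grad K U‖ ^ 2 = -∑ a, ∑ b, ⟪m.gradCoord K a, m.gradCoord K b⟫ *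
      (U (m.vert K a) - U (m.vert K b)) ^ 2 := by
  have hs : ∀ w : Fin (d + 1) → ℝ, ∑ a, ∑ b, ⟪m.gradCoord K a, m.gradCoord K b⟫ * w a = 0 := by
    intro w
    refine Finset.sum_eq_zero fun a _ => ?_
    rw [← Finset.sum_mul, ← inner_sum, sum_gradCoord, inner_zero_right, zero_mul]
  have hs' : ∀ w : Fin (d + 1) → ℝ, ∑ a, ∑ b, ⟪m.gradCoord K a, m.gradCoord K b⟫ * w b = 0 := by
    intro w
    rw [Finset.sum_comm]
    simpa only [real_inner_comm] using hs w
  have h1 := hs fun a => U (m.vert K a) ^ 2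
  have h2 := hs' fun a => U (m.vert K a) ^ 2
  have h3 : ‖m.grad K U‖ ^ 2 = ∑ a, ∑ b, ⟪m.gradCoord K a, m.gradCoord K b⟫ *
      (U (m.vert K a) * U (m.vert K b)) := by
    rw [← real_inner_self_eq_norm_sq, grad, sum_inner]
    refine Finset.sum_congr rfl fun a _ => ?_
    rw [inner_sum]
    refine Finset.sum_congr rfl fun b _ => ?_
    rw [real_inner_smul_left, real_inner_smul_right]; ring
  have h4 : ∑ a, ∑ b, ⟪m.gradCoord K a, m.gradCoord K b⟫ *
      (U (m.vert K a) - U (m.vert K b)) ^ 2 =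
      ∑ a, ∑ b, ⟪m.gradCoord K a, m.gradCoord K b⟫ * U (m.vert K a) ^ 2 +
      ∑ a, ∑ b, ⟪m.gradCoord K a, m.gradCoord K b⟫ * U (m.vert K b) ^ 2 -
      2 * ∑ a, ∑ b, ⟪m.gradCoord K a, m.gradCoord K b⟫ * (U (m.vert K a) * U (m.vert K b)) := by
    simp only [Finset.mul_sum, ← Finset.sum_add_distrib, ← Finset.sum_sub_distrib]
    refine Finset.sum_congr rfl fun a _ => Finset.sum_congr rfl fun b _ => ?_
    ring
  rw [h4, h1, h2, h3]
  ring

/-! ### Gradients of barycentric coordinates and altitudes -/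

/-- The altitude is orthogonal to the opposite facet, so the vector on the right has the correct
product with each vertex measured from the foot; affine combinations of the vertices give all
points. This translates angles and inradii into information on the gradients. -/
lemma gradCoord_eq [NeZero d] (K : Fin m.nElt) (a : Fin (d + 1)) :
    m.gradCoord K a = ((m.simplex K).height a ^ 2)⁻¹ •
      ((m.simplex K).points a -ᵥ (m.simplex K).altitudeFoot a) := by
  set s := m.simplex K
  set w := (s.height a ^ 2)⁻¹ • (s.points a -ᵥ s.altitudeFoot a) with hw
  have hpos : 0 < s.height a := s.height_pos a
  have hdelta : ∀ c, ⟪w, s.points c - s.altitudeFoot a⟫ = if c = a then 1 else 0 := by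
    intro c
    rw [hw, real_inner_smul_left, real_inner_comm]
    split_ifs with h
    · subst h
      rw [vsub_eq_sub, real_inner_self_eq_norm_sq, ← dist_eq_norm]
      exact inv_mul_cancel₀ (pow_pos hpos 2).ne'
    · have := s.inner_vsub_altitudeFoot_vsub_altitudeFoot_eq_zero (Ne.symm h)
      rw [← vsub_eq_sub (s.points c), this, mul_zero]
  have hcoord : ∀ y, ⟪w, y - s.altitudeFoot a⟫ = (m.basis K).coord a y := by
    intro y
    have hy : y - s.altitudeFoot a =
        ∑ c, (m.basis K).coord c y • (s.points c - s.altitudeFoot a) := by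
      simp only [smul_sub, Finset.sum_sub_distrib, ← Finset.sum_smul, sum_coord, one_smul]
      congr 1
      exact ((m.basis K).linear_combination_coord_eq_self y).symm
    rw [hy, inner_sum]
    simp [real_inner_smul_right, hdelta]
  refine ext_inner_right ℝ fun v => ?_
  have h1 := m.coord_sub K a 0 v
  rw [← hcoord, ← hcoord, ← inner_sub_right] at h1
  rw [sub_sub_sub_cancel_right, sub_zero] at h1
  exact h1.symm

lemma norm_gradCoord [NeZero d] (K : Fin m.nElt) (a : Fin (d + 1)) :
    ‖m.gradCoord K a‖ = ((m.simplex K).height a)⁻¹ := by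
  have hpos : 0 < (m.simplex K).height a := (m.simplex K).height_pos a
  have h : ‖(m.simplex K).points a -ᵥ (m.simplex K).altitudeFoot a‖ = (m.simplex K).height a := by
    rw [← dist_eq_norm_vsub]; rfl
  rw [gradCoord_eq, norm_smul, h, norm_inv, norm_pow, Real.norm_eq_abs, abs_of_pos hpos]
  field_simp

/-- The barycentric gradients are inward normals, whose angle is the supplement of the dihedral
angle, hence at least π/2. -/
lemma Nonobtuse.inner_gradCoord_nonpos [NeZero d] {m : Mesh Ω} (h : m.Nonobtuse) (K : Fin m.nElt)
    {a b : Fin (d + 1)} (hab : a ≠ b) : ⟪m.gradCoord K a, m.gradCoord K b⟫ ≤ 0 := by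
  have h1 := h K a b hab
  rw [dihedralAngle] at h1
  have h2 : Real.pi / 2 ≤ InnerProductGeometry.angle
      ((m.simplex K).points a -ᵥ (m.simplex K).altitudeFoot a)
      ((m.simplex K).points b -ᵥ (m.simplex K).altitudeFoot b) := by linarith
  rw [gradCoord_eq, gradCoord_eq, real_inner_smul_left, real_inner_smul_right]
  have h4 : ⟪(m.simplex K).points a -ᵥ (m.simplex K).altitudeFoot a,
      (m.simplex K).points b -ᵥ (m.simplex K).altitudeFoot b⟫ ≤ 0 := by
    rw [← InnerProductGeometry.cos_angle_mul_norm_mul_norm]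
    refine mul_nonpos_of_nonpos_of_nonneg (Real.cos_nonpos_of_pi_div_two_le_of_le h2 ?_)
      (by positivity)
    have := InnerProductGeometry.angle_le_pi ((m.simplex K).points a -ᵥ (m.simplex K).altitudeFoot a)
      ((m.simplex K).points b -ᵥ (m.simplex K).altitudeFoot b)
    linarith [Real.pi_pos]
  refine mul_nonpos_of_nonneg_of_nonpos (by positivity)
    (mul_nonpos_of_nonneg_of_nonpos (by positivity) h4)

/-- On a nonobtuse mesh, the discrete Dirichlet form is the continuous one. -/
lemma Nonobtuse.sum_c_mul_sq [NeZero d] {m : Mesh Ω} (h : m.Nonobtuse) (U : Fin m.M → ℝ) :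
    ∑ i, ∑ j, m.c i j * (U i - U j) ^ 2 = 2 * m.dirichlet U := by
  rw [m.sum_sum_c_mul fun i j => (U i - U j) ^ 2, dirichlet, Finset.mul_sum]
  refine Finset.sum_congr rfl fun K _ => ?_
  rw [mul_left_comm, two_mul_norm_grad_sq]
  simp only [← Finset.sum_neg_distrib]
  congr 1
  refine Finset.sum_congr rfl fun a _ => Finset.sum_congr rfl fun b _ => ?_
  -- The absolute value in c_ij is removed by the sign of the off-diagonal products; diagonal terms
  -- carry a zero difference.
  rcases eq_or_ne a b with rfl | hab
  · simp
  · rw [abs_of_nonpos (h.inner_gradCoord_nonpos K hab)]; ring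

end Mesh

end TwoPhase

namespace TwoPhase

namespace Mesh

variable {d : ℕ} {Ω : Set (E d)} (m : Mesh Ω)

/-! ### Shape regularity -/

/-- The diameter of an element. -/
noncomputable def diam (K : Fin m.nElt) : ℝ := Metric.diam (m.elt K)

lemma diam_nonneg (K : Fin m.nElt) : 0 ≤ m.diam K := Metric.diam_nonneg

lemma dist_le_diam {K : Fin m.nElt} {x y : E d} (hx : x ∈ m.elt K) (hy : y ∈ m.elt K) :
    dist x y ≤ m.diam K :=
  Metric.dist_le_diam_of_mem (m.isCompact_elt K).isBounded hx hy

lemma diam_pos [NeZero d] (K : Fin m.nElt) : 0 < m.diam K := by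
  have h01 : (0 : Fin (d + 1)) ≠ Fin.last d := by
    intro h
    have := congrArg Fin.val h
    simp at this
    exact NeZero.ne d this.symm
  have h : m.node (m.vert K 0) ≠ m.node (m.vert K (Fin.last d)) := fun h =>
    h01 ((m.affineIndependent K).injective h)
  exact (dist_pos.2 h).trans_le (m.dist_le_diam (m.node_mem_elt K _) (m.node_mem_elt K _))

/-- The oscillation of a linear function in an element. -/
lemma abs_lin_sub_le {K : Fin m.nElt} (U : Fin m.M → ℝ) {x y : E d} (hx : x ∈ m.elt K)
    (hy : y ∈ m.elt K) : |m.lin K U x - m.lin K U y| ≤ ‖m.grad K U‖ * m.diam K := by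
  rw [lin_sub]
  refine (abs_real_inner_le_norm _ _).trans ?_
  gcongr
  rw [← dist_eq_norm]
  exact m.dist_le_diam hx hy

lemma abs_sub_le_norm_grad (K : Fin m.nElt) (U : Fin m.M → ℝ) (a b : Fin (d + 1)) :
    |U (m.vert K a) - U (m.vert K b)| ≤ ‖m.grad K U‖ * m.diam K := by
  have := m.abs_lin_sub_le U (m.node_mem_elt K a) (m.node_mem_elt K b)
  rwa [lin_node, lin_node] at this

/-- The inverse of the inradius is the sum of the inverse heights, and the norm of a barycentric
gradient is one of these inverses. -/
lemma norm_gradCoord_mul_inradius_le [NeZero d] (K : Fin m.nElt) (a : Fin (d + 1)) :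
    ‖m.gradCoord K a‖ * (m.simplex K).inradius ≤ 1 := by
  have hpos : ∀ b, 0 < ((m.simplex K).height b)⁻¹ := fun b => inv_pos.2 ((m.simplex K).height_pos b)
  have hle : ((m.simplex K).height a)⁻¹ ≤ ∑ b, ((m.simplex K).height b)⁻¹ :=
    Finset.single_le_sum (f := fun b => ((m.simplex K).height b)⁻¹) (fun b _ => (hpos b).le)
      (Finset.mem_univ a)
  have hsum := (hpos a).trans_le hle
  rw [norm_gradCoord, Affine.Simplex.inradius_eq_abs_inv_sum]
  simp only [Affine.Simplex.excenterWeightsUnnorm_empty_apply]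
  rw [abs_of_pos (inv_pos.2 hsum), ← div_eq_mul_inv]
  exact (div_le_one hsum).2 hle

variable {m}

lemma Regular.pos [NeZero d] {σ : ℝ} (h : m.Regular σ) (K : Fin m.nElt) : 0 < σ := by
  by_contra hσ
  have h1 := h K
  have h2 := m.diam_pos K
  have h3 := (m.simplex K).inradius_pos
  rw [diam] at h2
  nlinarith [mul_nonneg (neg_nonneg.2 (not_lt.1 hσ)) h3.le]

lemma Regular.norm_gradCoord_mul_diam_le [NeZero d] {σ : ℝ} (h : m.Regular σ) (K : Fin m.nElt)
    (a : Fin (d + 1)) : ‖m.gradCoord K a‖ * m.diam K ≤ 2 * σ := by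
  have h1 := m.norm_gradCoord_mul_inradius_le K a
  have hσ := h.pos K
  calc ‖m.gradCoord K a‖ * m.diam K
      ≤ ‖m.gradCoord K a‖ * (σ * (2 * (m.simplex K).inradius)) :=
        mul_le_mul_of_nonneg_left (h K) (norm_nonneg _)
    _ = 2 * σ * (‖m.gradCoord K a‖ * (m.simplex K).inradius) := by ring
    _ ≤ 2 * σ * 1 := by gcongr
    _ = 2 * σ := mul_one _

/-- The volume of the unit ball. -/
noncomputable def unitVol (d : ℕ) : ℝ := volume.real (Metric.ball (0 : E d) 1)

lemma unitVol_pos (d : ℕ) : 0 < unitVol d := by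
  refine ENNReal.toReal_pos (Metric.measure_ball_pos volume _ one_pos).ne' measure_ball_lt_top.ne

lemma volume_real_ball [NeZero d] (x : E d) {r : ℝ} (hr : 0 ≤ r) :
    volume.real (Metric.ball x r) = r ^ d * unitVol d := by
  have : Nontrivial (E d) := by
    refine Module.nontrivial_of_finrank_pos (R := ℝ) ?_
    simpa using Nat.pos_of_ne_zero (NeZero.ne d)
  rw [Measure.real, Measure.addHaar_ball volume x hr, ENNReal.toReal_mul,
    ENNReal.toReal_ofReal (by positivity), finrank_euclideanSpace_fin]
  rfl

lemma volume_real_closedBall [NeZero d] (x : E d) {r : ℝ} (hr : 0 ≤ r) :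
    volume.real (Metric.closedBall x r) = r ^ d * unitVol d := by
  rw [Measure.real, Measure.addHaar_closedBall volume x hr, ENNReal.toReal_mul,
    ENNReal.toReal_ofReal (by positivity), finrank_euclideanSpace_fin]
  rfl

/-- The lower bound of the volume of an element of unit diameter. -/
noncomputable def volBound (d : ℕ) (σ : ℝ) : ℝ := (2 * σ * (d + 1))⁻¹ ^ d * unitVol d

lemma volBound_pos {σ : ℝ} (hσ : 0 < σ) : 0 < volBound d σ := by
  have := unitVol_pos d
  unfold volBound
  positivity

/-- At the centroid all coordinates equal 1/(d+1), and they vary at rate at most 2σ/h_K. They stay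
nonnegative on a ball of radius h_K/(2σ(d+1)), which is therefore contained in K. -/
lemma Regular.volBound_mul_le [NeZero d] {σ : ℝ} (h : m.Regular σ) (K : Fin m.nElt) :
    volBound d σ * m.diam K ^ d ≤ m.vol K := by
  have hσ := h.pos K
  have hdiam := m.diam_pos K
  set ρ := m.diam K / (2 * σ * (d + 1)) with hρ
  have hρ0 : 0 < ρ := by positivity
  set x : E d := Finset.univ.centroid ℝ (m.basis K) with hx
  have hxc : ∀ a, (m.basis K).coord a x = ((d : ℝ) + 1)⁻¹ := by
    intro a
    rw [hx, AffineBasis.coord_apply_centroid (m.basis K) (Finset.mem_univ a)]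
    simp
  have hsub : Metric.ball x ρ ⊆ m.elt K := by
    intro y hy
    rw [mem_elt_iff]
    intro a
    have h1 := m.coord_sub K a x y
    have h2 := abs_real_inner_le_norm (m.gradCoord K a) (y - x)
    have h3 : ‖y - x‖ ≤ ρ := by rw [← dist_eq_norm]; exact (Metric.mem_ball.1 hy).le
    have h4 := h.norm_gradCoord_mul_diam_le K a
    have h5 : ‖m.gradCoord K a‖ * ‖y - x‖ ≤ ((d : ℝ) + 1)⁻¹ := by
      calc ‖m.gradCoord K a‖ * ‖y - x‖ ≤ ‖m.gradCoord K a‖ * ρ := by gcongr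
        _ = (‖m.gradCoord K a‖ * m.diam K) / (2 * σ * (d + 1)) := by rw [hρ]; ring
        _ ≤ 2 * σ / (2 * σ * (d + 1)) := by gcongr
        _ = ((d : ℝ) + 1)⁻¹ := by field_simp
    rw [← h1, hxc] at h2
    have h6 := (abs_le.1 (h2.trans h5)).1
    linarith
  have := measureReal_mono (μ := volume) hsub (m.volume_elt_ne_top K)
  rw [volume_real_ball _ hρ0.le] at this
  calc volBound d σ * m.diam K ^ d = ρ ^ d * unitVol d := by
        rw [volBound, hρ, div_eq_mul_inv, mul_pow]; ring
    _ ≤ m.vol K := this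

lemma vol_le [NeZero d] (m : Mesh Ω) (K : Fin m.nElt) : m.vol K ≤ m.diam K ^ d * unitVol d := by
  rw [← volume_real_closedBall (m.node (m.vert K 0)) (m.diam_nonneg K)]
  exact measureReal_mono (fun x hx => m.dist_le_diam hx (m.node_mem_elt K 0))
    measure_closedBall_lt_top.ne

/-- The number of elements sharing a node is bounded. -/
lemma Regular.card_elts_mul_le [NeZero d] {σ : ℝ} (h : m.Regular σ) (i : Fin m.M) :
    ((m.elts i).card : ℝ) * volBound d σ ≤ unitVol d := by
  obtain ⟨K₁, a₁, h₁⟩ := m.node_used i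
  obtain ⟨K₀, -, hK₀⟩ := Finset.exists_min_image (m.elts i) m.diam ⟨K₁, m.mem_elts.2 ⟨a₁, h₁⟩⟩
  set r := m.diam K₀ with hr
  have hr0 : 0 < r := m.diam_pos K₀
  -- Every element around the node is shrunk towards it to the smallest diameter r. The images
  -- overlap in null sets, lie in one ball of radius r, and each keeps a volume of at least
  -- `volBound d σ * r ^ d`; comparing volumes bounds their number.
  set A : Fin m.nElt → Set (E d) := fun K =>
    AffineMap.homothety (m.node i) (r / m.diam K) '' m.elt K with hA
  have hnode : ∀ K ∈ m.elts i, m.node i ∈ m.elt K := by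
    intro K hK
    obtain ⟨a, rfl⟩ := m.mem_elts.1 hK
    exact m.node_mem_elt K a
  have hAelt : ∀ K ∈ m.elts i, A K ⊆ m.elt K := by
    rintro K hK _ ⟨x, hx, rfl⟩
    have hle : r / m.diam K ≤ 1 := (div_le_one (m.diam_pos K)).2 (hK₀ K hK)
    have h0 : 0 ≤ r / m.diam K := div_nonneg hr0.le (m.diam_nonneg K)
    rw [AffineMap.homothety_eq_lineMap]
    exact (m.convex_elt K).lineMap_mem (hnode K hK) hx ⟨h0, hle⟩
  have hAball : ∀ K ∈ m.elts i, A K ⊆ Metric.closedBall (m.node i) r := by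
    rintro K hK _ ⟨x, hx, rfl⟩
    have hd := m.diam_pos K
    rw [Metric.mem_closedBall, AffineMap.homothety_eq_lineMap, dist_lineMap_left, Real.norm_eq_abs,
      abs_of_nonneg (div_nonneg hr0.le hd.le)]
    calc r / m.diam K * dist (m.node i) x ≤ r / m.diam K * m.diam K := by
          gcongr
          exact m.dist_le_diam (hnode K hK) hx
      _ = r := by field_simp
  have hAvol : ∀ K, ENNReal.ofReal (volBound d σ * r ^ d) ≤ volume (A K) := by
    intro K
    have hd := m.diam_pos K
    rw [hA, Measure.addHaar_image_homothety, finrank_euclideanSpace_fin,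
      abs_of_nonneg (by positivity), ← ENNReal.ofReal_toReal (m.volume_elt_ne_top K),
      ← ENNReal.ofReal_mul (by positivity)]
    refine ENNReal.ofReal_le_ofReal ?_
    calc volBound d σ * r ^ d = (r / m.diam K) ^ d * (volBound d σ * m.diam K ^ d) := by
          rw [div_pow]; field_simp
      _ ≤ (r / m.diam K) ^ d * m.vol K := by
          gcongr
          exact h.volBound_mul_le K
  have hmeas : ∀ K, MeasurableSet (A K) := fun K =>
    ((m.isCompact_elt K).image (AffineMap.homothety_continuous _ _)).measurableSet
  have hsum : ∑ K ∈ m.elts i, volume (A K) ≤ volume (Metric.closedBall (m.node i) r) := by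
    rw [← measure_biUnion_finset₀ (f := A)]
    · exact measure_mono (iUnion₂_subset hAball)
    · intro K hK K' hK' hne
      exact measure_mono_null (inter_subset_inter (hAelt K hK) (hAelt K' hK'))
        (m.volume_elt_inter hne)
    · exact fun K _ => (hmeas K).nullMeasurableSet
  have hfin : ((m.elts i).card : ℝ≥0∞) * ENNReal.ofReal (volBound d σ * r ^ d) ≤
      ENNReal.ofReal (r ^ d * unitVol d) := by
    rw [← volume_real_closedBall (m.node i) hr0.le, Measure.real,
      ENNReal.ofReal_toReal measure_closedBall_lt_top.ne]
    refine le_trans ?_ hsum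
    rw [← nsmul_eq_mul]
    exact Finset.card_nsmul_le_sum _ _ _ fun K _ => hAvol K
  rw [← ENNReal.ofReal_natCast, ← ENNReal.ofReal_mul (by positivity),
    ENNReal.ofReal_le_ofReal_iff (mul_nonneg (by positivity) (unitVol_pos d).le)] at hfin
  have hrd : 0 < r ^ d := by positivity
  refine le_of_mul_le_mul_right ?_ hrd
  linarith

/-- The bound of the row sums of the coefficients `c_ij`. -/
noncomputable def rowBound (d : ℕ) (σ : ℝ) : ℝ :=
  unitVol d / volBound d σ * (unitVol d * ((d + 1) * (2 * σ) ^ 2)) * ((d + 1) / volBound d σ)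

lemma sum_c (m : Mesh Ω) (i : Fin m.M) :
    ∑ j, m.c i j = ∑ K ∈ m.elts i, m.vol K * ∑ b, |⟪m.gradHat K i, m.gradCoord K b⟫| := by
  simp only [c_eq]
  rw [Finset.sum_comm, ← Finset.sum_subset (Finset.subset_univ (m.elts i))]
  · refine Finset.sum_congr rfl fun K _ => ?_
    rw [← Finset.mul_sum, m.sum_eq_sum_vert K]
    · simp only [gradHat_vert]
    · intro j hj
      rw [m.gradHat_of_notMem hj, inner_zero_right, abs_zero]
  · intro K _ hK
    rw [mem_elts] at hK
    simp [m.gradHat_of_notMem hK]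

/-- The c_ij are at most of order H^{d-2}, with H the largest diameter around the node, since d ≥ 2
makes x^{d-2} nondecreasing; the mass is at least of order H^d. Only h_K ≤ H is needed, so diameters
of neighbours are never compared. This is a stability condition for explicit steps no longer than
h_K². -/
lemma Regular.diam_sq_mul_sum_c_le [NeZero d] {σ : ℝ} (h : m.Regular σ) (hd : 2 ≤ d)
    {i : Fin m.M} {K : Fin m.nElt} (hi : i ∈ range (m.vert K)) :
    m.diam K ^ 2 * ∑ j, m.c i j ≤ rowBound d σ * m.mass i := by
  have hσ := h.pos K
  have hK := m.mem_elts.2 hi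
  have hω := unitVol_pos d
  have hκ := volBound_pos (d := d) hσ
  obtain ⟨K₀, hK₀, hmax⟩ := Finset.exists_max_image (m.elts i) m.diam ⟨K, hK⟩
  set H := m.diam K₀
  have hH : 0 < H := m.diam_pos K₀
  set B := unitVol d * ((d + 1) * (2 * σ) ^ 2) with hB
  have hB0 : 0 < B := by positivity
  have hpow : ∀ x : ℝ, x ^ d = x ^ (d - 2) * x ^ 2 := fun x => by
    rw [← pow_add, Nat.sub_add_cancel hd]
  have hterm : ∀ K ∈ m.elts i,
      m.vol K * ∑ b, |⟪m.gradHat K i, m.gradCoord K b⟫| ≤ B * H ^ (d - 2) := by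
    intro K hK
    obtain ⟨a, rfl⟩ := m.mem_elts.1 hK
    have hdK := m.diam_pos K
    have hb : ∀ b, m.diam K ^ 2 * |⟪m.gradHat K (m.vert K a), m.gradCoord K b⟫| ≤ (2 * σ) ^ 2 := by
      intro b
      rw [gradHat_vert]
      calc m.diam K ^ 2 * |⟪m.gradCoord K a, m.gradCoord K b⟫|
          ≤ m.diam K ^ 2 * (‖m.gradCoord K a‖ * ‖m.gradCoord K b‖) := by
            gcongr; exact abs_real_inner_le_norm _ _
        _ = (‖m.gradCoord K a‖ * m.diam K) * (‖m.gradCoord K b‖ * m.diam K) := by ring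
        _ ≤ (2 * σ) * (2 * σ) := by
            exact mul_le_mul (h.norm_gradCoord_mul_diam_le K a) (h.norm_gradCoord_mul_diam_le K b)
              (by positivity) (by positivity)
        _ = (2 * σ) ^ 2 := by ring
    calc m.vol K * ∑ b, |⟪m.gradHat K (m.vert K a), m.gradCoord K b⟫|
        ≤ (m.diam K ^ d * unitVol d) * ∑ b, |⟪m.gradHat K (m.vert K a), m.gradCoord K b⟫| := by
          gcongr; exact m.vol_le K
      _ = m.diam K ^ (d - 2) * unitVol d *
            ∑ b, m.diam K ^ 2 * |⟪m.gradHat K (m.vert K a), m.gradCoord K b⟫| := by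
          rw [← Finset.mul_sum]
          rw [hpow]; ring
      _ ≤ m.diam K ^ (d - 2) * unitVol d * ∑ b : Fin (d + 1), (2 * σ) ^ 2 := by
          gcongr with b; exact hb b
      _ = B * m.diam K ^ (d - 2) := by
          simp only [Finset.sum_const, Finset.card_univ, Fintype.card_fin, nsmul_eq_mul]
          push_cast
          rw [hB]; ring
      _ ≤ B * H ^ (d - 2) := by
          gcongr; exact hmax K hK
  have hcard : ((m.elts i).card : ℝ) ≤ unitVol d / volBound d σ := by
    rw [le_div_iff₀ hκ]; exact h.card_elts_mul_le i
  have hsum : ∑ j, m.c i j ≤ unitVol d / volBound d σ * (B * H ^ (d - 2)) := by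
    rw [m.sum_c]
    calc _ ≤ (m.elts i).card • (B * H ^ (d - 2)) := Finset.sum_le_card_nsmul _ _ _ hterm
      _ = (m.elts i).card * (B * H ^ (d - 2)) := by rw [nsmul_eq_mul]
      _ ≤ _ := by gcongr
  have hmass : H ^ d ≤ (d + 1) / volBound d σ * m.mass i := by
    have h1 := h.volBound_mul_le K₀
    have h2 := m.vol_le_mass (m.mem_elts.1 hK₀)
    rw [div_mul_eq_mul_div, le_div_iff₀ hκ, mul_comm]
    exact h1.trans h2
  calc m.diam K ^ 2 * ∑ j, m.c i j
      ≤ H ^ 2 * (unitVol d / volBound d σ * (B * H ^ (d - 2))) := by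
        gcongr
        · exact Finset.sum_nonneg fun j _ => m.c_nonneg i j
        · exact m.diam_nonneg K
        · exact hmax K hK
    _ = unitVol d / volBound d σ * B * H ^ d := by
        rw [hpow]; ring
    _ ≤ unitVol d / volBound d σ * B * ((d + 1) / volBound d σ * m.mass i) := by gcongr
    _ = rowBound d σ * m.mass i := by rw [rowBound, ← hB]; ring

end Mesh

end TwoPhase

namespace TwoPhase

/-! ### The Poincaré inequality on a Lipschitz domain -/

section Poincare

variable {d : ℕ}

/-- `H` controls the increments of `u` along the segments contained in `Ω`, as the squared norm of
the gradient of `u` does. -/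
structure IsGradBound (Ω : Set (E d)) (u : E d → ℝ) (H : E d → ℝ≥0∞) : Prop where
  meas_u : Measurable u
  meas_H : Measurable H
  bound : ∀ x v : E d, (∀ s ∈ Icc (0 : ℝ) 1, x + s • v ∈ Ω) →
    ENNReal.ofReal ((u (x + v) - u x) ^ 2) ≤
      ENNReal.ofReal (‖v‖ ^ 2) * ∫⁻ s in Icc (0 : ℝ) 1, H (x + s • v)

/-- The integral of `(u x - u y)²` over `A × B`. -/
noncomputable def diffInt (u : E d → ℝ) (A B : Set (E d)) : ℝ≥0∞ :=
  ∫⁻ x in A, ∫⁻ y in B, ENNReal.ofReal ((u x - u y) ^ 2)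

lemma measurable_diff_sq {u : E d → ℝ} (hu : Measurable u) :
    Measurable fun p : E d × E d => ENNReal.ofReal ((u p.1 - u p.2) ^ 2) := by
  fun_prop

lemma diffInt_comm {u : E d → ℝ} (hu : Measurable u) (A B : Set (E d)) :
    diffInt u A B = diffInt u B A := by
  rw [diffInt, lintegral_lintegral_swap (measurable_diff_sq hu).aemeasurable]
  simp only [diffInt, sub_sq_comm]

lemma diffInt_mono (u : E d → ℝ) {A A' B B' : Set (E d)} (hA : A ⊆ A') (hB : B ⊆ B') :
    diffInt u A B ≤ diffInt u A' B' :=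
  (lintegral_mono fun _ => lintegral_mono_set hB).trans (lintegral_mono_set hA)

lemma ofReal_sub_sq_le (a b c : ℝ) :
    ENNReal.ofReal ((a - c) ^ 2) ≤
      2 * ENNReal.ofReal ((a - b) ^ 2) + 2 * ENNReal.ofReal ((b - c) ^ 2) := by
  rw [← ENNReal.ofReal_ofNat 2, ← ENNReal.ofReal_mul two_pos.le, ← ENNReal.ofReal_mul two_pos.le,
    ← ENNReal.ofReal_add (by positivity) (by positivity)]
  exact ENNReal.ofReal_le_ofReal (by nlinarith [sq_nonneg (a - 2 * b + c)])

/-- The triangle inequality through an intermediate point, averaged over that point in W. -/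
lemma diffInt_chain {u : E d → ℝ} (hu : Measurable u) (A W B : Set (E d)) :
    diffInt u A B * volume W ≤
      2 * (diffInt u A W * volume B) + 2 * (diffInt u W B * volume A) := by
  have hm : ∀ x, Measurable fun y => ENNReal.ofReal ((u x - u y) ^ 2) := fun x => by fun_prop
  have hF : ∀ C : Set (E d), Measurable fun x => ∫⁻ y in C, ENNReal.ofReal ((u x - u y) ^ 2) :=
    fun C => (measurable_diff_sq hu).lintegral_prod_right'
  calc diffInt u A B * volume W
      = ∫⁻ x in A, ∫⁻ _ in W, ∫⁻ z in B, ENNReal.ofReal ((u x - u z) ^ 2) := by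
        simp only [setLIntegral_const]
        rw [lintegral_mul_const _ (hF B)]
        rfl
    _ ≤ ∫⁻ x in A, ∫⁻ y in W, ∫⁻ z in B, (2 * ENNReal.ofReal ((u x - u y) ^ 2) +
          2 * ENNReal.ofReal ((u y - u z) ^ 2)) :=
        lintegral_mono fun x => lintegral_mono fun y => lintegral_mono fun z =>
          ofReal_sub_sq_le _ _ _
    _ = ∫⁻ x in A, (2 * ((∫⁻ y in W, ENNReal.ofReal ((u x - u y) ^ 2)) * volume B) +
          2 * diffInt u W B) := by
        refine lintegral_congr fun x => ?_
        have h1 : ∀ y, ∫⁻ z in B, (2 * ENNReal.ofReal ((u x - u y) ^ 2) +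
            2 * ENNReal.ofReal ((u y - u z) ^ 2)) =
            2 * (ENNReal.ofReal ((u x - u y) ^ 2) * volume B) +
            2 * ∫⁻ z in B, ENNReal.ofReal ((u y - u z) ^ 2) := by
          intro y
          rw [lintegral_add_left measurable_const, setLIntegral_const,
            lintegral_const_mul _ (hm y), mul_assoc]
        simp only [h1]
        rw [lintegral_add_left (by fun_prop), lintegral_const_mul _ (by fun_prop),
          lintegral_mul_const _ (hm x), lintegral_const_mul _ (hF B)]
        rfl
    _ = _ := by
        rw [lintegral_add_right _ measurable_const, setLIntegral_const,
          lintegral_const_mul _ ((hF W).mul_const _), lintegral_mul_const _ (hF W), mul_assoc]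
        rfl

/-- The bound on segments is integrated over their origins. For each fixed s the points x + s v, x
in V, form a translate of V inside Ω. -/
lemma IsGradBound.lintegral_translate_le {Ω : Set (E d)} {u : E d → ℝ} {H : E d → ℝ≥0∞}
    (h : IsGradBound Ω u H) (hΩ : MeasurableSet Ω) {V : Set (E d)} (hV : MeasurableSet V) (v : E d)
    (hVv : ∀ x ∈ V, ∀ s ∈ Icc (0 : ℝ) 1, x + s • v ∈ Ω) :
    ∫⁻ x in V, ENNReal.ofReal ((u (x + v) - u x) ^ 2) ≤
      ENNReal.ofReal (‖v‖ ^ 2) * ∫⁻ x in Ω, H x := by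
  have hmeas : Measurable fun p : E d × ℝ => H (p.1 + p.2 • v) := h.meas_H.comp (by fun_prop)
  calc ∫⁻ x in V, ENNReal.ofReal ((u (x + v) - u x) ^ 2)
      ≤ ∫⁻ x in V, ENNReal.ofReal (‖v‖ ^ 2) * ∫⁻ s in Icc (0 : ℝ) 1, H (x + s • v) :=
        setLIntegral_mono' hV fun x hx => h.bound x v (hVv x hx)
    _ = ENNReal.ofReal (‖v‖ ^ 2) * ∫⁻ s in Icc (0 : ℝ) 1, ∫⁻ x in V, H (x + s • v) := by
        rw [lintegral_const_mul _ hmeas.lintegral_prod_right',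
          lintegral_lintegral_swap hmeas.aemeasurable]
    _ ≤ ENNReal.ofReal (‖v‖ ^ 2) * ∫⁻ _ in Icc (0 : ℝ) 1, ∫⁻ x in Ω, H x := by
        gcongr 1
        refine setLIntegral_mono' measurableSet_Icc fun s hs => ?_
        rw [← lintegral_indicator hV, ← lintegral_indicator hΩ,
          ← lintegral_add_right_eq_self (Ω.indicator H) (s • v)]
        refine lintegral_mono fun x => ?_
        by_cases hx : x ∈ V
        · simp [hx, hVv x hx s hs]
        · simp [hx]
    _ = _ := by simp

/-- With y = x + v and v fixed, convexity keeps the segments in V and the translation estimate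
applies; only v of norm at most D contribute. -/
lemma IsGradBound.diffInt_convex_le {Ω : Set (E d)} {u : E d → ℝ} {H : E d → ℝ≥0∞}
    (h : IsGradBound Ω u H) (hΩ : MeasurableSet Ω) {V : Set (E d)} (hV : MeasurableSet V)
    (hconv : Convex ℝ V) (hVΩ : V ⊆ Ω) {D : ℝ} (hD : ∀ x ∈ V, ∀ y ∈ V, dist x y ≤ D) :
    diffInt u V V ≤
      ENNReal.ofReal (D ^ 2) * volume (Metric.closedBall (0 : E d) D) * ∫⁻ x in Ω, H x := by
  have hu := h.meas_u
  have hmeas : Measurable fun p : E d × E d => ({q : E d × E d | q.1 + q.2 ∈ V}.indicator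
      (fun q => ENNReal.ofReal ((u q.1 - u (q.1 + q.2)) ^ 2)) p) := by
    refine Measurable.indicator (by fun_prop) ?_
    exact (measurable_fst.add measurable_snd) hV
  calc diffInt u V V
      = ∫⁻ x in V, ∫⁻ v, {q : E d × E d | q.1 + q.2 ∈ V}.indicator
          (fun q => ENNReal.ofReal ((u q.1 - u (q.1 + q.2)) ^ 2)) (x, v) := by
        refine lintegral_congr fun x => ?_
        rw [← lintegral_indicator hV,
          ← lintegral_add_left_eq_self _ x]
        rfl
    _ = ∫⁻ v, ∫⁻ x in V, {q : E d × E d | q.1 + q.2 ∈ V}.indicator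
          (fun q => ENNReal.ofReal ((u q.1 - u (q.1 + q.2)) ^ 2)) (x, v) :=
        lintegral_lintegral_swap hmeas.aemeasurable
    _ ≤ ∫⁻ v, (Metric.closedBall (0 : E d) D).indicator
          (fun _ => ENNReal.ofReal (D ^ 2) * ∫⁻ x in Ω, H x) v := by
        refine lintegral_mono fun v => ?_
        by_cases hv : v ∈ Metric.closedBall (0 : E d) D
        · have hmV : MeasurableSet {x | x + v ∈ V} := (measurable_id.add_const v) hV
          have heq : ∫⁻ x in V, {q : E d × E d | q.1 + q.2 ∈ V}.indicator
              (fun q => ENNReal.ofReal ((u q.1 - u (q.1 + q.2)) ^ 2)) (x, v) =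
              ∫⁻ x in V ∩ {x | x + v ∈ V}, ENNReal.ofReal ((u (x + v) - u x) ^ 2) := by
            rw [inter_comm, ← setLIntegral_indicator hmV]
            refine lintegral_congr fun x => ?_
            by_cases hx : x + v ∈ V
            · simp [hx, sub_sq_comm]
            · simp [hx]
          simp only [heq, indicator_of_mem hv]
          refine (h.lintegral_translate_le hΩ (hV.inter hmV) v ?_).trans ?_
          · rintro x ⟨hx, hxv⟩ s hs
            refine hVΩ ?_
            have := hconv.lineMap_mem hx hxv hs
            rwa [AffineMap.lineMap_apply, vsub_eq_sub, add_sub_cancel_left, vadd_eq_add,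
              add_comm] at this
          · gcongr
            simpa using hv
        · have : ∀ x ∈ V, {q : E d × E d | q.1 + q.2 ∈ V}.indicator
              (fun q => ENNReal.ofReal ((u q.1 - u (q.1 + q.2)) ^ 2)) (x, v) = 0 := by
            intro x hx
            refine indicator_of_notMem (fun hxv => hv ?_) _
            have := hD (x + v) hxv x hx
            simpa using this
          rw [setLIntegral_congr_fun hV this]
          simp
    _ = _ := by
        rw [lintegral_indicator measurableSet_closedBall, setLIntegral_const]
        ring

/-- The sets `A` for which `∫_{B} ∫_A (u x - u y)²` is controlled by the gradient of `u`. -/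
def PoincarePair (Ω B A : Set (E d)) : Prop :=
  ∃ C : ℝ≥0, ∀ u H, IsGradBound Ω u H → diffInt u B A ≤ C * ∫⁻ x in Ω, H x

lemma PoincarePair.mono {Ω B A A' : Set (E d)} (h : PoincarePair Ω B A) (hA : A' ⊆ A) :
    PoincarePair Ω B A' :=
  let ⟨C, hC⟩ := h
  ⟨C, fun u H hu => (diffInt_mono u Subset.rfl hA).trans (hC u H hu)⟩

lemma PoincarePair.union {Ω B A A' : Set (E d)} (h : PoincarePair Ω B A)
    (h' : PoincarePair Ω B A') : PoincarePair Ω B (A ∪ A') := by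
  obtain ⟨C, hC⟩ := h
  obtain ⟨C', hC'⟩ := h'
  refine ⟨C + C', fun u H hu => ?_⟩
  rw [diffInt_comm hu.meas_u, ENNReal.coe_add, add_mul]
  refine (lintegral_union_le _ _ _).trans (add_le_add ?_ ?_)
  · rw [← diffInt, diffInt_comm hu.meas_u]; exact hC u H hu
  · rw [← diffInt, diffInt_comm hu.meas_u]; exact hC' u H hu

lemma PoincarePair.ball {Ω : Set (E d)} (hΩ : MeasurableSet Ω) {x : E d} {r : ℝ}
    (hball : Metric.ball x r ⊆ Ω) : PoincarePair Ω (Metric.ball x r) (Metric.ball x r) := by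
  refine ⟨(ENNReal.ofReal ((r + r) ^ 2) * volume (Metric.closedBall (0 : E d) (r + r))).toNNReal,
    fun u H hu => ?_⟩
  rw [ENNReal.coe_toNNReal (ENNReal.mul_ne_top ENNReal.ofReal_ne_top measure_closedBall_lt_top.ne)]
  refine hu.diffInt_convex_le hΩ measurableSet_ball (convex_ball x r) hball fun y hy z hz => ?_
  have h1 := Metric.mem_ball.1 hy
  have h2 := Metric.mem_ball'.1 hz
  linarith [dist_triangle y x z]

/-- A reference set linked to A is linked to any ball in Ω that overlaps A in positive measure, the
overlap serving as intermediate set. This propagates the inequality along chains of balls. -/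
lemma PoincarePair.chain {Ω B A : Set (E d)} (hΩ : MeasurableSet Ω) (hB : volume B ≠ ∞)
    (h : PoincarePair Ω B A) {x : E d} {r : ℝ} (hball : Metric.ball x r ⊆ Ω)
    (hpos : volume (A ∩ Metric.ball x r) ≠ 0) : PoincarePair Ω B (Metric.ball x r) := by
  obtain ⟨C, hC⟩ := h
  obtain ⟨C', hC'⟩ := PoincarePair.ball hΩ hball
  set V := Metric.ball x r with hV
  set W := A ∩ V
  have hVtop : volume V ≠ ∞ := measure_ball_lt_top.ne
  have hWtop : volume W ≠ ∞ := measure_ne_top_of_subset inter_subset_right hVtop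
  set c : ℝ≥0∞ := (2 * (C * volume V) + 2 * (C' * volume B)) / volume W with hc
  have hctop : c ≠ ∞ := by
    refine ENNReal.div_ne_top ?_ hpos
    finiteness
  refine ⟨c.toNNReal, fun u H hu => ?_⟩
  rw [ENNReal.coe_toNNReal hctop, hc]
  have h1 := diffInt_chain hu.meas_u B W V
  have h2 : diffInt u B W ≤ C * ∫⁻ x in Ω, H x :=
    (diffInt_mono u Subset.rfl inter_subset_left).trans (hC u H hu)
  have h3 : diffInt u W V ≤ C' * ∫⁻ x in Ω, H x :=
    (diffInt_mono u inter_subset_right Subset.rfl).trans (hC' u H hu)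
  rw [← ENNReal.mul_div_right_comm, ENNReal.le_div_iff_mul_le (Or.inl hpos) (Or.inl hWtop)]
  refine h1.trans ?_
  calc _ ≤ 2 * ((C * ∫⁻ x in Ω, H x) * volume V) + 2 * ((C' * ∫⁻ x in Ω, H x) * volume B) := by
        gcongr
    _ = _ := by ring

/-- This reaches the boundary, where no full ball is available: V is compared with its translate V +
v, lying in a set already treated, along segments inside Ω. -/
lemma PoincarePair.translate {Ω B A : Set (E d)} (hΩ : MeasurableSet Ω) (hB : volume B ≠ ∞)
    (h : PoincarePair Ω B A) {V : Set (E d)} (hV : MeasurableSet V) (v : E d)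
    (hVv : ∀ x ∈ V, ∀ s ∈ Icc (0 : ℝ) 1, x + s • v ∈ Ω) (hVA : ∀ x ∈ V, x + v ∈ A)
    (hA : MeasurableSet A) :
    PoincarePair Ω B V := by
  obtain ⟨C, hC⟩ := h
  set c : ℝ≥0∞ := 2 * C + 2 * (ENNReal.ofReal (‖v‖ ^ 2) * volume B)
  have hctop : c ≠ ∞ := by finiteness
  refine ⟨c.toNNReal, fun u H hu => ?_⟩
  have hum := hu.meas_u
  rw [ENNReal.coe_toNNReal hctop]
  have hm : Measurable fun p : E d × E d => ENNReal.ofReal ((u p.1 - u (p.2 + v)) ^ 2) := by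
    fun_prop
  calc diffInt u B V ≤ ∫⁻ x in B, ∫⁻ y in V, (2 * ENNReal.ofReal ((u x - u (y + v)) ^ 2) +
          2 * ENNReal.ofReal ((u (y + v) - u y) ^ 2)) :=
        lintegral_mono fun x => lintegral_mono fun y => ofReal_sub_sq_le _ _ _
    _ = 2 * (∫⁻ x in B, ∫⁻ y in V, ENNReal.ofReal ((u x - u (y + v)) ^ 2)) +
          2 * ((∫⁻ y in V, ENNReal.ofReal ((u (y + v) - u y) ^ 2)) * volume B) := by
        have : ∀ x, ∫⁻ y in V, (2 * ENNReal.ofReal ((u x - u (y + v)) ^ 2) +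
            2 * ENNReal.ofReal ((u (y + v) - u y) ^ 2)) =
            2 * (∫⁻ y in V, ENNReal.ofReal ((u x - u (y + v)) ^ 2)) +
            2 * ∫⁻ y in V, ENNReal.ofReal ((u (y + v) - u y) ^ 2) := by
          intro x
          rw [lintegral_add_left (by fun_prop), lintegral_const_mul _ (by fun_prop),
            lintegral_const_mul _ (by fun_prop)]
        simp only [this]
        rw [lintegral_add_right _ measurable_const, setLIntegral_const,
          lintegral_const_mul _ hm.lintegral_prod_right', mul_assoc]
    _ ≤ 2 * diffInt u B A + 2 * ((ENNReal.ofReal (‖v‖ ^ 2) * ∫⁻ x in Ω, H x) * volume B) := by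
        gcongr
        · refine lintegral_mono fun x => ?_
          rw [← lintegral_indicator hV, ← lintegral_indicator hA,
            ← lintegral_add_right_eq_self (A.indicator _) v]
          refine lintegral_mono fun y => ?_
          by_cases hy : y ∈ V
          · simp [hy, hVA y hy]
          · simp [hy]
        · exact hu.lintegral_translate_le hΩ hV v hVv
    _ ≤ 2 * (C * ∫⁻ x in Ω, H x) +
          2 * ((ENNReal.ofReal (‖v‖ ^ 2) * ∫⁻ x in Ω, H x) * volume B) := by
        gcongr; exact hC u H hu
    _ = _ := by ring

/-- The Poincaré inequality. -/
theorem exists_poincare {Ω : Set (E d)} (ho : IsOpen Ω) (hc : IsConnected Ω)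
    (hb : Bornology.IsBounded Ω) (hL : HasLipschitzBoundary Ω) :
    ∃ C : ℝ≥0, ∀ u H, IsGradBound Ω u H →
      ∃ c : ℝ, ∫⁻ x in Ω, ENNReal.ofReal ((u x - c) ^ 2) ≤ C * ∫⁻ x in Ω, H x := by
  have hΩ := ho.measurableSet
  obtain ⟨x₀, hx₀⟩ := hc.nonempty
  obtain ⟨r₀, hr₀, hball₀⟩ := Metric.isOpen_iff.1 ho x₀ hx₀
  set B := Metric.ball x₀ r₀
  have hBtop : volume B ≠ ∞ := measure_ball_lt_top.ne
  -- The points having a ball linked to the reference ball B form an open set, also relatively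
  -- closed in Ω because overlapping balls can be chained; Ω being connected, it contains Ω.
  set S : Set (E d) := {x | ∃ r > 0, Metric.ball x r ⊆ Ω ∧ PoincarePair Ω B (Metric.ball x r)}
    with hS
  have hSo : IsOpen S := by
    rw [Metric.isOpen_iff]
    rintro x ⟨r, hr, hxr, hP⟩
    refine ⟨r, hr, fun y hy => ⟨r - dist y x, sub_pos.2 hy, ?_⟩⟩
    have hsub : Metric.ball y (r - dist y x) ⊆ Metric.ball x r :=
      Metric.ball_subset_ball' (by linarith)
    exact ⟨hsub.trans hxr, hP.mono hsub⟩
  have hΩS : Ω ⊆ S := by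
    refine hc.isPreconnected.subset_of_closure_inter_subset hSo
      ⟨x₀, hx₀, r₀, hr₀, hball₀, PoincarePair.ball hΩ hball₀⟩ ?_
    rintro x ⟨hx, hxΩ⟩
    obtain ⟨r, hr, hxr⟩ := Metric.isOpen_iff.1 ho x hxΩ
    obtain ⟨y, ⟨ρ, hρ, -, hP⟩, hyx⟩ := Metric.mem_closure_iff.1 hx r hr
    refine ⟨r, hr, hxr, hP.chain hΩ hBtop hxr ?_⟩
    refine ((Metric.isOpen_ball.inter Metric.isOpen_ball).measure_pos volume ⟨y, ?_⟩).ne'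
    exact ⟨Metric.mem_ball_self hρ, Metric.mem_ball'.2 hyx⟩
  -- At a boundary point, the part of Ω nearby is pushed inwards by (R/2) ν. The epigraph
  -- description keeps the segments in Ω, and they end in a ball around an interior point.
  have hloc : ∀ x ∈ closure Ω, ∃ r > 0, PoincarePair Ω B (Metric.ball x r ∩ Ω) := by
    intro x hx
    by_cases hxΩ : x ∈ Ω
    · obtain ⟨r, hr, -, hP⟩ := hΩS hxΩ
      exact ⟨r, hr, hP.mono inter_subset_left⟩
    have hfr : x ∈ frontier Ω := by rw [ho.frontier_eq]; exact ⟨hx, hxΩ⟩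
    obtain ⟨ν, L, ψ, R, hν, hR, hψ, hinv, hmem⟩ := hL x hfr
    have hψx : ψ x ≤ ⟪ν, x⟫ := by
      have hcl : x ∈ closure (Ω ∩ Metric.ball x R) :=
        Metric.isOpen_ball.closure_inter ⟨hx, Metric.mem_ball_self hR⟩
      exact closure_minimal (fun z hz => ((hmem z hz.2).1 hz.1).le)
        (isClosed_le hψ.continuous (by fun_prop)) hcl
    have hνν : ⟪ν, ν⟫ = 1 := by rw [real_inner_self_eq_norm_sq, hν, one_pow]
    have hxν : x + (R / 2) • ν ∈ Ω := by
      refine (hmem _ ?_).2 ?_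
      · simp only [Metric.mem_ball, dist_self_add_left, norm_smul, hν, mul_one, Real.norm_eq_abs,
          abs_of_pos (half_pos hR)]
        linarith
      · rw [hinv, inner_add_right, real_inner_smul_right, hνν]
        linarith
    obtain ⟨ρ, hρ, -, hP⟩ := hΩS hxν
    refine ⟨min ρ (R / 2), lt_min hρ (half_pos hR), hP.translate hΩ hBtop
      (measurableSet_ball.inter hΩ) ((R / 2) • ν) ?_ ?_ measurableSet_ball⟩
    · rintro y ⟨hy, hyΩ⟩ s ⟨hs0, hs1⟩
      have hyx : dist y x < R / 2 := (Metric.mem_ball.1 hy).trans_le (min_le_right _ _)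
      have hyR : y ∈ Metric.ball x R := Metric.mem_ball.2 (by linarith)
      rw [smul_smul]
      refine (hmem _ ?_).2 ?_
      · rw [Metric.mem_ball]
        calc dist (y + (s * (R / 2)) • ν) x ≤ dist (y + (s * (R / 2)) • ν) y + dist y x :=
              dist_triangle _ _ _
          _ = s * (R / 2) + dist y x := by
              rw [dist_self_add_left, norm_smul, hν, mul_one, Real.norm_eq_abs,
                abs_of_nonneg (by positivity)]
          _ < R := by nlinarith
      · rw [hinv, inner_add_right, real_inner_smul_right, hνν]
        have := (hmem y hyR).1 hyΩ
        nlinarith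
    · rintro y ⟨hy, -⟩
      rw [Metric.mem_ball, dist_add_right]
      exact (Metric.mem_ball.1 hy).trans_le (min_le_left _ _)
  have hP : PoincarePair Ω B (closure Ω ∩ Ω) := by
    -- Finitely many neighbourhoods cover the compact closure, and linked sets are stable under
    -- finite unions.
    refine hb.isCompact_closure.induction_on (p := fun A => PoincarePair Ω B (A ∩ Ω)) ?_ ?_ ?_ ?_
    · exact ⟨0, fun u H _ => by simp [diffInt]⟩
    · exact fun A A' hA h => h.mono (inter_subset_inter_left _ hA)
    · intro A A' h h'
      rw [union_inter_distrib_right]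
      exact h.union h'
    · intro x hx
      obtain ⟨r, hr, h⟩ := hloc x hx
      exact ⟨Metric.ball x r, mem_nhdsWithin_of_mem_nhds (Metric.ball_mem_nhds x hr), h⟩
  rw [inter_eq_self_of_subset_right subset_closure] at hP
  obtain ⟨C, hC⟩ := hP
  have hB0 : volume B ≠ 0 := (Metric.measure_ball_pos volume x₀ hr₀).ne'
  have htop : (C : ℝ≥0∞) / volume B ≠ ∞ := ENNReal.div_ne_top ENNReal.coe_ne_top hB0
  refine ⟨((C : ℝ≥0∞) / volume B).toNNReal, fun u H hu => ?_⟩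
  have hum := hu.meas_u
  -- Some x in B does at least as well as the average over B; the constant is the value of u there.
  obtain ⟨x, -, hx⟩ := exists_le_setLAverage (μ := volume) (s := B) hB0 hBtop
    (f := fun x => ∫⁻ y in Ω, ENNReal.ofReal ((u x - u y) ^ 2))
    (measurable_diff_sq hum).lintegral_prod_right'.aemeasurable
  refine ⟨u x, ?_⟩
  rw [ENNReal.coe_toNNReal htop]
  calc ∫⁻ y in Ω, ENNReal.ofReal ((u y - u x) ^ 2)
      = ∫⁻ y in Ω, ENNReal.ofReal ((u x - u y) ^ 2) := by simp only [sub_sq_comm]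
    _ ≤ _ := hx
    _ = diffInt u B Ω / volume B := by rw [setLAverage_eq]; rfl
    _ ≤ (C * ∫⁻ x in Ω, H x) / volume B := by gcongr; exact hC u H hu
    _ = _ := by rw [ENNReal.mul_div_right_comm]

end Poincare

end TwoPhase

/-! ### The Poincaré inequality for finite element functions -/

namespace TwoPhase

/-- The increment of a continuous function which is Lipschitz on each of finitely many pieces of an
interval. -/
lemma ofReal_abs_sub_le_sum {ι : Type*} [Fintype ι] {f : ℝ → ℝ} (hf : ContinuousOn f (Icc 0 1))
    (I : ι → Set ℝ) (L : ι → ℝ≥0) (hcover : Icc (0 : ℝ) 1 ⊆ ⋃ k, I k)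
    (hL : ∀ k, LipschitzOnWith (L k) f (I k)) :
    ENNReal.ofReal |f 1 - f 0| ≤ ∑ k, L k * volume (I k) := by
  -- By the intermediate value theorem the images of the pieces cover the interval between f 0 and f
  -- 1, so no ordering of the pieces along [0,1] is needed.
  have himg : uIcc (f 0) (f 1) ⊆ ⋃ k, f '' I k := by
    rw [← image_iUnion]
    have h := intermediate_value_uIcc (a := (0 : ℝ)) (b := 1) (f := f)
      (by rwa [uIcc_of_le zero_le_one])
    rw [uIcc_of_le (zero_le_one (α := ℝ))] at h
    exact h.trans (image_mono hcover)
  calc ENNReal.ofReal |f 1 - f 0| = volume (uIcc (f 0) (f 1)) := by rw [Real.volume_interval]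
    _ ≤ ∑ k, volume (f '' I k) := (measure_mono himg).trans (measure_iUnion_fintype_le _ _)
    _ ≤ ∑ k, L k * volume (I k) := by
        refine Finset.sum_le_sum fun k _ => ?_
        have := (hL k).hausdorffMeasure_image_le zero_le_one
        rwa [hausdorffMeasure_real, ENNReal.rpow_one] at this

namespace Mesh

variable {d : ℕ} {Ω : Set (E d)} (m : Mesh Ω)

/-- The norm of the gradient of a finite element function. -/
noncomputable def gradNorm (U : Fin m.M → ℝ) (x : E d) : ℝ≥0∞ :=
  ∑ K, (m.elt K).indicator (fun _ => ‖m.grad K U‖ₑ) x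

lemma measurable_gradNorm (U : Fin m.M → ℝ) : Measurable (m.gradNorm U) :=
  Finset.measurable_fun_sum _ fun K _ => measurable_const.indicator (m.measurableSet_elt K)

lemma fn_of_notMem {x : E d} (hx : x ∉ closure Ω) (U : Fin m.M → ℝ) : m.fn U x = 0 := by
  have h : ¬ ∃ K, x ∈ m.elt K := fun ⟨K, hK⟩ => hx (m.elt_subset_closure K hK)
  simp [fn, hat, h]

lemma measurable_fn (U : Fin m.M → ℝ) : Measurable (m.fn U) := by
  classical
  have h : m.fn U = (closure Ω).piecewise (m.fn U) (fun _ => 0) := by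
    ext x
    by_cases hx : x ∈ closure Ω
    · rw [piecewise_eq_of_mem _ _ _ hx]
    · rw [piecewise_eq_of_notMem _ _ _ hx, m.fn_of_notMem hx]
  rw [h]
  exact (m.continuousOn_fn U).measurable_piecewise continuousOn_const isClosed_closure.measurableSet

lemma sq_lintegral_Icc_le {f : ℝ → ℝ≥0∞} (hf : Measurable f) :
    (∫⁻ s in Icc (0 : ℝ) 1, f s) ^ 2 ≤ ∫⁻ s in Icc (0 : ℝ) 1, f s ^ 2 := by
  have h := ENNReal.lintegral_mul_le_Lp_mul_Lq (volume.restrict (Icc (0 : ℝ) 1))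
    Real.HolderConjugate.two_two hf.aemeasurable (g := fun _ => 1) aemeasurable_const
  simp only [Pi.mul_apply, mul_one, lintegral_const, Measure.restrict_apply_univ,
    Real.volume_Icc, sub_zero, ENNReal.ofReal_one, ENNReal.rpow_two, one_pow, ENNReal.one_rpow] at h
  calc _ ≤ ((∫⁻ s in Icc (0 : ℝ) 1, f s ^ 2) ^ (1 / 2 : ℝ)) ^ 2 := by gcongr
    _ = _ := by
        rw [← ENNReal.rpow_natCast, ← ENNReal.rpow_mul]
        norm_num

/-- Along the segment the function is continuous, and Lipschitz with constant |∇U| |v| on the part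
lying in each element. `gradNorm` adds up all elements containing a point, so the bound holds for
every segment, even one running inside a face. -/
lemma ofReal_abs_fn_sub_le (U : Fin m.M → ℝ) {x v : E d}
    (h : ∀ s ∈ Icc (0 : ℝ) 1, x + s • v ∈ closure Ω) :
    ENNReal.ofReal |m.fn U (x + v) - m.fn U x| ≤
      ENNReal.ofReal ‖v‖ * ∫⁻ s in Icc (0 : ℝ) 1, m.gradNorm U (x + s • v) := by
  set f : ℝ → ℝ := fun s => m.fn U (x + s • v) with hf
  have hγ : Continuous fun s : ℝ => x + s • v := by fun_prop
  have hfc : ContinuousOn f (Icc 0 1) :=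
    (m.continuousOn_fn U).comp hγ.continuousOn h
  set J : Fin m.nElt → Set ℝ := fun K => (fun s : ℝ => x + s • v) ⁻¹' m.elt K with hJ
  have hJm : ∀ K, MeasurableSet (J K) := fun K => hγ.measurable (m.measurableSet_elt K)
  have hcov : Icc (0 : ℝ) 1 ⊆ ⋃ K, (J K ∩ Icc 0 1) := by
    intro s hs
    obtain ⟨K, hK⟩ := m.exists_mem_elt (h s hs)
    exact mem_iUnion.2 ⟨K, hK, hs⟩
  have hLip : ∀ K, LipschitzOnWith (‖m.grad K U‖₊ * ‖v‖₊) f (J K ∩ Icc 0 1) := by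
    intro K
    refine LipschitzOnWith.of_dist_le_mul ?_
    rintro s ⟨hs, -⟩ t ⟨ht, -⟩
    have hs' : f s = m.lin K U (x + s • v) := m.fn_eq_lin hs U
    have ht' : f t = m.lin K U (x + t • v) := m.fn_eq_lin ht U
    rw [Real.dist_eq, hs', ht', lin_sub, add_sub_add_left_eq_sub,
      ← sub_smul]
    refine (abs_real_inner_le_norm _ _).trans ?_
    rw [norm_smul, Real.dist_eq, Real.norm_eq_abs]
    simp only [NNReal.coe_mul, coe_nnnorm]
    exact le_of_eq (by ring)
  have hmain := ofReal_abs_sub_le_sum hfc _ _ hcov hLip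
  simp only [hf, one_smul, zero_smul, add_zero] at hmain
  refine hmain.trans (le_of_eq ?_)
  simp only [gradNorm]
  rw [lintegral_finsetSum _ fun K _ => ?_, Finset.mul_sum]
  · refine Finset.sum_congr rfl fun K _ => ?_
    have : ∀ s : ℝ, (m.elt K).indicator (fun _ => ‖m.grad K U‖ₑ) (x + s • v) =
        (J K).indicator (fun _ => ‖m.grad K U‖ₑ) s := fun s => rfl
    simp only [this]
    rw [lintegral_indicator (hJm K), setLIntegral_const, Measure.restrict_apply (hJm K), ENNReal.coe_mul, ofReal_norm]
    simp only [enorm_eq_nnnorm]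
    ring
  · exact (measurable_const.indicator (m.measurableSet_elt K)).comp hγ.measurable

lemma isGradBound_fn (U : Fin m.M → ℝ) :
    IsGradBound Ω (m.fn U) fun x => m.gradNorm U x ^ 2 where
  meas_u := m.measurable_fn U
  meas_H := (m.measurable_gradNorm U).pow_const 2
  bound x v h := by
    have hγ : Measurable fun s : ℝ => x + s • v := by fun_prop
    have h1 := m.ofReal_abs_fn_sub_le U fun s hs => subset_closure (h s hs)
    calc ENNReal.ofReal ((m.fn U (x + v) - m.fn U x) ^ 2)
        = ENNReal.ofReal |m.fn U (x + v) - m.fn U x| ^ 2 := by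
          rw [← ENNReal.ofReal_pow (abs_nonneg _), sq_abs]
      _ ≤ (ENNReal.ofReal ‖v‖ * ∫⁻ s in Icc (0 : ℝ) 1, m.gradNorm U (x + s • v)) ^ 2 := by gcongr
      _ = ENNReal.ofReal (‖v‖ ^ 2) * (∫⁻ s in Icc (0 : ℝ) 1, m.gradNorm U (x + s • v)) ^ 2 := by
          rw [mul_pow, ENNReal.ofReal_pow (norm_nonneg _)]
      _ ≤ _ := by
          gcongr
          exact sq_lintegral_Icc_le ((m.measurable_gradNorm U).comp hγ)

lemma lintegral_gradNorm_le (U : Fin m.M → ℝ) :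
    ∫⁻ x in Ω, m.gradNorm U x ^ 2 ≤ ENNReal.ofReal (m.dirichlet U) := by
  refine (lintegral_mono_set subset_closure).trans ((m.lintegral_closure _).trans ?_)
  rw [dirichlet, ENNReal.ofReal_sum_of_nonneg fun K _ =>
    mul_nonneg (m.vol_nonneg K) (sq_nonneg _)]
  refine Finset.sum_le_sum fun K _ => le_of_eq ?_
  have hae : ∀ᵐ x ∂(volume.restrict (m.elt K)), m.gradNorm U x ^ 2 = ‖m.grad K U‖ₑ ^ 2 := by
    have h1 : ∀ᵐ x, ∀ K', K' ≠ K → x ∉ m.elt K ∩ m.elt K' := by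
      refine ae_all_iff.2 fun K' => ?_
      by_cases h : K' = K
      · exact ae_of_all _ fun x h' => absurd h h'
      · filter_upwards [measure_eq_zero_iff_ae_notMem.1 (m.volume_elt_inter (Ne.symm h))]
          with x hx _ using hx
    filter_upwards [ae_restrict_of_ae h1, ae_restrict_mem (m.measurableSet_elt K)] with x hx hxK
    rw [gradNorm, Finset.sum_eq_single K, indicator_of_mem hxK]
    · intro K' _ hK'
      exact indicator_of_notMem (fun h => hx K' hK' ⟨hxK, h⟩) _
    · simp
  rw [lintegral_congr_ae hae, setLIntegral_const, vol, ENNReal.ofReal_mul measureReal_nonneg,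
    Measure.real, ENNReal.ofReal_toReal (m.volume_elt_ne_top K), mul_comm,
    ENNReal.ofReal_pow (norm_nonneg _), ofReal_norm]

/-- The discrete Poincaré inequality, with a constant independent of the mesh. -/
theorem exists_discrete_poincare (ho : IsOpen Ω) (hc : IsConnected Ω)
    (hb : Bornology.IsBounded Ω) (hL : HasLipschitzBoundary Ω) :
    ∃ C : ℝ, 0 ≤ C ∧ ∀ (m : Mesh Ω) (U : Fin m.M → ℝ),
      ∃ c : ℝ, ∑ i, m.mass i * (U i - c) ^ 2 ≤ C * m.dirichlet U := by
  obtain ⟨C, hC⟩ := exists_poincare ho hc hb hL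
  refine ⟨2 * C + 2 * Metric.diam (closure Ω) ^ 2, by positivity, fun m U => ?_⟩
  obtain ⟨c, hcU⟩ := hC _ _ (m.isGradBound_fn U)
  refine ⟨c, ?_⟩
  have hae := m.closure_ae_eq hL ho
  have hD := m.dirichlet_nonneg U
  have hint : IntegrableOn (fun x => (m.fn U x - c) ^ 2) (closure Ω) :=
    (((m.continuousOn_fn U).sub continuousOn_const).pow 2).integrableOn_compact m.isCompact_closure
  have h1 : ∫ x in closure Ω, (m.fn U x - c) ^ 2 ≤ C * m.dirichlet U := by
    rw [setIntegral_congr_set hae, integral_eq_lintegral_of_nonneg_ae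
      (ae_of_all _ fun x => sq_nonneg _) ((((m.measurable_fn U).sub_const c).pow_const 2).aestronglyMeasurable)]
    refine ENNReal.toReal_le_of_le_ofReal (by positivity) (hcU.trans ?_)
    rw [ENNReal.ofReal_mul C.coe_nonneg, ENNReal.ofReal_coe_nnreal]
    gcongr
    exact m.lintegral_gradNorm_le U
  rw [m.setIntegral_closure hint] at h1
  have hdiam : ∀ K, m.diam K ≤ Metric.diam (closure Ω) := fun K =>
    Metric.diam_mono (m.elt_subset_closure K) m.isCompact_closure.isBounded
  -- The Poincaré inequality controls the L² norm, while the lumped norm uses nodal values; they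
  -- differ on K by at most h_K |∇U|, with h_K bounded by the diameter of Ω.
  have hK : ∀ K a, m.vol K * (U (m.vert K a) - c) ^ 2 ≤
      2 * (∫ x in m.elt K, (m.fn U x - c) ^ 2) +
        2 * Metric.diam (closure Ω) ^ 2 * (m.vol K * ‖m.grad K U‖ ^ 2) := by
    intro K a
    have hconst : IntegrableOn (fun _ : E d => 2 * (Metric.diam (closure Ω) ^ 2 * ‖m.grad K U‖ ^ 2))
        (m.elt K) := integrableOn_const (m.volume_elt_ne_top K)
    have hintK := hint.mono_set (m.elt_subset_closure K)
    calc m.vol K * (U (m.vert K a) - c) ^ 2 = ∫ _ in m.elt K, (U (m.vert K a) - c) ^ 2 := by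
          rw [setIntegral_const, smul_eq_mul, vol]
      _ ≤ ∫ x in m.elt K, (2 * (m.fn U x - c) ^ 2 +
            2 * (Metric.diam (closure Ω) ^ 2 * ‖m.grad K U‖ ^ 2)) := by
          refine setIntegral_mono_on (integrableOn_const (m.volume_elt_ne_top K))
            ((hintK.const_mul 2).add hconst) (m.measurableSet_elt K) fun x hx => ?_
          have h2 := m.abs_lin_sub_le U (m.node_mem_elt K a) hx
          rw [lin_node, ← m.fn_eq_lin hx] at h2
          have h3 : |U (m.vert K a) - m.fn U x| ≤ ‖m.grad K U‖ * Metric.diam (closure Ω) :=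
            h2.trans (by gcongr; exact hdiam K)
          have h4 : (U (m.vert K a) - m.fn U x) ^ 2 ≤
              Metric.diam (closure Ω) ^ 2 * ‖m.grad K U‖ ^ 2 := by
            rw [← sq_abs, ← mul_pow, mul_comm (Metric.diam _)]
            gcongr
          nlinarith [sq_nonneg (U (m.vert K a) - m.fn U x - (m.fn U x - c))]
      _ = _ := by
          rw [integral_add (hintK.const_mul 2) hconst, integral_const_mul, setIntegral_const,
            smul_eq_mul, vol]
          ring
  rw [m.sum_mass_mul fun i => (U i - c) ^ 2]
  calc 1 / ((d : ℝ) + 1) * ∑ K, m.vol K * ∑ a, (U (m.vert K a) - c) ^ 2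
      ≤ 1 / ((d : ℝ) + 1) * ∑ K, ∑ _a : Fin (d + 1), (2 * (∫ x in m.elt K, (m.fn U x - c) ^ 2) +
        2 * Metric.diam (closure Ω) ^ 2 * (m.vol K * ‖m.grad K U‖ ^ 2)) := by
        gcongr with K
        rw [Finset.mul_sum]
        gcongr with a
        exact hK K a
    _ = 2 * ∑ K, (∫ x in m.elt K, (m.fn U x - c) ^ 2) +
        2 * Metric.diam (closure Ω) ^ 2 * m.dirichlet U := by
        simp only [Finset.sum_const, Finset.card_univ, Fintype.card_fin, nsmul_eq_mul,
          ← Finset.mul_sum, Finset.sum_add_distrib, dirichlet]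
        push_cast
        field_simp
    _ ≤ 2 * (C * m.dirichlet U) + 2 * Metric.diam (closure Ω) ^ 2 * m.dirichlet U := by gcongr
    _ = _ := by ring

end Mesh

end TwoPhase

namespace TwoPhase

lemma ext_of_mem {f : ℝ → ℝ} {s : ℝ} (hs : s ∈ Icc (0 : ℝ) 1) : ext f s = f s := by
  rw [ext, projIcc_of_mem zero_le_one hs]

lemma ext_of_nonpos {f : ℝ → ℝ} {s : ℝ} (hs : s ≤ 0) : ext f s = f 0 := by
  rw [ext, projIcc_of_le_left zero_le_one hs]

lemma ext_of_one_le {f : ℝ → ℝ} {s : ℝ} (hs : 1 ≤ s) : ext f s = f 1 := by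
  rw [ext, projIcc_of_right_le zero_le_one hs]

lemma exists_ext_eq (s : ℝ) : ∃ t ∈ Icc (0 : ℝ) 1, ∀ f : ℝ → ℝ, ext f s = f t :=
  ⟨projIcc (0 : ℝ) 1 zero_le_one s, (projIcc (0 : ℝ) 1 zero_le_one s).2, fun _ => rfl⟩

namespace Data

variable {d : ℕ} {D : Data d}

/-! ### The nonlinear functions of the saturation -/

lemma BasicAssumptions.add_pos (hD : D.BasicAssumptions) {s : ℝ} (hs : s ∈ Icc (0 : ℝ) 1) :
    0 < D.ηw s + D.ηo s := by
  obtain ⟨η, h0, h⟩ := hD.η_lower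
  exact h0.trans_le (h s hs)

lemma BasicAssumptions.ext_ηw_nonneg (hD : D.BasicAssumptions) (s : ℝ) : 0 ≤ ext D.ηw s := by
  obtain ⟨t, ht, h⟩ := exists_ext_eq s
  rw [h]; exact hD.ηw_nonneg t ht

lemma BasicAssumptions.ext_ηo_nonneg (hD : D.BasicAssumptions) (s : ℝ) : 0 ≤ ext D.ηo s := by
  obtain ⟨t, ht, h⟩ := exists_ext_eq s
  rw [h]; exact hD.ηo_nonneg t ht

lemma BasicAssumptions.fw_mem (hD : D.BasicAssumptions) (s : ℝ) : D.fw s ∈ Icc (0 : ℝ) 1 := by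
  obtain ⟨t, ht, h⟩ := exists_ext_eq s
  have h1 := hD.ηw_nonneg t ht
  have h2 := hD.ηo_nonneg t ht
  rw [fw, h, h]
  exact ⟨by positivity, div_le_one_of_le₀ (by linarith) (by positivity)⟩

lemma BasicAssumptions.fo_mem (hD : D.BasicAssumptions) (s : ℝ) : D.fo s ∈ Icc (0 : ℝ) 1 := by
  have := hD.fw_mem s
  rw [fo]
  exact ⟨by linarith [this.2], by linarith [this.1]⟩

lemma fw_of_nonpos (hP : D.PowerLaw) {s : ℝ} (hs : s ≤ 0) : D.fw s = 0 := by
  rw [fw, ext_of_nonpos hs, hP.ηw_zero, zero_div]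

lemma fo_of_one_le (hD : D.BasicAssumptions) (hP : D.PowerLaw) {s : ℝ} (hs : 1 ≤ s) :
    D.fo s = 0 := by
  have := hD.add_pos (right_mem_Icc.2 zero_le_one)
  rw [hP.ηo_one, add_zero] at this
  rw [fo, fw, ext_of_one_le hs, ext_of_one_le hs, hP.ηo_one, add_zero, div_self this.ne', sub_self]

lemma BasicAssumptions.pc_cont (hD : D.BasicAssumptions) : ContinuousOn D.pc (Icc 0 1) := by
  have := hD.pc_ac.continuousOn
  rwa [uIcc_of_le zero_le_one] at this

lemma BasicAssumptions.integral_deriv_pc (hD : D.BasicAssumptions) {a b : ℝ}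
    (ha : a ∈ Icc (0 : ℝ) 1) (hb : b ∈ Icc (0 : ℝ) 1) :
    ∫ s in a..b, deriv D.pc s = D.pc b - D.pc a := by
  refine (hD.pc_ac.mono ?_).integral_deriv_eq_sub
  rw [uIcc_of_le (zero_le_one (α := ℝ))]
  exact ordConnected_Icc.uIcc_subset ha hb

lemma BasicAssumptions.intervalIntegrable_mul_deriv_pc (hD : D.BasicAssumptions) {w : ℝ → ℝ}
    (hw : ContinuousOn w (Icc 0 1)) {a b : ℝ}
    (ha : a ∈ Icc (0 : ℝ) 1) (hb : b ∈ Icc (0 : ℝ) 1) :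
    IntervalIntegrable (fun s => w s * deriv D.pc s) volume a b := by
  have h : IntervalIntegrable (fun s => w s * deriv D.pc s) volume 0 1 :=
    hD.pc_ac.intervalIntegrable_deriv.continuousOn_mul (by rwa [uIcc_of_le zero_le_one])
  refine h.mono_set ?_
  rw [uIcc_of_le (zero_le_one (α := ℝ))]
  exact ordConnected_Icc.uIcc_subset ha hb

lemma PowerLaw.deriv_pc_nonpos (hP : D.PowerLaw) :
    ∀ᵐ x ∂(volume.restrict (Ioo (0 : ℝ) 1)), deriv D.pc x ≤ 0 := by
  obtain ⟨α, β, γ, h0, -, -, -, h⟩ := hP.pc_deriv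
  filter_upwards [h, ae_restrict_mem measurableSet_Ioo] with x hx hx'
  have : 0 ≤ α * (x ^ (β - 1) * (1 - x) ^ (γ - 1)) :=
    mul_nonneg h0.le (mul_nonneg (Real.rpow_nonneg hx'.1.le _)
      (Real.rpow_nonneg (sub_nonneg.2 hx'.2.le) _))
  linarith [hx.1]

/-- Almost everywhere properties in `]0,1[` hold almost everywhere in subintervals of `[0,1]`. -/
lemma ae_restrict_Ioc {p : ℝ → Prop} (h : ∀ᵐ x ∂(volume.restrict (Ioo (0 : ℝ) 1)), p x)
    {a b : ℝ} (ha : a ∈ Icc (0 : ℝ) 1) (hb : b ∈ Icc (0 : ℝ) 1) :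
    ∀ᵐ x ∂(volume.restrict (Ioc a b)), p x := by
  rw [← restrict_Ioo_eq_restrict_Ioc]
  exact ae_restrict_of_ae_restrict_of_subset (Ioo_subset_Ioo ha.1 hb.2) h

/-- The primitive of `w p_c'`. -/
noncomputable def capPrim (D : Data d) (w : ℝ → ℝ) (x : ℝ) : ℝ :=
  ∫ s in (0 : ℝ)..x, w s * deriv D.pc s

lemma capPrim_sub (hD : D.BasicAssumptions) {w : ℝ → ℝ} (hw : ContinuousOn w (Icc 0 1)) {a b : ℝ}
    (ha : a ∈ Icc (0 : ℝ) 1) (hb : b ∈ Icc (0 : ℝ) 1) :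
    D.capPrim w a - D.capPrim w b = ∫ s in a..b, w s * -deriv D.pc s := by
  have h0 : (0 : ℝ) ∈ Icc (0 : ℝ) 1 := left_mem_Icc.2 zero_le_one
  simp only [mul_neg, intervalIntegral.integral_neg]
  rw [← intervalIntegral.integral_symm,
    ← intervalIntegral.integral_interval_sub_left (hD.intervalIntegrable_mul_deriv_pc hw h0 ha)
      (hD.intervalIntegrable_mul_deriv_pc hw h0 hb)]
  rfl

/-- A mean value inequality for the nonnegative measure -p_c' ds. -/
lemma mul_le_capPrim_sub (hD : D.BasicAssumptions) (hP : D.PowerLaw) {w : ℝ → ℝ}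
    (hw : ContinuousOn w (Icc 0 1)) {a b : ℝ} (ha : a ∈ Icc (0 : ℝ) 1) (hb : b ∈ Icc (0 : ℝ) 1)
    (hab : a ≤ b) {c : ℝ} (hc : ∀ s ∈ Icc a b, c ≤ w s) :
    c * (D.pc a - D.pc b) ≤ D.capPrim w a - D.capPrim w b := by
  rw [capPrim_sub hD hw ha hb]
  have h1 : c * (D.pc a - D.pc b) = ∫ s in a..b, c * -deriv D.pc s := by
    rw [intervalIntegral.integral_const_mul, intervalIntegral.integral_neg,
      hD.integral_deriv_pc ha hb]
    ring
  rw [h1]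
  refine intervalIntegral.integral_mono_ae_restrict hab ?_ ?_ ?_
  · simp only [mul_neg]
    exact (hD.intervalIntegrable_mul_deriv_pc continuousOn_const ha hb (w := fun _ => c)).neg
  · simp only [mul_neg]
    exact (hD.intervalIntegrable_mul_deriv_pc hw ha hb).neg
  · rw [← restrict_Ioc_eq_restrict_Icc]
    filter_upwards [ae_restrict_Ioc hP.deriv_pc_nonpos ha hb, ae_restrict_mem measurableSet_Ioc]
      with s hs hs'
    exact mul_le_mul_of_nonneg_right (hc s (Ioc_subset_Icc_self hs')) (neg_nonneg.2 hs)

lemma capPrim_sub_le_mul (hD : D.BasicAssumptions) (hP : D.PowerLaw) {w : ℝ → ℝ}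
    (hw : ContinuousOn w (Icc 0 1)) {a b : ℝ} (ha : a ∈ Icc (0 : ℝ) 1) (hb : b ∈ Icc (0 : ℝ) 1)
    (hab : a ≤ b) {c : ℝ} (hc : ∀ s ∈ Icc a b, w s ≤ c) :
    D.capPrim w a - D.capPrim w b ≤ c * (D.pc a - D.pc b) := by
  have h := mul_le_capPrim_sub hD hP hw.neg ha hb hab (c := -c) fun s hs => neg_le_neg (hc s hs)
  have h2 : ∀ x, D.capPrim (fun s => -w s) x = -D.capPrim w x := by
    intro x
    simp only [capPrim, neg_mul, intervalIntegral.integral_neg]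
  have h3 : D.capPrim (-w) = fun x => -D.capPrim w x := funext h2
  rw [h3] at h
  linarith

lemma pc_sub_nonneg (hD : D.BasicAssumptions) {a b : ℝ} (ha : a ∈ Icc (0 : ℝ) 1)
    (hb : b ∈ Icc (0 : ℝ) 1) (hab : a ≤ b) : 0 ≤ D.pc a - D.pc b :=
  sub_nonneg.2 (hD.pc_strictAnti.antitoneOn ha hb hab)

/-- The coefficient `η_w η_o / (η_w + η_o)`. -/
noncomputable def mob (D : Data d) (s : ℝ) : ℝ := D.ηw s * D.ηo s / (D.ηw s + D.ηo s)

/-- The fractional flow of the non-wetting phase on `[0,1]`. -/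
noncomputable def frac (D : Data d) (s : ℝ) : ℝ := D.ηo s / (D.ηw s + D.ηo s)

lemma BasicAssumptions.mob_cont (hD : D.BasicAssumptions) : ContinuousOn D.mob (Icc 0 1) :=
  (hD.ηw_cont.mul hD.ηo_cont).div (hD.ηw_cont.add hD.ηo_cont) fun _ hs => (hD.add_pos hs).ne'

lemma BasicAssumptions.frac_cont (hD : D.BasicAssumptions) : ContinuousOn D.frac (Icc 0 1) :=
  hD.ηo_cont.div (hD.ηw_cont.add hD.ηo_cont) fun _ hs => (hD.add_pos hs).ne'

lemma BasicAssumptions.mob_nonneg (hD : D.BasicAssumptions) {s : ℝ} (hs : s ∈ Icc (0 : ℝ) 1) :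
    0 ≤ D.mob s :=
  div_nonneg (mul_nonneg (hD.ηw_nonneg s hs) (hD.ηo_nonneg s hs)) (hD.add_pos hs).le

lemma BasicAssumptions.mob_le_ηo (hD : D.BasicAssumptions) {s : ℝ} (hs : s ∈ Icc (0 : ℝ) 1) :
    D.mob s ≤ D.ηo s := by
  rw [mob, div_le_iff₀ (hD.add_pos hs)]
  nlinarith [hD.ηw_nonneg s hs, hD.ηo_nonneg s hs]

lemma BasicAssumptions.mob_le_ηw (hD : D.BasicAssumptions) {s : ℝ} (hs : s ∈ Icc (0 : ℝ) 1) :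
    D.mob s ≤ D.ηw s := by
  rw [mob, div_le_iff₀ (hD.add_pos hs)]
  nlinarith [hD.ηw_nonneg s hs, hD.ηo_nonneg s hs]

lemma BasicAssumptions.frac_anti (hD : D.BasicAssumptions) : AntitoneOn D.frac (Icc 0 1) := by
  intro a ha b hb hab
  have h1 := hD.ηw_mono ha hb hab
  have h2 := hD.ηo_anti ha hb hab
  rw [frac, frac, div_le_div_iff₀ (hD.add_pos hb) (hD.add_pos ha)]
  nlinarith [hD.ηw_nonneg a ha, hD.ηo_nonneg b hb, hD.ηw_nonneg b hb, hD.ηo_nonneg a ha]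

lemma BasicAssumptions.frac_mem (hD : D.BasicAssumptions) {s : ℝ} (hs : s ∈ Icc (0 : ℝ) 1) :
    D.frac s ∈ Icc (0 : ℝ) 1 := by
  have h1 := hD.ηw_nonneg s hs
  have h2 := hD.ηo_nonneg s hs
  exact ⟨div_nonneg h2 (by linarith), div_le_one_of_le₀ (by linarith) (by linarith)⟩

lemma g_eq (D : Data d) (x : ℝ) : D.g x = -D.capPrim D.mob x := rfl

lemma g_sub_nonneg (hD : D.BasicAssumptions) (hP : D.PowerLaw) {a b : ℝ} (ha : a ∈ Icc (0 : ℝ) 1)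
    (hb : b ∈ Icc (0 : ℝ) 1) (hab : a ≤ b) : 0 ≤ D.g b - D.g a := by
  have := mul_le_capPrim_sub hD hP hD.mob_cont ha hb hab (c := 0)
    fun s hs => hD.mob_nonneg ⟨ha.1.trans hs.1, hs.2.trans hb.2⟩
  rw [zero_mul] at this
  rw [g_eq, g_eq]
  linarith

lemma g_sub_le (hD : D.BasicAssumptions) (hP : D.PowerLaw) {a b : ℝ} (ha : a ∈ Icc (0 : ℝ) 1)
    (hb : b ∈ Icc (0 : ℝ) 1) (hab : a ≤ b) {c : ℝ} (hc : ∀ s ∈ Icc a b, D.mob s ≤ c) :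
    D.g b - D.g a ≤ c * (D.pc a - D.pc b) := by
  have := capPrim_sub_le_mul hD hP hD.mob_cont ha hb hab hc
  rw [g_eq, g_eq]
  linarith

lemma g_monotoneOn (hD : D.BasicAssumptions) (hP : D.PowerLaw) : MonotoneOn D.g (Icc 0 1) :=
  fun _ ha _ hb hab => sub_nonneg.1 (g_sub_nonneg hD hP ha hb hab)

/-- The degenerate mobility compensates for the singularities of the capillary pressure. -/
lemma exists_g_lipschitz (hD : D.BasicAssumptions) (hP : D.PowerLaw) :
    ∃ L : ℝ, 0 ≤ L ∧ ∀ a ∈ Icc (0 : ℝ) 1, ∀ b ∈ Icc (0 : ℝ) 1, |D.g a - D.g b| ≤ L * |a - b| := by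
  obtain ⟨Lw, hLw⟩ := hP.ηw_lipschitz
  obtain ⟨Lo, hLo⟩ := hP.ηo_lipschitz
  obtain ⟨η, hη, hηs⟩ := hD.η_lower
  obtain ⟨α, β, γ, hα, -, hβ, hγ, hpc⟩ := hP.pc_deriv
  have h0 : (0 : ℝ) ∈ Icc (0 : ℝ) 1 := left_mem_Icc.2 zero_le_one
  have h1 : (1 : ℝ) ∈ Icc (0 : ℝ) 1 := right_mem_Icc.2 zero_le_one
  set L : ℝ := Lw * Lo / η * (1 / α) with hL
  have hL0 : 0 ≤ L := by positivity
  -- Both mobilities vanish at least linearly at their degenerate ends, which raises the exponents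
  -- β₃ - 1 and β₄ - 1 to the positive β₃ and β₄.
  have hbound : ∀ᵐ x ∂(volume.restrict (Ioo (0 : ℝ) 1)), D.mob x * -deriv D.pc x ≤ L := by
    filter_upwards [hpc, ae_restrict_mem measurableSet_Ioo] with x hx hx'
    have hxI : x ∈ Icc (0 : ℝ) 1 := Ioo_subset_Icc_self hx'
    have hx0 : 0 < x := hx'.1
    have hx1 : 0 < 1 - x := sub_pos.2 hx'.2
    have hw : D.ηw x ≤ Lw * x := by
      have := hLw.dist_le_mul x hxI 0 h0
      rw [hP.ηw_zero, Real.dist_eq, Real.dist_eq, sub_zero, sub_zero, abs_of_pos hx0] at this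
      exact (le_abs_self _).trans this
    have ho : D.ηo x ≤ Lo * (1 - x) := by
      have := hLo.dist_le_mul x hxI 1 h1
      rw [hP.ηo_one, Real.dist_eq, Real.dist_eq, sub_zero, abs_sub_comm x, abs_of_pos hx1] at this
      exact (le_abs_self _).trans this
    have hm : D.mob x ≤ Lw * x * (Lo * (1 - x)) / η := by
      rw [mob]
      have := hD.ηo_nonneg x hxI
      gcongr
      exact hηs x hxI
    have hp0 : 0 ≤ x ^ (β - 1) * (1 - x) ^ (γ - 1) := by positivity
    calc D.mob x * -deriv D.pc x
        ≤ D.mob x * (1 / α * (x ^ (β - 1) * (1 - x) ^ (γ - 1))) :=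
          mul_le_mul_of_nonneg_left hx.2 (hD.mob_nonneg hxI)
      _ ≤ Lw * x * (Lo * (1 - x)) / η * (1 / α * (x ^ (β - 1) * (1 - x) ^ (γ - 1))) := by
          gcongr
      _ = L * ((x * x ^ (β - 1)) * ((1 - x) * (1 - x) ^ (γ - 1))) := by rw [hL]; ring
      _ = L * (x ^ β * (1 - x) ^ γ) := by
          rw [← Real.rpow_one_add' hx0.le (by linarith), ← Real.rpow_one_add' hx1.le (by linarith),
            add_sub_cancel, add_sub_cancel]
      _ ≤ L * (1 * 1) := by
          gcongr
          · exact Real.rpow_le_one hx0.le hx'.2.le hβ.le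
          · exact Real.rpow_le_one hx1.le (by linarith) hγ.le
      _ = L := by ring
  have hmain : ∀ a ∈ Icc (0 : ℝ) 1, ∀ b ∈ Icc (0 : ℝ) 1, a ≤ b → D.g b - D.g a ≤ L * (b - a) := by
    intro a ha b hb hab
    have h2 := capPrim_sub hD hD.mob_cont ha hb
    have h3 : ∫ s in a..b, D.mob s * -deriv D.pc s ≤ ∫ _ in a..b, L := by
      refine intervalIntegral.integral_mono_ae_restrict hab ?_ intervalIntegrable_const ?_
      · simp only [mul_neg]
        exact (hD.intervalIntegrable_mul_deriv_pc hD.mob_cont ha hb).neg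
      · rw [← restrict_Ioc_eq_restrict_Icc]
        exact ae_restrict_Ioc hbound ha hb
    rw [intervalIntegral.integral_const, smul_eq_mul] at h3
    rw [g_eq, g_eq]
    linarith
  refine ⟨L, hL0, fun a ha b hb => ?_⟩
  rcases le_total a b with hab | hab
  · rw [abs_sub_comm, abs_of_nonneg (g_sub_nonneg hD hP ha hb hab), abs_sub_comm,
      abs_of_nonneg (sub_nonneg.2 hab)]
    exact hmain a ha b hb hab
  · rw [abs_of_nonneg (g_sub_nonneg hD hP hb ha hab), abs_of_nonneg (sub_nonneg.2 hab)]
    exact hmain b hb a ha hab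

/-! ### Inequalities on the edges of the mesh -/

/-- Upwind inequality for the global pressure and for `g`, between two nodes with saturations
`a ≤ b`; `xw`, `xo` are the increments of the phase pressures. -/
lemma upwind_global_pressure (hD : D.BasicAssumptions) (hP : D.PowerLaw) {η : ℝ} (hη : 0 < η)
    (hηs : ∀ s ∈ Icc (0 : ℝ) 1, η ≤ D.ηw s + D.ηo s) {a b : ℝ} (ha : a ∈ Icc (0 : ℝ) 1)
    (hb : b ∈ Icc (0 : ℝ) 1) (hab : a ≤ b) {xw xo : ℝ} (hx : xo - xw = D.pc a - D.pc b) :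
    η * (xw + (D.capPrim D.frac a - D.capPrim D.frac b)) ^ 2 ≤
      D.ηw (if 0 < xw then a else b) * xw ^ 2 + D.ηo (if 0 ≤ xo then a else b) * xo ^ 2 := by
  have hI : ∀ s ∈ Icc a b, s ∈ Icc (0 : ℝ) 1 := fun s hs => ⟨ha.1.trans hs.1, hs.2.trans hb.2⟩
  have hπ := pc_sub_nonneg hD ha hb hab
  have hlo := mul_le_capPrim_sub hD hP hD.frac_cont ha hb hab (c := D.frac b)
    fun s hs => hD.frac_anti (hI s hs) hb hs.2
  have hhi := capPrim_sub_le_mul hD hP hD.frac_cont ha hb hab (c := D.frac a)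
    fun s hs => hD.frac_anti ha (hI s hs) hs.1
  set r := D.capPrim D.frac a - D.capPrim D.frac b
  rw [← hx] at hπ hlo hhi
  have hfo : ∀ s ∈ Icc (0 : ℝ) 1, η * D.frac s ≤ D.ηo s := by
    intro s hs
    have h1 : D.frac s * (D.ηw s + D.ηo s) = D.ηo s := div_mul_cancel₀ _ (hD.add_pos hs).ne'
    nlinarith [hηs s hs, (hD.frac_mem hs).1]
  have hfw : ∀ s ∈ Icc (0 : ℝ) 1, η * (1 - D.frac s) ≤ D.ηw s := by
    intro s hs
    have h1 : D.frac s * (D.ηw s + D.ηo s) = D.ηo s := div_mul_cancel₀ _ (hD.add_pos hs).ne'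
    nlinarith [hηs s hs, (hD.frac_mem hs).2]
  -- When both phases use the same saturation s, the convex combination of xw and xo with weight
  -- f_o(s) is handled by convexity of the square, since each mobility is at least η times its
  -- fractional flow.
  have hconv : ∀ s ∈ Icc (0 : ℝ) 1, ∀ y : ℝ, y ^ 2 ≤ ((1 - D.frac s) * xw + D.frac s * xo) ^ 2 →
      η * y ^ 2 ≤ D.ηw s * xw ^ 2 + D.ηo s * xo ^ 2 := by
    intro s hs y hy
    have h1 := hD.frac_mem hs
    have h2 : ((1 - D.frac s) * xw + D.frac s * xo) ^ 2 ≤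
        (1 - D.frac s) * xw ^ 2 + D.frac s * xo ^ 2 := by
      nlinarith [mul_nonneg (mul_nonneg h1.1 (sub_nonneg.2 h1.2)) (sq_nonneg (xw - xo))]
    calc η * y ^ 2 ≤ η * ((1 - D.frac s) * xw ^ 2 + D.frac s * xo ^ 2) := by
          gcongr; exact hy.trans h2
      _ = (η * (1 - D.frac s)) * xw ^ 2 + (η * D.frac s) * xo ^ 2 := by ring
      _ ≤ _ := by
          gcongr
          · exact hfw s hs
          · exact hfo s hs
  have hfa := hD.frac_mem ha
  have hfb := hD.frac_mem hb
  -- With π = xo - xw ≥ 0, the increment of the global pressure lies between the convex combinations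
  -- of xw and xo with weights f_o(b) and f_o(a). If xw > 0, then xo ≥ 0, both upwind values are a,
  -- and the combination at a dominates.
  by_cases h1 : 0 < xw
  · have h2 : 0 ≤ xo := by linarith
    rw [if_pos h1, if_pos h2]
    refine hconv a ha _ (pow_le_pow_left₀ ?_ ?_ 2)
    · nlinarith [mul_nonneg hfb.1 hπ]
    · nlinarith
  -- Opposite flows: the wetting phase is upwinded at b and the other at a. The increment lies
  -- between (1 - f_o(b)) xw ≤ 0 and f_o(a) xo ≥ 0, and according to its sign a single phase bounds
  -- it.
  by_cases h2 : 0 ≤ xo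
  · rw [if_neg h1, if_pos h2]
    have h3 : xw + r ≤ D.frac a * xo := by
      nlinarith [mul_nonneg (sub_nonneg.2 hfa.2) (neg_nonneg.2 (not_lt.1 h1))]
    have h4 : (1 - D.frac b) * xw ≤ xw + r := by nlinarith [mul_nonneg hfb.1 h2]
    have hwb := hfw b hb
    have hoa := hfo a ha
    rcases le_total 0 (xw + r) with h5 | h5
    · calc η * (xw + r) ^ 2 ≤ η * (D.frac a * xo) ^ 2 := by gcongr
        _ = (η * D.frac a) * D.frac a * xo ^ 2 := by ring
        _ ≤ D.ηo a * 1 * xo ^ 2 := by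
            have := hD.ηo_nonneg a ha
            gcongr
            · exact hfa.1
            · exact hfa.2
        _ ≤ _ := by
            have := mul_nonneg (hD.ηw_nonneg b hb) (sq_nonneg xw)
            linarith
    · have h6 : (xw + r) ^ 2 ≤ ((1 - D.frac b) * xw) ^ 2 := by
        rw [← neg_sq, ← neg_sq ((1 - D.frac b) * xw)]
        exact pow_le_pow_left₀ (by linarith) (by linarith) 2
      have h7 : 0 ≤ 1 - D.frac b := sub_nonneg.2 hfb.2
      calc η * (xw + r) ^ 2 ≤ η * ((1 - D.frac b) * xw) ^ 2 := by gcongr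
        _ = (η * (1 - D.frac b)) * (1 - D.frac b) * xw ^ 2 := by ring
        _ ≤ D.ηw b * 1 * xw ^ 2 := by
            have := hD.ηw_nonneg b hb
            gcongr
            linarith [hfb.1]
        _ ≤ _ := by
            have := mul_nonneg (hD.ηo_nonneg a ha) (sq_nonneg xo)
            linarith
  · rw [if_neg h1, if_neg h2]
    push Not at h1 h2
    refine hconv b hb _ ?_
    rw [← neg_sq, ← neg_sq (_ + _)]
    refine pow_le_pow_left₀ ?_ ?_ 2
    · nlinarith [mul_nonneg (sub_nonneg.2 hfa.2) hπ]
    · nlinarith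

/-- The increment of g is the integral of η_w η_o/(η_w + η_o) against -p_c' ds, of total mass xo -
xw. If both increments have one sign, this mass is at most the larger of |xw| and |xo|, and the
mobility of the corresponding phase, at its upwind value, bounds the coefficient: this gives the
constant B. For opposite flows the coefficient is at most η_w(b) η_o(a)/η, which produces 2B³/η². -/
lemma upwind_g (hD : D.BasicAssumptions) (hP : D.PowerLaw) {η B : ℝ} (hη : 0 < η)
    (hηs : ∀ s ∈ Icc (0 : ℝ) 1, η ≤ D.ηw s + D.ηo s)
    (hB : ∀ s ∈ Icc (0 : ℝ) 1, D.ηw s ≤ B ∧ D.ηo s ≤ B) {a b : ℝ} (ha : a ∈ Icc (0 : ℝ) 1)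
    (hb : b ∈ Icc (0 : ℝ) 1) (hab : a ≤ b) {xw xo : ℝ} (hx : xo - xw = D.pc a - D.pc b) :
    (D.g b - D.g a) ^ 2 ≤ (B + 2 * B ^ 3 / η ^ 2) *
      (D.ηw (if 0 < xw then a else b) * xw ^ 2 + D.ηo (if 0 ≤ xo then a else b) * xo ^ 2) := by
  have hI : ∀ s ∈ Icc a b, s ∈ Icc (0 : ℝ) 1 := fun s hs => ⟨ha.1.trans hs.1, hs.2.trans hb.2⟩
  have hπ := pc_sub_nonneg hD ha hb hab
  have hg0 := g_sub_nonneg hD hP ha hb hab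
  have hwa := hD.ηw_nonneg a ha
  have hwb := hD.ηw_nonneg b hb
  have hoa := hD.ηo_nonneg a ha
  have hob := hD.ηo_nonneg b hb
  have hBwb := (hB b hb).1
  have hBoa := (hB a ha).2
  have hB0 : 0 ≤ B := hwb.trans hBwb
  by_cases h1 : 0 < xw
  · have h2 : 0 ≤ xo := by linarith
    rw [if_pos h1, if_pos h2]
    have h3 := g_sub_le hD hP ha hb hab (c := D.ηo a) fun s hs =>
      (hD.mob_le_ηo (hI s hs)).trans (hD.ηo_anti ha (hI s hs) hs.1)
    rw [← hx] at h3
    have h4 : D.g b - D.g a ≤ D.ηo a * xo := by nlinarith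
    calc (D.g b - D.g a) ^ 2 ≤ (D.ηo a * xo) ^ 2 := by gcongr
      _ = D.ηo a * (D.ηo a * xo ^ 2) := by ring
      _ ≤ (B + 2 * B ^ 3 / η ^ 2) * (D.ηw a * xw ^ 2 + D.ηo a * xo ^ 2) := by
          gcongr
          · exact hBoa.trans (le_add_of_nonneg_right (by positivity))
          · exact le_add_of_nonneg_left (by positivity)
  by_cases h2 : 0 ≤ xo
  · rw [if_neg h1, if_pos h2]
    have h3 := g_sub_le hD hP ha hb hab (c := D.ηw b * D.ηo a / η) fun s hs => by
      have hs' := hI s hs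
      rw [mob]
      have := hD.ηo_nonneg s hs'
      gcongr
      · exact hD.ηw_mono hs' hb hs.2
      · exact hD.ηo_anti ha hs' hs.1
      · exact hηs s hs'
    rw [← hx] at h3
    calc (D.g b - D.g a) ^ 2 ≤ (D.ηw b * D.ηo a / η * (xo - xw)) ^ 2 := by gcongr
      _ = (D.ηw b * D.ηo a) ^ 2 / η ^ 2 * (xo - xw) ^ 2 := by ring
      _ ≤ (D.ηw b * D.ηo a) ^ 2 / η ^ 2 * (2 * (xw ^ 2 + xo ^ 2)) := by
          gcongr
          nlinarith [sq_nonneg (xo + xw)]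
      _ = 2 / η ^ 2 * (D.ηw b * D.ηo a * D.ηo a * (D.ηw b * xw ^ 2) +
            D.ηw b * D.ηw b * D.ηo a * (D.ηo a * xo ^ 2)) := by ring
      _ ≤ 2 / η ^ 2 * (B * B * B * (D.ηw b * xw ^ 2) + B * B * B * (D.ηo a * xo ^ 2)) := by
          gcongr
      _ = 2 * B ^ 3 / η ^ 2 * (D.ηw b * xw ^ 2 + D.ηo a * xo ^ 2) := by ring
      _ ≤ _ := by
          gcongr
          exact le_add_of_nonneg_left hB0
  · rw [if_neg h1, if_neg h2]
    push Not at h1 h2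
    have h3 := g_sub_le hD hP ha hb hab (c := D.ηw b) fun s hs =>
      (hD.mob_le_ηw (hI s hs)).trans (hD.ηw_mono (hI s hs) hb hs.2)
    rw [← hx] at h3
    have h4 : D.g b - D.g a ≤ D.ηw b * -xw := by nlinarith
    calc (D.g b - D.g a) ^ 2 ≤ (D.ηw b * -xw) ^ 2 := by gcongr
      _ = D.ηw b * (D.ηw b * xw ^ 2) := by ring
      _ ≤ (B + 2 * B ^ 3 / η ^ 2) * (D.ηw b * xw ^ 2 + D.ηo b * xo ^ 2) := by
          gcongr
          · exact hBwb.trans (le_add_of_nonneg_right (by positivity))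
          · exact le_add_of_nonneg_right (by positivity)

end Data

/-! ### Upwind values and the dissipation on an edge -/

lemma upW_comm {M : ℕ} (S P : Fin M → ℝ) (i j : Fin M) : upW S P i j = upW S P j i := by
  rcases lt_trichotomy (P i) (P j) with h | h | h
  · simp [upW, h, h.not_gt]
  · simp [upW, h, max_comm]
  · simp [upW, h, h.not_gt]

lemma upO_comm {M : ℕ} (S P : Fin M → ℝ) (i j : Fin M) : upO S P i j = upO S P j i := by
  rcases lt_trichotomy (P i) (P j) with h | h | h
  · simp [upO, h, h.not_gt]
  · simp [upO, h, min_comm]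
  · simp [upO, h, h.not_gt]

/-- For equal pressures the maximum selects the upper saturation, and for the other phase the
minimum selects the lower one. This agrees with the strict and the large inequality in the edge
estimates, so the tie needs no separate case. -/
lemma upW_eq {M : ℕ} {S : Fin M → ℝ} (P : Fin M → ℝ) {i j : Fin M} (h : S j ≤ S i) :
    upW S P i j = if 0 < P j - P i then S j else S i := by
  rcases lt_trichotomy (P i) (P j) with h' | h' | h'
  · simp [upW, h', h'.not_gt]
  · simp [upW, h', h]
  · simp [upW, h', h'.not_gt]

lemma upO_eq {M : ℕ} {S : Fin M → ℝ} (P : Fin M → ℝ) {i j : Fin M} (h : S j ≤ S i) :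
    upO S P i j = if 0 ≤ P j - P i then S j else S i := by
  rcases lt_trichotomy (P i) (P j) with h' | h' | h'
  · simp [upO, h', h'.not_gt, h'.le]
  · simp [upO, h', h]
  · simp [upO, h', h'.not_ge]

namespace Data

variable {d : ℕ} {D : Data d}

/-- The dissipation on an edge. -/
noncomputable def edgeDiss (D : Data d) {M : ℕ} (S Pw Po : Fin M → ℝ) (i j : Fin M) : ℝ :=
  ext D.ηw (upW S Pw i j) * (Pw j - Pw i) ^ 2 + ext D.ηo (upO S Po i j) * (Po j - Po i) ^ 2

lemma edgeDiss_comm (D : Data d) {M : ℕ} (S Pw Po : Fin M → ℝ) (i j : Fin M) :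
    D.edgeDiss S Pw Po i j = D.edgeDiss S Pw Po j i := by
  rw [edgeDiss, edgeDiss, upW_comm, upO_comm]; ring

lemma edgeDiss_eq {M : ℕ} {S Pw Po : Fin M → ℝ} (hS : ∀ i, S i ∈ Icc (0 : ℝ) 1) {i j : Fin M}
    (h : S j ≤ S i) :
    D.edgeDiss S Pw Po i j =
      D.ηw (if 0 < Pw j - Pw i then S j else S i) * (Pw j - Pw i) ^ 2 +
      D.ηo (if 0 ≤ Po j - Po i then S j else S i) * (Po j - Po i) ^ 2 := by
  rw [edgeDiss, upW_eq Pw h, upO_eq Po h, ext_of_mem, ext_of_mem]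
  · split_ifs <;> exact hS _
  · split_ifs <;> exact hS _

lemma edge_global_pressure (hD : D.BasicAssumptions) (hP : D.PowerLaw) {η : ℝ} (hη : 0 < η)
    (hηs : ∀ s ∈ Icc (0 : ℝ) 1, η ≤ D.ηw s + D.ηo s) {M : ℕ} {S Pw Po : Fin M → ℝ}
    (hS : ∀ i, S i ∈ Icc (0 : ℝ) 1) (hcap : ∀ i, Po i - Pw i = D.pc (S i)) (i j : Fin M) :
    η * ((Pw i + D.capPrim D.frac (S i)) - (Pw j + D.capPrim D.frac (S j))) ^ 2 ≤
      D.edgeDiss S Pw Po i j := by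
  have key : ∀ i j, S j ≤ S i →
      η * ((Pw i + D.capPrim D.frac (S i)) - (Pw j + D.capPrim D.frac (S j))) ^ 2 ≤
      D.edgeDiss S Pw Po i j := by
    intro i j h
    rw [edgeDiss_eq hS h]
    refine le_trans (le_of_eq ?_) (upwind_global_pressure hD hP hη hηs (hS j) (hS i) h
      (xw := Pw j - Pw i) (xo := Po j - Po i) ?_)
    · ring
    · rw [← hcap, ← hcap]; ring
  rcases le_total (S j) (S i) with h | h
  · exact key i j h
  · rw [edgeDiss_comm, ← neg_sq, neg_sub]
    exact key j i h

lemma edge_g (hD : D.BasicAssumptions) (hP : D.PowerLaw) {η B : ℝ} (hη : 0 < η)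
    (hηs : ∀ s ∈ Icc (0 : ℝ) 1, η ≤ D.ηw s + D.ηo s)
    (hB : ∀ s ∈ Icc (0 : ℝ) 1, D.ηw s ≤ B ∧ D.ηo s ≤ B) {M : ℕ} {S Pw Po : Fin M → ℝ}
    (hS : ∀ i, S i ∈ Icc (0 : ℝ) 1) (hcap : ∀ i, Po i - Pw i = D.pc (S i)) (i j : Fin M) :
    (D.g (S i) - D.g (S j)) ^ 2 ≤ (B + 2 * B ^ 3 / η ^ 2) * D.edgeDiss S Pw Po i j := by
  have key : ∀ i j, S j ≤ S i →
      (D.g (S i) - D.g (S j)) ^ 2 ≤ (B + 2 * B ^ 3 / η ^ 2) * D.edgeDiss S Pw Po i j := by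
    intro i j h
    rw [edgeDiss_eq hS h]
    refine upwind_g hD hP hη hηs hB (hS j) (hS i) h ?_
    rw [← hcap, ← hcap]; ring
  rcases le_total (S j) (S i) with h | h
  · exact key i j h
  · rw [edgeDiss_comm, ← neg_sq, neg_sub]
    exact key j i h

end Data

end TwoPhase

namespace TwoPhase

/-- Expansion of the nonnegative integral of (V f - A)², where V is the total mass and A the
integral of f. -/
lemma sq_integral_le {α : Type*} [MeasurableSpace α] {μ : Measure α} [IsFiniteMeasure μ]
    {f : α → ℝ} (hf : MemLp f 2 μ) : (∫ x, f x ∂μ) ^ 2 ≤ μ.real univ * ∫ x, f x ^ 2 ∂μ := by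
  have h1 : Integrable f μ := hf.integrable one_le_two
  have h2 : Integrable (fun x => f x ^ 2) μ := hf.integrable_sq
  set V := μ.real univ with hV
  set A := ∫ x, f x ∂μ with hA
  have h3 : ∫ x, (V * f x - A) ^ 2 ∂μ = V * (V * ∫ x, f x ^ 2 ∂μ - A ^ 2) := by
    have : ∀ x, (V * f x - A) ^ 2 = V ^ 2 * f x ^ 2 - 2 * V * A * f x + A ^ 2 := fun x => by ring
    have h5 : Integrable (fun x => V ^ 2 * f x ^ 2 - 2 * V * A * f x) μ :=
      (h2.const_mul _).sub (h1.const_mul _)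
    simp only [this]
    rw [integral_add h5 (integrable_const _),
      integral_sub (h2.const_mul _) (h1.const_mul _), integral_const_mul, integral_const_mul,
      integral_const, ← hA, smul_eq_mul, ← hV]
    ring
  have h4 : 0 ≤ ∫ x, (V * f x - A) ^ 2 ∂μ := integral_nonneg fun x => sq_nonneg _
  rcases (measureReal_nonneg (μ := μ) (s := univ)).eq_or_lt with h0 | h0
  · have hμ : μ = 0 := by
      rw [← Measure.measure_univ_eq_zero]
      exact (measureReal_eq_zero_iff).1 h0.symm
    simp [hA, hμ]
  · rw [h3] at h4
    have := nonneg_of_mul_nonneg_right h4 h0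
    linarith

namespace Data

variable {d : ℕ} {D : Data d}

/-! ### The discrete data -/

lemma cylMeasure_eq (m : Mesh D.Ω) (hD : D.BasicAssumptions) :
    D.cylMeasure = (volume.restrict (Ioc 0 D.T)).prod (volume.restrict (closure D.Ω)) := by
  rw [cylMeasure, restrict_Ioo_eq_restrict_Ioc,
    Measure.restrict_congr_set (m.closure_ae_eq hD.lipschitz hD.isOpen)]

/-- The measure on the space-time cell of the time interval `]t_{n-1}, t_n]` and the patch `Δ_i`. -/
noncomputable def cell (m : Mesh D.Ω) (τ : ℝ) (n : ℕ) (i : Fin m.M) : Measure (ℝ × E d) :=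
  (volume.restrict (Ioc (((n : ℝ) - 1) * τ) (n * τ))).prod (volume.restrict (m.patch i))

lemma timeStep_pos (hD : D.BasicAssumptions) {N : ℕ} (hN : 1 ≤ N) : 0 < D.T / N :=
  div_pos hD.T_pos (Nat.cast_pos.2 hN)

lemma Ioc_subset_Ioc_T (hD : D.BasicAssumptions) {N n : ℕ} (hn : 1 ≤ n) (hnN : n ≤ N) :
    Ioc (((n : ℝ) - 1) * (D.T / N)) (n * (D.T / N)) ⊆ Ioc 0 D.T := by
  have hN : (0 : ℝ) < N := Nat.cast_pos.2 (hn.trans hnN)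
  have hτ := timeStep_pos hD (hn.trans hnN)
  have h1 : (1 : ℝ) ≤ n := Nat.one_le_cast.2 hn
  refine Ioc_subset_Ioc (mul_nonneg (by linarith) hτ.le) ?_
  calc (n : ℝ) * (D.T / N) ≤ N * (D.T / N) := by gcongr
    _ = D.T := by field_simp

lemma cell_le (m : Mesh D.Ω) (hD : D.BasicAssumptions) {N n : ℕ} (hn : 1 ≤ n) (hnN : n ≤ N)
    (i : Fin m.M) : cell m (D.T / N) n i ≤ D.cylMeasure := by
  rw [cylMeasure_eq m hD, cell, Measure.prod_restrict, Measure.prod_restrict]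
  exact Measure.restrict_mono_set _
    (prod_mono (Ioc_subset_Ioc_T hD hn hnN) (m.patch_subset_closure i))

instance isFiniteMeasure_cell (m : Mesh D.Ω) (τ : ℝ) (n : ℕ) (i : Fin m.M) :
    IsFiniteMeasure (cell m τ n i) := by
  have : IsFiniteMeasure (volume.restrict (m.patch i)) :=
    isFiniteMeasure_restrict.2 (measure_ne_top_of_subset (m.patch_subset_closure i)
      m.volume_closure_ne_top)
  unfold cell
  infer_instance

lemma isFiniteMeasure_cylMeasure (hD : D.BasicAssumptions) : IsFiniteMeasure D.cylMeasure := by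
  have : IsFiniteMeasure (volume.restrict D.Ω) :=
    isFiniteMeasure_restrict.2 hD.isBounded.measure_lt_top.ne
  unfold cylMeasure
  infer_instance

/-- The discrete flow rate associated with `f`. -/
noncomputable def flow (m : Mesh D.Ω) (τ : ℝ) (f : ℝ → E d → ℝ) (n : ℕ) (i : Fin m.M) : ℝ :=
  rhoTau τ (fun t => m.rhCorr (f t) i) n

/-- For almost every t the correction vanishes, and Fubini identifies the discrete rate with a mean
over a space-time cell. Nonnegativity and the L² bound follow. -/
lemma flow_eq (m : Mesh D.Ω) (hD : D.BasicAssumptions) {f : ℝ → E d → ℝ}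
    (hf : MemLp (fun p : ℝ × E d => f p.1 p.2) 2 D.cylMeasure) {N n : ℕ} (hn : 1 ≤ n)
    (hnN : n ≤ N) (i : Fin m.M) :
    flow m (D.T / N) f n i = (D.T / N * ((d + 1) * m.mass i))⁻¹ *
      ∫ p, f p.1 p.2 ∂(cell m (D.T / N) n i) := by
  have := isFiniteMeasure_cylMeasure hD
  have hint : Integrable (fun p : ℝ × E d => f p.1 p.2) D.cylMeasure := hf.integrable one_le_two
  have hcell := hint.mono_measure (cell_le m hD hn hnN i)
  have hτ := timeStep_pos hD (hn.trans hnN)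
  have hae : ∀ᵐ t ∂(volume.restrict (Ioc (((n : ℝ) - 1) * (D.T / N)) (n * (D.T / N)))),
      m.rhCorr (f t) i = ((d + 1) * m.mass i)⁻¹ * ∫ x in m.patch i, f t x := by
    have h1 : ∀ᵐ t ∂(volume.restrict (Ioc 0 D.T)), IntegrableOn (f t) D.Ω := by
      rw [← restrict_Ioo_eq_restrict_Ioc]
      exact hint.prod_right_ae
    filter_upwards [ae_restrict_of_ae_restrict_of_subset (Ioc_subset_Ioc_T hD hn hnN) h1] with t ht
    rw [m.rhCorr_eq_rh hD.lipschitz hD.isOpen ht, Mesh.rh, setAverage_eq, m.volume_patch,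
      smul_eq_mul]
  rw [flow, rhoTau, intervalIntegral.integral_of_le (by nlinarith), integral_congr_ae hae,
    integral_const_mul, cell, integral_prod _ hcell, mul_inv (D.T / N), one_div,
    mul_assoc]

lemma flow_nonneg (m : Mesh D.Ω) (hD : D.BasicAssumptions) {f : ℝ → E d → ℝ}
    (hf : MemLp (fun p : ℝ × E d => f p.1 p.2) 2 D.cylMeasure)
    (h0 : ∀ᵐ p ∂D.cylMeasure, 0 ≤ f p.1 p.2) {N n : ℕ} (hn : 1 ≤ n)
    (hnN : n ≤ N) (i : Fin m.M) : 0 ≤ flow m (D.T / N) f n i := by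
  have hτ := timeStep_pos hD (hn.trans hnN)
  have hm := m.mass_pos i
  rw [flow_eq m hD hf hn hnN]
  exact mul_nonneg (by positivity)
    (integral_nonneg_of_ae (ae_mono (cell_le m hD hn hnN i) h0))

lemma timeStep_mul_mass_mul_flow_sq_le (m : Mesh D.Ω) (hD : D.BasicAssumptions) {f : ℝ → E d → ℝ}
    (hf : MemLp (fun p : ℝ × E d => f p.1 p.2) 2 D.cylMeasure) {N n : ℕ} (hn : 1 ≤ n)
    (hnN : n ≤ N) (i : Fin m.M) :
    D.T / N * (m.mass i * flow m (D.T / N) f n i ^ 2) ≤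
      1 / ((d : ℝ) + 1) * ∫ p, f p.1 p.2 ^ 2 ∂(cell m (D.T / N) n i) := by
  have hτ := timeStep_pos hD (hn.trans hnN)
  have hm := m.mass_pos i
  have h1 := sq_integral_le (hf.mono_measure (cell_le m hD hn hnN i))
  have h2 : (cell m (D.T / N) n i).real univ = D.T / N * ((d + 1) * m.mass i) := by
    have h4 : (n : ℝ) * (D.T / N) - ((n : ℝ) - 1) * (D.T / N) = D.T / N := by ring
    rw [cell, ← univ_prod_univ, measureReal_prod_prod, measureReal_restrict_apply_univ,
      measureReal_restrict_apply_univ, m.volume_patch, Real.volume_real_Ioc_of_le (by nlinarith), h4]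
  rw [h2] at h1
  rw [flow_eq m hD hf hn hnN, mul_pow]
  set A := ∫ p, f p.1 p.2 ∂(cell m (D.T / N) n i)
  set B := ∫ p, f p.1 p.2 ^ 2 ∂(cell m (D.T / N) n i)
  set τ := D.T / N
  calc τ * (m.mass i * ((τ * ((d + 1) * m.mass i))⁻¹ ^ 2 * A ^ 2))
      ≤ τ * (m.mass i * ((τ * ((d + 1) * m.mass i))⁻¹ ^ 2 * (τ * ((d + 1) * m.mass i) * B))) := by
        gcongr
    _ = 1 / ((d : ℝ) + 1) * B := by field_simp

/-- The discrete flow rates are bounded in `L²`. -/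
lemma sum_flow_sq_le (m : Mesh D.Ω) (hD : D.BasicAssumptions) {f : ℝ → E d → ℝ}
    (hf : MemLp (fun p : ℝ × E d => f p.1 p.2) 2 D.cylMeasure) {N : ℕ} (hN : 1 ≤ N) :
    ∑ k ∈ Finset.range N, D.T / N * ∑ i, m.mass i * flow m (D.T / N) f (k + 1) i ^ 2 ≤
      ∫ p, f p.1 p.2 ^ 2 ∂D.cylMeasure := by
  have hτ := timeStep_pos hD hN
  set τ := D.T / N with hτdef
  have hsq : Integrable (fun p : ℝ × E d => f p.1 p.2 ^ 2) D.cylMeasure := hf.integrable_sq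
  have hsq' := hsq
  rw [cylMeasure_eq m hD] at hsq'
  set h : ℝ → ℝ := fun t => ∫ x in closure D.Ω, f t x ^ 2 with hh
  have hhint : IntegrableOn h (Ioc 0 D.T) := hsq'.integral_prod_left
  -- Each element is counted by its d+1 vertices, which cancels the factor 1/(d+1) of the lumped
  -- mass.
  have hk : ∀ k ∈ Finset.range N, ∑ i, ∫ p, f p.1 p.2 ^ 2 ∂(cell m τ (k + 1) i) =
      (d + 1) * ∫ t in (k : ℝ) * τ..((k + 1 : ℕ) : ℝ) * τ, h t := by
    intro k hk
    have hkN : k + 1 ≤ N := Finset.mem_range.1 hk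
    have hc := fun i => hsq.mono_measure (cell_le m hD (Nat.le_add_left 1 k) hkN i)
    have hcast : (((k + 1 : ℕ) : ℝ) - 1) = k := by push_cast; ring
    have hsub := Ioc_subset_Ioc_T hD (Nat.le_add_left 1 k) hkN
    rw [hcast] at hsub
    rw [intervalIntegral.integral_of_le (by push_cast; nlinarith), ← integral_const_mul]
    have h1 : ∀ i, ∫ p, f p.1 p.2 ^ 2 ∂(cell m τ (k + 1) i) =
        ∫ t in Ioc ((k : ℝ) * τ) (((k + 1 : ℕ) : ℝ) * τ), ∫ x in m.patch i, f t x ^ 2 := by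
      intro i
      rw [cell, integral_prod _ (hc i), hcast]
    simp only [h1]
    rw [← integral_finsetSum]
    · refine integral_congr_ae ?_
      filter_upwards [ae_restrict_of_ae_restrict_of_subset hsub hsq'.prod_right_ae] with t ht
      exact m.sum_integral_patch ht
    · intro i _
      have := (hc i).integral_prod_left
      rwa [hcast] at this
  calc ∑ k ∈ Finset.range N, τ * ∑ i, m.mass i * flow m τ f (k + 1) i ^ 2
      ≤ ∑ k ∈ Finset.range N, ∑ i, 1 / ((d : ℝ) + 1) *
          ∫ p, f p.1 p.2 ^ 2 ∂(cell m τ (k + 1) i) := by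
        refine Finset.sum_le_sum fun k hk => ?_
        rw [Finset.mul_sum]
        exact Finset.sum_le_sum fun i _ => timeStep_mul_mass_mul_flow_sq_le m hD hf
          (Nat.le_add_left 1 k) (Finset.mem_range.1 hk) i
    _ = ∑ k ∈ Finset.range N, ∫ t in (k : ℝ) * τ..((k + 1 : ℕ) : ℝ) * τ, h t := by
        refine Finset.sum_congr rfl fun k hk' => ?_
        rw [← Finset.mul_sum, hk k hk']
        field_simp
    _ = ∫ t in (0 : ℕ) * τ..(N : ℝ) * τ, h t := by
        refine intervalIntegral.sum_integral_adjacent_intervals (a := fun k : ℕ => (k : ℝ) * τ)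
          fun k hkN => ?_
        have hsub := Ioc_subset_Ioc_T hD (Nat.le_add_left 1 k) hkN
        have hcast : (((k + 1 : ℕ) : ℝ) - 1) = k := by push_cast; ring
        rw [hcast] at hsub
        rw [intervalIntegrable_iff_integrableOn_Ioc_of_le (by push_cast; nlinarith)]
        exact hhint.mono_set hsub
    _ = ∫ t in Ioc 0 D.T, h t := by
        have : (N : ℝ) * τ = D.T := by
          have : (0 : ℝ) < N := Nat.cast_pos.2 hN
          rw [hτdef]; field_simp
        rw [this, Nat.cast_zero, zero_mul, intervalIntegral.integral_of_le hD.T_pos.le]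
    _ = ∫ p, f p.1 p.2 ^ 2 ∂D.cylMeasure := by
        rw [cylMeasure_eq m hD, integral_prod _ hsq']

lemma ae_closure {p : E d → Prop} (m : Mesh D.Ω) (hD : D.BasicAssumptions)
    (h : ∀ᵐ x ∂(volume.restrict D.Ω), p x) : ∀ᵐ x ∂(volume.restrict (closure D.Ω)), p x := by
  rwa [Measure.restrict_congr_set (m.closure_ae_eq hD.lipschitz hD.isOpen)]

lemma aestronglyMeasurable_closure {f : E d → ℝ} (m : Mesh D.Ω) (hD : D.BasicAssumptions)
    (h : AEStronglyMeasurable f (volume.restrict D.Ω)) :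
    AEStronglyMeasurable f (volume.restrict (closure D.Ω)) := by
  rwa [Measure.restrict_congr_set (m.closure_ae_eq hD.lipschitz hD.isOpen)]

lemma setAverage_mem_Icc {s t : Set (E d)} (hst : s ⊆ t) (ht : volume t ≠ ∞) (hs0 : volume s ≠ 0)
    {f : E d → ℝ} {a b : ℝ} (hm : AEStronglyMeasurable f (volume.restrict t))
    (h : ∀ᵐ x ∂(volume.restrict t), f x ∈ Icc a b) : ⨍ x in s, f x ∈ Icc a b := by
  have hs : volume s ≠ ∞ := measure_ne_top_of_subset hst ht
  have h' := ae_restrict_of_ae_restrict_of_subset hst h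
  refine (convex_Icc a b).set_average_mem isClosed_Icc hs0 hs h' ?_
  have : IsFiniteMeasure (volume.restrict s) := isFiniteMeasure_restrict.2 hs
  refine Integrable.of_bound (hm.mono_set hst) (max |a| |b|) ?_
  filter_upwards [h'] with x hx
  exact abs_le_max_abs_abs hx.1 hx.2

lemma rh_s0_mem (m : Mesh D.Ω) (hD : D.BasicAssumptions) (i : Fin m.M) :
    m.rh D.s0 i ∈ Icc (0 : ℝ) 1 := by
  refine setAverage_mem_Icc (m.patch_subset_closure i) m.volume_closure_ne_top ?_
    (aestronglyMeasurable_closure m hD hD.s0_meas) (ae_closure m hD hD.s0_mem)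
  intro h
  have h1 := m.volume_patch i
  rw [Measure.real, h, ENNReal.toReal_zero] at h1
  have := m.mass_pos i
  have : 0 < ((d : ℝ) + 1) * m.mass i := by positivity
  linarith

lemma exists_mTilde_bounds (hD : D.BasicAssumptions) : ∃ a b : ℝ, 0 < a ∧ 0 < b ∧
    ∀ (m : Mesh D.Ω) (i : Fin m.M), a * m.mass i ≤ m.mTilde D.φ i ∧
      m.mTilde D.φ i ≤ b * m.mass i := by
  obtain ⟨a, b, ha, hab⟩ := hD.φ_bounds
  refine ⟨a, max b 1, ha, lt_max_of_lt_right one_pos, fun m i => ?_⟩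
  have hK : ∀ K, (⨍ x in m.elt K, D.φ x) ∈ Icc a b := fun K =>
    setAverage_mem_Icc (m.elt_subset_closure K) m.volume_closure_ne_top
      (fun h => (m.vol_pos K).ne' (by rw [Mesh.vol, Measure.real, h, ENNReal.toReal_zero]))
      (aestronglyMeasurable_closure m hD hD.φ_meas) (ae_closure m hD hab)
  constructor
  · rw [Mesh.mTilde, Mesh.mass, mul_left_comm, Finset.mul_sum]
    refine mul_le_mul_of_nonneg_left (Finset.sum_le_sum fun K _ =>
      mul_le_mul_of_nonneg_right (hK K).1 measureReal_nonneg) (by positivity)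
  · rw [Mesh.mTilde, Mesh.mass, mul_left_comm (max b 1), Finset.mul_sum _ _ (max b 1)]
    refine mul_le_mul_of_nonneg_left (Finset.sum_le_sum fun K _ =>
      mul_le_mul_of_nonneg_right ((hK K).2.trans (le_max_left _ _)) measureReal_nonneg)
      (by positivity)

end Data

end TwoPhase

/-! ### The scheme at a node and summation by parts -/

namespace TwoPhase

namespace Mesh

variable {d : ℕ} {Ω : Set (E d)} (m : Mesh Ω)

lemma form_single (W : Fin m.M → Fin m.M → ℝ) (V : Fin m.M → ℝ) (i : Fin m.M) :
    m.form W V (Pi.single i 1) = ∑ j, m.c i j * W i j * (V j - V i) := by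
  rw [form, Finset.sum_eq_single i]
  · simp
  · intro j _ hj
    simp [Pi.single_eq_of_ne hj]
  · simp

lemma ip_single (U : Fin m.M → ℝ) (i : Fin m.M) :
    m.ip U (Pi.single i 1) = m.mass i * U i := by
  rw [ip, Finset.sum_eq_single i]
  · simp
  · intro j _ hj
    simp [Pi.single_eq_of_ne hj]
  · simp

lemma ipφ_single (φ : E d → ℝ) (U : Fin m.M → ℝ) (i : Fin m.M) :
    m.ipφ φ U (Pi.single i 1) = m.mTilde φ i * U i := by
  rw [ipφ, Finset.sum_eq_single i]
  · simp
  · intro j _ hj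
    simp [Pi.single_eq_of_ne hj]
  · simp

/-- Summation by parts. -/
lemma form_eq {W : Fin m.M → Fin m.M → ℝ} (hW : ∀ i j, W i j = W j i) (V U : Fin m.M → ℝ) :
    m.form W V U =
      -(1 / 2 * ∑ i, ∑ j, m.c i j * (W i j * ((V j - V i) * (U j - U i)))) := by
  have h1 : m.form W V U = ∑ i, ∑ j, -(U j * m.c i j * W i j * (V j - V i)) := by
    rw [form, Finset.sum_comm]
    refine Finset.sum_congr rfl fun j _ => Finset.sum_congr rfl fun i _ => ?_
    rw [m.c_comm i j, hW i j]; ring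
  have h2 : m.form W V U + m.form W V U =
      -∑ i, ∑ j, m.c i j * (W i j * ((V j - V i) * (U j - U i))) := by
    nth_rewrite 1 [h1]
    rw [form, ← Finset.sum_neg_distrib, ← Finset.sum_add_distrib]
    refine Finset.sum_congr rfl fun i _ => ?_
    rw [← Finset.sum_neg_distrib, ← Finset.sum_add_distrib]
    exact Finset.sum_congr rfl fun j _ => by ring
  linarith

lemma form_const {W : Fin m.M → Fin m.M → ℝ} (hW : ∀ i j, W i j = W j i) (V : Fin m.M → ℝ) :
    m.form W V (fun _ => 1) = 0 := by
  rw [m.form_eq hW]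
  simp

end Mesh

namespace Data

variable {d : ℕ} {D : Data d}

/-! ### The maximum principle and the energy estimate -/

namespace IsDiscreteSolution

variable {m : Mesh D.Ω} {N : ℕ} {S Pw Po : ℕ → Fin m.M → ℝ}

lemma qInH_nonneg (m : Mesh D.Ω) (hD : D.BasicAssumptions) {N n : ℕ} (hn : 1 ≤ n) (hnN : n ≤ N)
    (i : Fin m.M) : 0 ≤ D.qInH m (D.T / N) n i :=
  flow_nonneg m hD hD.qIn_memLp hD.qIn_nonneg hn hnN i

lemma qOutH_nonneg (m : Mesh D.Ω) (hD : D.BasicAssumptions) {N n : ℕ} (hn : 1 ≤ n) (hnN : n ≤ N)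
    (i : Fin m.M) : 0 ≤ D.qOutH m (D.T / N) n i :=
  flow_nonneg m hD hD.qOut_memLp hD.qOut_nonneg hn hnN i

lemma mTilde_pos (m : Mesh D.Ω) (hD : D.BasicAssumptions) (i : Fin m.M) : 0 < m.mTilde D.φ i := by
  obtain ⟨a, b, ha, -, h⟩ := exists_mTilde_bounds hD
  exact (mul_pos ha (m.mass_pos i)).trans_le (h m i).1

/-- The wetting phase equation at a node. -/
lemma wetting_node (h : D.IsDiscreteSolution m N S Pw Po) {n : ℕ} (hn : 1 ≤ n) (hnN : n ≤ N)
    (i : Fin m.M) :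
    1 / (D.T / N) * (m.mTilde D.φ i * (S n i - S (n - 1) i)) =
      ∑ j, m.c i j * ext D.ηw (upW (S n) (Pw n) i j) * (Pw n j - Pw n i) +
        m.mass i * (D.fw (D.sInH m (D.T / N) n i) * D.qInH m (D.T / N) n i
          - D.fw (S n i) * D.qOutH m (D.T / N) n i) := by
  have h1 := h.wetting n hn hnN (Pi.single i 1)
  rw [m.form_single, m.ip_single, m.ipφ_single] at h1
  linarith

lemma nonwetting_node (h : D.IsDiscreteSolution m N S Pw Po) {n : ℕ} (hn : 1 ≤ n) (hnN : n ≤ N)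
    (i : Fin m.M) :
    -(1 / (D.T / N) * (m.mTilde D.φ i * (S n i - S (n - 1) i))) =
      ∑ j, m.c i j * ext D.ηo (upO (S n) (Po n) i j) * (Po n j - Po n i) +
        m.mass i * (D.fo (D.sInH m (D.T / N) n i) * D.qInH m (D.T / N) n i
          - D.fo (S n i) * D.qOutH m (D.T / N) n i) := by
  have h1 := h.nonwetting n hn hnN (Pi.single i 1)
  rw [m.form_single, m.ip_single, m.ipφ_single] at h1
  linarith

/-- The maximum principle. -/
theorem saturation_mem (h : D.IsDiscreteSolution m N S Pw Po) (hD : D.BasicAssumptions)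
    (hP : D.PowerLaw) : ∀ n ≤ N, ∀ i, S n i ∈ Icc (0 : ℝ) 1 := by
  intro n
  induction n with
  | zero =>
    intro _ i
    rw [h.init]
    exact rh_s0_mem m hD i
  | succ n ih =>
    intro hn i
    have hprev := ih (Nat.le_of_succ_le hn) i
    have hN : 1 ≤ N := (Nat.le_add_left 1 n).trans hn
    have hτ := timeStep_pos hD hN
    have hm := m.mass_pos i
    have hmT := mTilde_pos m hD i
    have hq := qInH_nonneg m hD (Nat.le_add_left 1 n) hn i
    have hw := h.wetting_node (Nat.le_add_left 1 n) hn i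
    have ho := h.nonwetting_node (Nat.le_add_left 1 n) hn i
    rw [Nat.add_sub_cancel] at hw ho
    constructor
    -- At a negative saturation the extended η_w and f_w vanish. An outflow would be upwinded at
    -- this node, hence has zero mobility; only inflow and injection remain, so S cannot have
    -- dropped below its previous nonnegative value.
    · by_contra hneg
      push Not at hneg
      have h1 : 0 ≤ ∑ j, m.c i j * ext D.ηw (upW (S (n + 1)) (Pw (n + 1)) i j) *
          (Pw (n + 1) j - Pw (n + 1) i) := by
        refine Finset.sum_nonneg fun j _ => ?_
        rcases lt_trichotomy (Pw (n + 1) i) (Pw (n + 1) j) with hlt | heq | hgt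
        · exact mul_nonneg (mul_nonneg (m.c_nonneg i j) (hD.ext_ηw_nonneg _)) (sub_pos.2 hlt).le
        · rw [heq, sub_self, mul_zero]
        · rw [upW, if_pos hgt, ext_of_nonpos hneg.le, hP.ηw_zero, mul_zero, zero_mul]
      rw [fw_of_nonpos hP hneg.le, zero_mul, sub_zero] at hw
      have h2 : 0 ≤ m.mass i * (D.fw (D.sInH m (D.T / N) (n + 1) i) *
          D.qInH m (D.T / N) (n + 1) i) :=
        mul_nonneg hm.le (mul_nonneg (hD.fw_mem _).1 hq)
      have h3 : 1 / (D.T / N) * (m.mTilde D.φ i * (S (n + 1) i - S n i)) < 0 :=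
        mul_neg_of_pos_of_neg (by positivity) (mul_neg_of_pos_of_neg hmT (by linarith [hprev.1]))
      linarith
    -- The same argument for the other phase, whose extended mobility and fractional flow vanish
    -- above 1.
    · by_contra hgt1
      push Not at hgt1
      have h1 : 0 ≤ ∑ j, m.c i j * ext D.ηo (upO (S (n + 1)) (Po (n + 1)) i j) *
          (Po (n + 1) j - Po (n + 1) i) := by
        refine Finset.sum_nonneg fun j _ => ?_
        rcases lt_trichotomy (Po (n + 1) i) (Po (n + 1) j) with hlt | heq | hgt
        · exact mul_nonneg (mul_nonneg (m.c_nonneg i j) (hD.ext_ηo_nonneg _)) (sub_pos.2 hlt).le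
        · rw [heq, sub_self, mul_zero]
        · rw [upO, if_pos hgt, ext_of_one_le hgt1.le, hP.ηo_one, mul_zero, zero_mul]
      rw [fo_of_one_le hD hP hgt1.le, zero_mul, sub_zero] at ho
      have h2 : 0 ≤ m.mass i * (D.fo (D.sInH m (D.T / N) (n + 1) i) *
          D.qInH m (D.T / N) (n + 1) i) :=
        mul_nonneg hm.le (mul_nonneg (hD.fo_mem _).1 hq)
      have h3 : 0 < 1 / (D.T / N) * (m.mTilde D.φ i * (S (n + 1) i - S n i)) :=
        mul_pos (by positivity) (mul_pos hmT (by linarith [hprev.2]))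
      linarith

end IsDiscreteSolution

/-- The dissipation at a time step. -/
noncomputable def diss (D : Data d) (m : Mesh D.Ω) (S Pw Po : Fin m.M → ℝ) : ℝ :=
  ∑ i, ∑ j, m.c i j * D.edgeDiss S Pw Po i j

/-- The squared norm of the flow rates at a time step. -/
noncomputable def rate (D : Data d) (m : Mesh D.Ω) (τ : ℝ) (n : ℕ) : ℝ :=
  ∑ i, m.mass i * (D.qInH m τ n i ^ 2 + D.qOutH m τ n i ^ 2)

lemma edgeDiss_nonneg (hD : D.BasicAssumptions) {M : ℕ} (S Pw Po : Fin M → ℝ) (i j : Fin M) :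
    0 ≤ D.edgeDiss S Pw Po i j :=
  add_nonneg (mul_nonneg (hD.ext_ηw_nonneg _) (sq_nonneg _))
    (mul_nonneg (hD.ext_ηo_nonneg _) (sq_nonneg _))

lemma diss_nonneg (hD : D.BasicAssumptions) (m : Mesh D.Ω) (S Pw Po : Fin m.M → ℝ) :
    0 ≤ D.diss m S Pw Po :=
  Finset.sum_nonneg fun i _ => Finset.sum_nonneg fun j _ =>
    mul_nonneg (m.c_nonneg i j) (edgeDiss_nonneg hD _ _ _ i j)

lemma rate_nonneg (D : Data d) (m : Mesh D.Ω) (τ : ℝ) (n : ℕ) : 0 ≤ D.rate m τ n :=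
  Finset.sum_nonneg fun i _ => mul_nonneg (m.mass_pos i).le (by positivity)

lemma exists_η_bound (hD : D.BasicAssumptions) :
    ∃ B : ℝ, 0 < B ∧ ∀ s ∈ Icc (0 : ℝ) 1, D.ηw s ≤ B ∧ D.ηo s ≤ B := by
  have h0 : (0 : ℝ) ∈ Icc (0 : ℝ) 1 := left_mem_Icc.2 zero_le_one
  have h1 : (1 : ℝ) ∈ Icc (0 : ℝ) 1 := right_mem_Icc.2 zero_le_one
  refine ⟨D.ηw 1 + D.ηo 0 + 1, ?_, fun s hs => ⟨?_, ?_⟩⟩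
  · linarith [hD.ηw_nonneg 1 h1, hD.ηo_nonneg 0 h0]
  · linarith [hD.ηw_mono hs h1 hs.2, hD.ηo_nonneg 0 h0]
  · linarith [hD.ηo_anti h0 hs hs.1, hD.ηw_nonneg 1 h1]

lemma exists_pc_bound (hD : D.BasicAssumptions) :
    ∃ B : ℝ, 0 ≤ B ∧ ∀ s ∈ Icc (0 : ℝ) 1, |D.pc s| ≤ B := by
  obtain ⟨B, hB⟩ := isCompact_Icc.exists_bound_of_continuousOn hD.pc_cont
  exact ⟨max B 0, le_max_right _ _, fun s hs => (hB s hs).trans (le_max_left _ _)⟩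

lemma abs_capPrim_frac_le (hD : D.BasicAssumptions) (hP : D.PowerLaw) {B : ℝ}
    (hB : ∀ s ∈ Icc (0 : ℝ) 1, |D.pc s| ≤ B) {s : ℝ} (hs : s ∈ Icc (0 : ℝ) 1) :
    |D.capPrim D.frac s| ≤ 2 * B := by
  have h0 : (0 : ℝ) ∈ Icc (0 : ℝ) 1 := left_mem_Icc.2 zero_le_one
  have hI : ∀ x ∈ Icc 0 s, x ∈ Icc (0 : ℝ) 1 := fun x hx => ⟨hx.1, hx.2.trans hs.2⟩
  have h1 := mul_le_capPrim_sub hD hP hD.frac_cont h0 hs hs.1 (c := 0)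
    fun x hx => (hD.frac_mem (hI x hx)).1
  have h2 := capPrim_sub_le_mul hD hP hD.frac_cont h0 hs hs.1 (c := 1)
    fun x hx => (hD.frac_mem (hI x hx)).2
  have h3 : D.capPrim D.frac 0 = 0 := by simp [capPrim]
  rw [h3] at h1 h2
  have h4 := abs_le.1 (hB 0 h0)
  have h5 := abs_le.1 (hB s hs)
  rw [abs_le]
  constructor <;> linarith

/-- The primitive of the capillary pressure. -/
noncomputable def pcPrim (D : Data d) (x : ℝ) : ℝ := ∫ s in (0 : ℝ)..x, D.pc s

lemma intervalIntegrable_pc (hD : D.BasicAssumptions) {a b : ℝ} (ha : a ∈ Icc (0 : ℝ) 1)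
    (hb : b ∈ Icc (0 : ℝ) 1) : IntervalIntegrable D.pc volume a b :=
  (hD.pc_cont.mono (ordConnected_Icc.uIcc_subset ha hb)).intervalIntegrable

/-- The primitive of the decreasing p_c is concave and lies below its tangents. This is what makes
the implicit accumulation term telescope. -/
lemma sub_mul_pc_le (hD : D.BasicAssumptions) {a b : ℝ} (ha : a ∈ Icc (0 : ℝ) 1)
    (hb : b ∈ Icc (0 : ℝ) 1) : (a - b) * D.pc a ≤ D.pcPrim a - D.pcPrim b := by
  have h0 : (0 : ℝ) ∈ Icc (0 : ℝ) 1 := left_mem_Icc.2 zero_le_one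
  rw [pcPrim, pcPrim, intervalIntegral.integral_interval_sub_left (intervalIntegrable_pc hD h0 ha)
    (intervalIntegrable_pc hD h0 hb)]
  have hanti := hD.pc_strictAnti.antitoneOn
  rcases le_total b a with hba | hab
  · rw [← smul_eq_mul, ← intervalIntegral.integral_const]
    refine intervalIntegral.integral_mono_on hba intervalIntegrable_const
      (intervalIntegrable_pc hD hb ha) fun x hx => ?_
    exact hanti ⟨hb.1.trans hx.1, hx.2.trans ha.2⟩ ha hx.2
  · rw [intervalIntegral.integral_symm, ← neg_sub b a, neg_mul, neg_le_neg_iff, ← smul_eq_mul,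
      ← intervalIntegral.integral_const]
    refine intervalIntegral.integral_mono_on hab (intervalIntegrable_pc hD ha hb)
      intervalIntegrable_const fun x hx => ?_
    exact hanti ha ⟨ha.1.trans hx.1, hx.2.trans hb.2⟩ hx.1

lemma abs_pcPrim_le {B : ℝ} (hB : ∀ s ∈ Icc (0 : ℝ) 1, |D.pc s| ≤ B) {s : ℝ}
    (hs : s ∈ Icc (0 : ℝ) 1) : |D.pcPrim s| ≤ B := by
  have h1 : ‖∫ x in (0 : ℝ)..s, D.pc x‖ ≤ B * |s - 0| := by
    refine intervalIntegral.norm_integral_le_of_norm_le_const fun x hx => ?_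
    rw [uIoc_of_le hs.1] at hx
    exact hB x ⟨hx.1.le, hx.2.trans hs.2⟩
  have hB0 : 0 ≤ B := (abs_nonneg _).trans (hB s hs)
  rw [sub_zero, abs_of_nonneg hs.1] at h1
  exact h1.trans (mul_le_of_le_one_right hB0 hs.2)

namespace IsDiscreteSolution

variable {m : Mesh D.Ω} {N : ℕ} {S Pw Po : ℕ → Fin m.M → ℝ}

lemma capillary_eq (h : D.IsDiscreteSolution m N S Pw Po) (hD : D.BasicAssumptions)
    (hP : D.PowerLaw) {n : ℕ} (hn : 1 ≤ n) (hnN : n ≤ N) (i : Fin m.M) :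
    Po n i - Pw n i = D.pc (S n i) := by
  rw [h.capillary n hn hnN i, ext_of_mem (h.saturation_mem hD hP n hnN i)]

/-- Adding the two equations tested with 1 cancels the accumulation, and f_w + f_o = 1. The balance
of the discrete rates, read off from the scheme, allows any constant to be subtracted from the
global pressure. -/
lemma sum_rates (h : D.IsDiscreteSolution m N S Pw Po) {n : ℕ} (hn : 1 ≤ n) (hnN : n ≤ N) :
    ∑ i, m.mass i * (D.qInH m (D.T / N) n i - D.qOutH m (D.T / N) n i) = 0 := by
  have h1 := h.wetting n hn hnN fun _ => 1
  have h2 := h.nonwetting n hn hnN fun _ => 1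
  rw [m.form_const fun i j => by rw [upW_comm]] at h1
  rw [m.form_const fun i j => by rw [upO_comm]] at h2
  have h3 : ∑ i, m.mass i * (D.qInH m (D.T / N) n i - D.qOutH m (D.T / N) n i) =
      m.ip (fun i => D.fw (D.sInH m (D.T / N) n i) * D.qInH m (D.T / N) n i
          - D.fw (S n i) * D.qOutH m (D.T / N) n i) (fun _ => 1) +
      m.ip (fun i => D.fo (D.sInH m (D.T / N) n i) * D.qInH m (D.T / N) n i
          - D.fo (S n i) * D.qOutH m (D.T / N) n i) (fun _ => 1) := by
    rw [Mesh.ip, Mesh.ip, ← Finset.sum_add_distrib]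
    refine Finset.sum_congr rfl fun i _ => ?_
    rw [fo, fo]; ring
  rw [h3, ← h1, ← h2]
  ring

/-- The energy identity. -/
lemma energy_eq (h : D.IsDiscreteSolution m N S Pw Po) (hD : D.BasicAssumptions)
    (hP : D.PowerLaw) {n : ℕ} (hn : 1 ≤ n) (hnN : n ≤ N) (c : ℝ) :
    1 / 2 * D.diss m (S n) (Pw n) (Po n) =
      1 / (D.T / N) * ∑ i, m.mTilde D.φ i * ((S n i - S (n - 1) i) * D.pc (S n i)) +
      ∑ i, m.mass i * ((D.qInH m (D.T / N) n i - D.qOutH m (D.T / N) n i) *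
          (Pw n i + D.capPrim D.frac (S n i) - c) -
        (D.qInH m (D.T / N) n i - D.qOutH m (D.T / N) n i) * D.capPrim D.frac (S n i) +
        (D.fo (D.sInH m (D.T / N) n i) * D.qInH m (D.T / N) n i
          - D.fo (S n i) * D.qOutH m (D.T / N) n i) * D.pc (S n i)) := by
  have h1 := h.wetting n hn hnN (Pw n)
  have h2 := h.nonwetting n hn hnN (Po n)
  rw [m.form_eq fun i j => by rw [upW_comm]] at h1
  rw [m.form_eq fun i j => by rw [upO_comm]] at h2
  have hcap := h.capillary_eq hD hP hn hnN
  have h3 : D.diss m (S n) (Pw n) (Po n) =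
      ∑ i, ∑ j, m.c i j * (ext D.ηw (upW (S n) (Pw n) i j) *
        ((Pw n j - Pw n i) * (Pw n j - Pw n i))) +
      ∑ i, ∑ j, m.c i j * (ext D.ηo (upO (S n) (Po n) i j) *
        ((Po n j - Po n i) * (Po n j - Po n i))) := by
    simp only [diss, ← Finset.sum_add_distrib]
    refine Finset.sum_congr rfl fun i _ => Finset.sum_congr rfl fun j _ => ?_
    rw [edgeDiss]; ring
  have h4 : ∑ i, m.mTilde D.φ i * ((S n i - S (n - 1) i) * D.pc (S n i)) =
      m.ipφ D.φ (fun i => S n i - S (n - 1) i) (Po n) -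
        m.ipφ D.φ (fun i => S n i - S (n - 1) i) (Pw n) := by
    rw [Mesh.ipφ, Mesh.ipφ, ← Finset.sum_sub_distrib]
    refine Finset.sum_congr rfl fun i _ => ?_
    rw [← hcap]; ring
  -- As P_o = P_w + p_c and f_w + f_o = 1, the sources act on P_w through the net rate and on p_c
  -- through the f_o-weighted rates. Then P_w is the global pressure minus a bounded function of S.
  have h5 : ∑ i, m.mass i * ((D.qInH m (D.T / N) n i - D.qOutH m (D.T / N) n i) *
          (Pw n i + D.capPrim D.frac (S n i) - c) -
        (D.qInH m (D.T / N) n i - D.qOutH m (D.T / N) n i) * D.capPrim D.frac (S n i) +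
        (D.fo (D.sInH m (D.T / N) n i) * D.qInH m (D.T / N) n i
          - D.fo (S n i) * D.qOutH m (D.T / N) n i) * D.pc (S n i)) =
      m.ip (fun i => D.fw (D.sInH m (D.T / N) n i) * D.qInH m (D.T / N) n i
          - D.fw (S n i) * D.qOutH m (D.T / N) n i) (Pw n) +
      m.ip (fun i => D.fo (D.sInH m (D.T / N) n i) * D.qInH m (D.T / N) n i
          - D.fo (S n i) * D.qOutH m (D.T / N) n i) (Po n) -
      c * ∑ i, m.mass i * (D.qInH m (D.T / N) n i - D.qOutH m (D.T / N) n i) := by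
    rw [Mesh.ip, Mesh.ip, Finset.mul_sum, ← Finset.sum_add_distrib, ← Finset.sum_sub_distrib]
    refine Finset.sum_congr rfl fun i _ => ?_
    rw [← hcap, fo, fo]; ring
  rw [h.sum_rates hn hnN, mul_zero, sub_zero] at h5
  rw [h3, h4, h5, ← h1, ← h2]
  ring

lemma dirichlet_le [NeZero d] (h : D.IsDiscreteSolution m N S Pw Po) (hD : D.BasicAssumptions)
    (hP : D.PowerLaw) (hm : m.Nonobtuse) {η : ℝ} (hη : 0 < η)
    (hηs : ∀ s ∈ Icc (0 : ℝ) 1, η ≤ D.ηw s + D.ηo s) {n : ℕ} (hn : 1 ≤ n) (hnN : n ≤ N) :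
    2 * η * m.dirichlet (fun i => Pw n i + D.capPrim D.frac (S n i)) ≤
      D.diss m (S n) (Pw n) (Po n) := by
  rw [mul_comm 2 η, mul_assoc, ← hm.sum_c_mul_sq, diss, Finset.mul_sum]
  refine Finset.sum_le_sum fun i _ => ?_
  rw [Finset.mul_sum]
  refine Finset.sum_le_sum fun j _ => ?_
  rw [mul_left_comm]
  exact mul_le_mul_of_nonneg_left (edge_global_pressure hD hP hη hηs
    (h.saturation_mem hD hP n hnN) (h.capillary_eq hD hP hn hnN) i j) (m.c_nonneg i j)

lemma dirichlet_g_le [NeZero d] (h : D.IsDiscreteSolution m N S Pw Po) (hD : D.BasicAssumptions)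
    (hP : D.PowerLaw) (hm : m.Nonobtuse) {η B : ℝ} (hη : 0 < η)
    (hηs : ∀ s ∈ Icc (0 : ℝ) 1, η ≤ D.ηw s + D.ηo s)
    (hB : ∀ s ∈ Icc (0 : ℝ) 1, D.ηw s ≤ B ∧ D.ηo s ≤ B) {n : ℕ} (hn : 1 ≤ n) (hnN : n ≤ N) :
    2 * m.dirichlet (fun i => D.g (S n i)) ≤
      (B + 2 * B ^ 3 / η ^ 2) * D.diss m (S n) (Pw n) (Po n) := by
  rw [← hm.sum_c_mul_sq, diss, Finset.mul_sum]
  refine Finset.sum_le_sum fun i _ => ?_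
  rw [Finset.mul_sum]
  refine Finset.sum_le_sum fun j _ => ?_
  rw [mul_left_comm]
  exact mul_le_mul_of_nonneg_left (edge_g hD hP hη hηs hB
    (h.saturation_mem hD hP n hnN) (h.capillary_eq hD hP hn hnN) i j) (m.c_nonneg i j)

end IsDiscreteSolution

/-- The total of dissipation, flow rates and volume at a time step. -/
noncomputable def budget (D : Data d) (m : Mesh D.Ω) (N : ℕ) (S Pw Po : ℕ → Fin m.M → ℝ) (n : ℕ) :
    ℝ :=
  D.diss m (S n) (Pw n) (Po n) + (volume.real (closure D.Ω) + D.rate m (D.T / N) n)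

/-- Young's inequality, with parameter lam, is spent only on the pressure term u; the factors p and
q are bounded functions of the saturation. -/
lemma source_bound {a b x y u p q A lam : ℝ} (hx : 0 ≤ x) (hy : 0 ≤ y) (ha : a ∈ Icc (0 : ℝ) 1)
    (hb : b ∈ Icc (0 : ℝ) 1) (hlam : 0 < lam) (hq : |q| ≤ 2 * A) (hp : |p| ≤ A) :
    (x - y) * u - (x - y) * q + (a * x - b * y) * p ≤
      (3 * A + lam) * (1 + (x ^ 2 + y ^ 2)) + 1 / (4 * lam) * u ^ 2 := by
  have hA : 0 ≤ A := (abs_nonneg p).trans hp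
  have h1 : (x - y) * u ≤ lam * (x - y) ^ 2 + 1 / (4 * lam) * u ^ 2 := by
    have h2 : lam * (x - y) ^ 2 + 1 / (4 * lam) * u ^ 2 - (x - y) * u =
        1 / (4 * lam) * (2 * lam * (x - y) - u) ^ 2 := by field_simp; ring
    have h3 : 0 ≤ 1 / (4 * lam) * (2 * lam * (x - y) - u) ^ 2 := by positivity
    linarith
  have h2 : (x - y) ^ 2 ≤ 1 + (x ^ 2 + y ^ 2) := by nlinarith [mul_nonneg hx hy]
  have hxy : |x - y| ≤ x + y := by rw [abs_le]; constructor <;> linarith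
  have h3 : -((x - y) * q) ≤ (x + y) * (2 * A) := by
    refine (neg_le_abs _).trans ?_
    rw [abs_mul]
    exact mul_le_mul hxy hq (abs_nonneg _) (by linarith)
  have hab : |a * x - b * y| ≤ x + y := by
    rw [abs_le]
    have := mul_nonneg ha.1 hx
    have := mul_nonneg hb.1 hy
    have := mul_le_of_le_one_left hx ha.2
    have := mul_le_of_le_one_left hy hb.2
    constructor <;> linarith
  have h4 : (a * x - b * y) * p ≤ (x + y) * A := by
    refine (le_abs_self _).trans ?_
    rw [abs_mul]
    exact mul_le_mul hab hp (abs_nonneg _) (by linarith)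
  have h5 : x + y ≤ 1 + (x ^ 2 + y ^ 2) := by nlinarith [sq_nonneg (x - 1 / 2), sq_nonneg (y - 1 / 2)]
  nlinarith [mul_le_mul_of_nonneg_left h2 hlam.le, mul_le_mul_of_nonneg_left h5 hA]

/-- The energy estimate. -/
theorem exists_energy_bound [NeZero d] (hD : D.BasicAssumptions) (hP : D.PowerLaw) :
    ∃ C : ℝ, 0 ≤ C ∧ ∀ m : Mesh D.Ω, m.Nonobtuse → ∀ N : ℕ, 1 ≤ N →
      ∀ S Pw Po : ℕ → Fin m.M → ℝ, D.IsDiscreteSolution m N S Pw Po →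
        ∑ k ∈ Finset.range N, D.T / N * D.budget m N S Pw Po (k + 1) ≤ C := by
  obtain ⟨η, hη, hηs⟩ := hD.η_lower
  obtain ⟨A, hA0, hA⟩ := exists_pc_bound hD
  obtain ⟨CP, hCP0, hCP⟩ := Mesh.exists_discrete_poincare hD.isOpen hD.isConnected hD.isBounded
    hD.lipschitz
  obtain ⟨a, b, ha, hb, hab⟩ := exists_mTilde_bounds hD
  -- This gives CP ≤ 2 η lam, so that the Poincaré inequality and the edge estimate bound the
  -- pressure term by a quarter of the dissipation. The summand 1 keeps lam positive when CP = 0.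
  set lam : ℝ := CP / (2 * η) + 1 with hlam
  have hlam0 : 0 < lam := by positivity
  set ω := volume.real (closure D.Ω)
  have hω : 0 ≤ ω := measureReal_nonneg
  have hωm : ∀ m : Mesh D.Ω, ω = ∑ i, m.mass i := fun m => m.sum_mass.symm
  set Q : ℝ := ∫ p, D.qIn p.1 p.2 ^ 2 ∂D.cylMeasure + ∫ p, D.qOut p.1 p.2 ^ 2 ∂D.cylMeasure
    with hQ
  have hQ0 : 0 ≤ Q := add_nonneg (integral_nonneg fun _ => sq_nonneg _)
    (integral_nonneg fun _ => sq_nonneg _)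
  have hT := hD.T_pos
  -- A quarter of the dissipation is left after absorption, whence the factors 4. The telescoped sum
  -- has two end values, each at most A b |Ω|, and the final + 1 pays for the volume and the rates
  -- included in the budget.
  refine ⟨4 * (2 * A * (b * ω)) + (4 * (3 * A + lam) + 1) * (D.T * ω + Q), by positivity,
    fun m hm N hN S Pw Po h => ?_⟩
  have hτ := timeStep_pos hD hN
  set τ := D.T / N with hτdef
  have hS := h.saturation_mem hD hP
  have hstep : ∀ k ∈ Finset.range N, τ * D.diss m (S (k + 1)) (Pw (k + 1)) (Po (k + 1)) ≤
      4 * (∑ i, m.mTilde D.φ i * D.pcPrim (S (k + 1) i) - ∑ i, m.mTilde D.φ i * D.pcPrim (S k i)) +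
      4 * (3 * A + lam) * (τ * (ω + D.rate m τ (k + 1))) := by
    intro k hk
    have hn : 1 ≤ k + 1 := Nat.le_add_left 1 k
    have hkN : k + 1 ≤ N := Finset.mem_range.1 hk
    have hkN' : k ≤ N := Nat.le_of_succ_le hkN
    obtain ⟨c, hc⟩ := hCP m fun i => Pw (k + 1) i + D.capPrim D.frac (S (k + 1) i)
    have hen := h.energy_eq hD hP hn hkN c
    rw [Nat.add_sub_cancel, ← hτdef] at hen
    have hdir := h.dirichlet_le hD hP hm hη hηs hn hkN
    set X := D.diss m (S (k + 1)) (Pw (k + 1)) (Po (k + 1))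
    have hX : 0 ≤ X := diss_nonneg hD _ _ _ _
    have h1 : ∑ i, m.mTilde D.φ i * ((S (k + 1) i - S k i) * D.pc (S (k + 1) i)) ≤
        ∑ i, m.mTilde D.φ i * D.pcPrim (S (k + 1) i) - ∑ i, m.mTilde D.φ i * D.pcPrim (S k i) := by
      rw [← Finset.sum_sub_distrib]
      refine Finset.sum_le_sum fun i _ => ?_
      rw [← mul_sub]
      exact mul_le_mul_of_nonneg_left (sub_mul_pc_le hD (hS _ hkN i) (hS _ hkN' i))
        (IsDiscreteSolution.mTilde_pos m hD i).le
    have h2 : ∑ i, m.mass i * ((D.qInH m τ (k + 1) i - D.qOutH m τ (k + 1) i) *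
          (Pw (k + 1) i + D.capPrim D.frac (S (k + 1) i) - c) -
        (D.qInH m τ (k + 1) i - D.qOutH m τ (k + 1) i) * D.capPrim D.frac (S (k + 1) i) +
        (D.fo (D.sInH m τ (k + 1) i) * D.qInH m τ (k + 1) i
          - D.fo (S (k + 1) i) * D.qOutH m τ (k + 1) i) * D.pc (S (k + 1) i)) ≤
        (3 * A + lam) * (ω + D.rate m τ (k + 1)) + 1 / (4 * lam) * ∑ i, m.mass i *
          (Pw (k + 1) i + D.capPrim D.frac (S (k + 1) i) - c) ^ 2 := by
      have h3 : (3 * A + lam) * (ω + D.rate m τ (k + 1)) + 1 / (4 * lam) * ∑ i, m.mass i *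
          (Pw (k + 1) i + D.capPrim D.frac (S (k + 1) i) - c) ^ 2 =
          ∑ i, m.mass i * ((3 * A + lam) *
            (1 + (D.qInH m τ (k + 1) i ^ 2 + D.qOutH m τ (k + 1) i ^ 2)) +
            1 / (4 * lam) * (Pw (k + 1) i + D.capPrim D.frac (S (k + 1) i) - c) ^ 2) := by
        rw [hωm m, rate, ← Finset.sum_add_distrib, Finset.mul_sum, Finset.mul_sum,
          ← Finset.sum_add_distrib]
        exact Finset.sum_congr rfl fun i _ => by ring
      rw [h3]
      refine Finset.sum_le_sum fun i _ => mul_le_mul_of_nonneg_left ?_ (m.mass_pos i).le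
      exact source_bound (IsDiscreteSolution.qInH_nonneg m hD hn hkN i)
        (IsDiscreteSolution.qOutH_nonneg m hD hn hkN i) (hD.fo_mem _) (hD.fo_mem _) hlam0
        (abs_capPrim_frac_le hD hP hA (hS _ hkN i)) (hA _ (hS _ hkN i))
    have h3 : 1 / (4 * lam) * ∑ i, m.mass i *
          (Pw (k + 1) i + D.capPrim D.frac (S (k + 1) i) - c) ^ 2 ≤ 1 / 4 * X := by
      have h4 : CP ≤ 2 * η * lam := by
        rw [hlam, mul_add, mul_div_cancel₀ _ (by positivity)]
        linarith
      set Y := m.dirichlet fun i => Pw (k + 1) i + D.capPrim D.frac (S (k + 1) i)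
      have hY : 0 ≤ Y := m.dirichlet_nonneg _
      calc _ ≤ 1 / (4 * lam) * (CP * Y) := by gcongr
        _ ≤ 1 / (4 * lam) * (2 * η * lam * Y) := by gcongr
        _ = 1 / 4 * (2 * η * Y) := by field_simp
        _ ≤ 1 / 4 * X := by gcongr
    have h5 : 1 / τ * ∑ i, m.mTilde D.φ i * ((S (k + 1) i - S k i) * D.pc (S (k + 1) i)) ≤
        1 / τ * (∑ i, m.mTilde D.φ i * D.pcPrim (S (k + 1) i) -
          ∑ i, m.mTilde D.φ i * D.pcPrim (S k i)) :=
      mul_le_mul_of_nonneg_left h1 (by positivity)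
    set Z := ∑ i, m.mTilde D.φ i * D.pcPrim (S (k + 1) i) - ∑ i, m.mTilde D.φ i * D.pcPrim (S k i)
    have h6 : 1 / 4 * X ≤ 1 / τ * Z + (3 * A + lam) * (ω + D.rate m τ (k + 1)) := by linarith
    calc τ * X = 4 * τ * (1 / 4 * X) := by ring
      _ ≤ 4 * τ * (1 / τ * Z + (3 * A + lam) * (ω + D.rate m τ (k + 1))) := by gcongr
      _ = _ := by field_simp
  have hrate : ∑ k ∈ Finset.range N, τ * (ω + D.rate m τ (k + 1)) ≤ D.T * ω + Q := by
    have h1 := sum_flow_sq_le m hD hD.qIn_memLp hN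
    have h2 := sum_flow_sq_le m hD hD.qOut_memLp hN
    have h3 : ∑ k ∈ Finset.range N, τ * (ω + D.rate m τ (k + 1)) = D.T * ω +
        (∑ k ∈ Finset.range N, τ * ∑ i, m.mass i * flow m τ D.qIn (k + 1) i ^ 2 +
        ∑ k ∈ Finset.range N, τ * ∑ i, m.mass i * flow m τ D.qOut (k + 1) i ^ 2) := by
      have hN0 : (0 : ℝ) < N := Nat.cast_pos.2 hN
      simp only [mul_add, Finset.sum_add_distrib, Finset.sum_const, Finset.card_range,
        nsmul_eq_mul, rate]
      congr 1
      rw [hτdef]; field_simp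
    rw [h3, hQ]
    linarith
  have hΨ : ∀ n ≤ N, |∑ i, m.mTilde D.φ i * D.pcPrim (S n i)| ≤ A * (b * ω) := by
    intro n hn
    refine (Finset.abs_sum_le_sum_abs _ _).trans ?_
    rw [show A * (b * ω) = ∑ i, (b * m.mass i) * A by
      rw [← Finset.sum_mul, ← Finset.mul_sum, hωm m]; ring]
    refine Finset.sum_le_sum fun i _ => ?_
    rw [abs_mul, abs_of_pos (IsDiscreteSolution.mTilde_pos m hD i)]
    exact mul_le_mul (hab m i).2 (abs_pcPrim_le hA (hS n hn i)) (abs_nonneg _)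
      (mul_nonneg hb.le (m.mass_pos i).le)
  have htel := Finset.sum_range_sub (fun n => ∑ i, m.mTilde D.φ i * D.pcPrim (S n i)) N
  have h1 := (abs_le.1 (hΨ N le_rfl)).2
  have h2 := (abs_le.1 (hΨ 0 (Nat.zero_le N))).1
  have hsum := Finset.sum_le_sum hstep
  rw [Finset.sum_add_distrib (g := fun k => 4 * (3 * A + lam) * (τ * (ω + D.rate m τ (k + 1)))),
    ← Finset.mul_sum (a := 4), htel,
    ← Finset.mul_sum (a := 4 * (3 * A + lam))] at hsum
  have hK : 0 ≤ 4 * (3 * A + lam) := by positivity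
  have h3 := mul_le_mul_of_nonneg_left hrate hK
  have h4 : ∑ k ∈ Finset.range N, τ * D.budget m N S Pw Po (k + 1) =
      ∑ k ∈ Finset.range N, τ * D.diss m (S (k + 1)) (Pw (k + 1)) (Po (k + 1)) +
        ∑ k ∈ Finset.range N, τ * (ω + D.rate m τ (k + 1)) := by
    rw [← Finset.sum_add_distrib]
    exact Finset.sum_congr rfl fun k _ => mul_add _ _ _
  rw [h4]
  linarith

end Data

end TwoPhase

/-! ### Pointwise and L² bounds on an element -/

namespace TwoPhase

namespace Mesh

variable {d : ℕ} {Ω : Set (E d)} (m : Mesh Ω)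

lemma exists_le_fn_le {K : Fin m.nElt} {x : E d} (hx : x ∈ m.elt K) (U : Fin m.M → ℝ) :
    ∃ a b, U (m.vert K a) ≤ m.fn U x ∧ m.fn U x ≤ U (m.vert K b) := by
  have hpos := m.mem_elt_iff.1 hx
  have hsum := m.sum_coord K x
  obtain ⟨a, -, ha⟩ := Finset.exists_min_image Finset.univ (fun a => U (m.vert K a))
    Finset.univ_nonempty
  obtain ⟨b, -, hb⟩ := Finset.exists_max_image Finset.univ (fun a => U (m.vert K a))
    Finset.univ_nonempty
  refine ⟨a, b, ?_, ?_⟩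
  · rw [m.fn_eq_lin hx, lin_apply, ← mul_one (U (m.vert K a)), ← hsum, Finset.mul_sum]
    exact Finset.sum_le_sum fun c hc => mul_le_mul_of_nonneg_right (ha c hc) (hpos c)
  · rw [m.fn_eq_lin hx, lin_apply, ← mul_one (U (m.vert K b)), ← hsum, Finset.mul_sum]
    exact Finset.sum_le_sum fun c hc => mul_le_mul_of_nonneg_right (hb c hc) (hpos c)

lemma fn_sq_le {K : Fin m.nElt} {x : E d} (hx : x ∈ m.elt K) (U : Fin m.M → ℝ) :
    m.fn U x ^ 2 ≤ ∑ a, U (m.vert K a) ^ 2 := by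
  obtain ⟨a, b, ha, hb⟩ := m.exists_le_fn_le hx U
  have h : ∀ c, U (m.vert K c) ^ 2 ≤ ∑ a, U (m.vert K a) ^ 2 := fun c =>
    Finset.single_le_sum (f := fun a => U (m.vert K a) ^ 2) (fun _ _ => sq_nonneg _)
      (Finset.mem_univ c)
  rcases le_total 0 (m.fn U x) with h0 | h0
  · exact (pow_le_pow_left₀ h0 hb 2).trans (h b)
  · refine le_trans ?_ (h a)
    rw [← neg_sq, ← neg_sq (U _)]
    exact pow_le_pow_left₀ (neg_nonneg.2 h0) (neg_le_neg ha) 2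

lemma fn_mem_Icc {K : Fin m.nElt} {x : E d} (hx : x ∈ m.elt K) {U : Fin m.M → ℝ}
    (hU : ∀ i, U i ∈ Icc (0 : ℝ) 1) : m.fn U x ∈ Icc (0 : ℝ) 1 := by
  obtain ⟨a, b, ha, hb⟩ := m.exists_le_fn_le hx U
  exact ⟨(hU _).1.trans ha, hb.trans (hU _).2⟩

lemma fn_sub (U V : Fin m.M → ℝ) (x : E d) :
    m.fn (fun i => U i - V i) x = m.fn U x - m.fn V x := by
  simp only [fn, sub_mul, Finset.sum_sub_distrib]

lemma grad_sub (K : Fin m.nElt) (U V : Fin m.M → ℝ) :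
    m.grad K (fun i => U i - V i) = m.grad K U - m.grad K V := by
  simp only [grad, sub_smul, Finset.sum_sub_distrib]

lemma dirichlet_sub_le (U V : Fin m.M → ℝ) :
    m.dirichlet (fun i => U i - V i) ≤ 2 * m.dirichlet U + 2 * m.dirichlet V := by
  rw [dirichlet, dirichlet, dirichlet, Finset.mul_sum, Finset.mul_sum, ← Finset.sum_add_distrib]
  refine Finset.sum_le_sum fun K _ => ?_
  have h : ‖m.grad K U - m.grad K V‖ ^ 2 ≤ 2 * ‖m.grad K U‖ ^ 2 + 2 * ‖m.grad K V‖ ^ 2 := by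
    have h1 := norm_sub_le (m.grad K U) (m.grad K V)
    have h2 := pow_le_pow_left₀ (norm_nonneg _) h1 2
    nlinarith [sq_nonneg (‖m.grad K U‖ - ‖m.grad K V‖)]
  rw [grad_sub]
  nlinarith [mul_le_mul_of_nonneg_left h (m.vol_nonneg K)]

/-- On an element, a monotone function of a finite element function differs from its nodal values
by at most the oscillation of its interpolate. -/
lemma abs_comp_fn_sub_le {K : Fin m.nElt} {x : E d} (hx : x ∈ m.elt K) {U : Fin m.M → ℝ}
    (hU : ∀ i, U i ∈ Icc (0 : ℝ) 1) {f : ℝ → ℝ} (hf : MonotoneOn f (Icc 0 1)) (a : Fin (d + 1)) :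
    |f (m.fn U x) - f (U (m.vert K a))| ≤ ‖m.grad K fun i => f (U i)‖ * m.diam K := by
  obtain ⟨b, c, hb, hc⟩ := m.exists_le_fn_le hx U
  have hx1 := m.fn_mem_Icc hx hU
  have h1 := hf (hU _) hx1 hb
  have h2 := hf hx1 (hU _) hc
  have h3 := (abs_le.1 (m.abs_sub_le_norm_grad K (fun i => f (U i)) b a)).1
  have h4 := (abs_le.1 (m.abs_sub_le_norm_grad K (fun i => f (U i)) c a)).2
  rw [abs_le]
  constructor <;> linarith

/-- An elementwise pointwise bound gives a bound of the `L²` norm. -/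
lemma eLpNorm_sq_le {f : E d → ℝ} {b : Fin m.nElt → ℝ}
    (h : ∀ K, ∀ x ∈ m.elt K, f x ^ 2 ≤ b K) :
    eLpNorm f 2 (volume.restrict Ω) ^ 2 ≤ ENNReal.ofReal (∑ K, m.vol K * b K) := by
  have h0 : ∀ K, 0 ≤ b K := fun K =>
    (sq_nonneg _).trans (h K _ (m.node_mem_elt K 0))
  have h1 : eLpNorm f 2 (volume.restrict Ω) ^ 2 = ∫⁻ x in Ω, ‖f x‖ₑ ^ 2 := by
    have := eLpNorm_nnreal_pow_eq_lintegral (μ := volume.restrict Ω) (f := f) (p := 2) two_ne_zero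
    simpa using this
  rw [h1, ENNReal.ofReal_sum_of_nonneg fun K _ => mul_nonneg (m.vol_nonneg K) (h0 K)]
  refine (lintegral_mono_set subset_closure).trans ((m.lintegral_closure _).trans ?_)
  refine Finset.sum_le_sum fun K _ => ?_
  rw [mul_comm, ENNReal.ofReal_mul (h0 K), vol, ofReal_measureReal (m.volume_elt_ne_top K),
    ← setLIntegral_const]
  refine setLIntegral_mono' (m.measurableSet_elt K) fun x hx => ?_
  rw [Real.enorm_eq_ofReal_abs, ← ENNReal.ofReal_pow (abs_nonneg _), sq_abs]
  exact ENNReal.ofReal_le_ofReal (h K x hx)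

lemma sum_vol_mul_sum (f : Fin m.M → ℝ) :
    ∑ K, m.vol K * ∑ a, f (m.vert K a) = (d + 1) * ∑ i, m.mass i * f i := by
  rw [sum_mass_mul]
  field_simp

end Mesh

namespace Data

variable {d : ℕ} {D : Data d}

/-! ### Estimates of the increments of the saturation -/

lemma budget_nonneg (hD : D.BasicAssumptions) (m : Mesh D.Ω) (N : ℕ) (S Pw Po : ℕ → Fin m.M → ℝ)
    (n : ℕ) : 0 ≤ D.budget m N S Pw Po n :=
  add_nonneg (diss_nonneg hD _ _ _ _) (add_nonneg measureReal_nonneg (rate_nonneg _ _ _ _))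

/-- The part of the dissipation and of the flow rates which belongs to a node. -/
noncomputable def nodal (D : Data d) (m : Mesh D.Ω) (N : ℕ) (S Pw Po : ℕ → Fin m.M → ℝ) (n : ℕ)
    (i : Fin m.M) : ℝ :=
  ∑ j, m.c i j * D.edgeDiss (S n) (Pw n) (Po n) i j +
    m.mass i * (D.qInH m (D.T / N) n i ^ 2 + D.qOutH m (D.T / N) n i ^ 2)

lemma nodal_nonneg (hD : D.BasicAssumptions) (m : Mesh D.Ω) (N : ℕ) (S Pw Po : ℕ → Fin m.M → ℝ)
    (n : ℕ) (i : Fin m.M) : 0 ≤ D.nodal m N S Pw Po n i :=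
  add_nonneg (Finset.sum_nonneg fun j _ => mul_nonneg (m.c_nonneg i j) (edgeDiss_nonneg hD _ _ _ i j))
    (mul_nonneg (m.mass_pos i).le (by positivity))

lemma sum_nodal_le (m : Mesh D.Ω) (N : ℕ) (S Pw Po : ℕ → Fin m.M → ℝ) (n : ℕ) :
    ∑ i, D.nodal m N S Pw Po n i ≤ D.budget m N S Pw Po n := by
  have h : (0 : ℝ) ≤ volume.real (closure D.Ω) := measureReal_nonneg
  simp only [nodal, Finset.sum_add_distrib]
  rw [budget, diss, rate]
  linarith

namespace IsDiscreteSolution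

variable {m : Mesh D.Ω} {N : ℕ} {S Pw Po : ℕ → Fin m.M → ℝ}

/-- The increment of the saturation over a time step, tested with a bounded function. -/
lemma sum_mTilde_mul_le [NeZero d] (h : D.IsDiscreteSolution m N S Pw Po) (hD : D.BasicAssumptions)
    (hm : m.Nonobtuse) {B L : ℝ} (hB : ∀ s ∈ Icc (0 : ℝ) 1, D.ηw s ≤ B ∧ D.ηo s ≤ B)
    (hL : 0 ≤ L) {θ : Fin m.M → ℝ} (hθ : ∀ i, |θ i| ≤ L) {n : ℕ} (hn : 1 ≤ n) (hnN : n ≤ N) :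
    ∑ i, m.mTilde D.φ i * (θ i * (S n i - S (n - 1) i)) ≤
      D.T / N * ((1 + L) * D.budget m N S Pw Po n + B * m.dirichlet θ) := by
  have hτ := timeStep_pos hD (hn.trans hnN)
  have hw := h.wetting n hn hnN θ
  have h1 : m.form (fun i j => ext D.ηw (upW (S n) (Pw n) i j)) (Pw n) θ ≤
      D.diss m (S n) (Pw n) (Po n) + B * m.dirichlet θ := by
    have h2 : B * m.dirichlet θ = 1 / 2 * ∑ i, ∑ j, m.c i j * (B * (θ j - θ i) ^ 2) := by
      rw [show B * m.dirichlet θ = 1 / 2 * (B * (2 * m.dirichlet θ)) by ring, ← hm.sum_c_mul_sq,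
        Finset.mul_sum]
      congr 1
      refine Finset.sum_congr rfl fun i _ => ?_
      rw [Finset.mul_sum]
      exact Finset.sum_congr rfl fun j _ => by ring
    have h0 := diss_nonneg hD m (S n) (Pw n) (Po n)
    -- Young's inequality on each edge, with the degenerate mobility W as weight: W δP_w² is part of
    -- the dissipation, and W ≤ B in front of δθ².
    have h3 : -∑ i, ∑ j, m.c i j * (ext D.ηw (upW (S n) (Pw n) i j) *
        ((Pw n j - Pw n i) * (θ j - θ i))) ≤
        D.diss m (S n) (Pw n) (Po n) + ∑ i, ∑ j, m.c i j * (B * (θ j - θ i) ^ 2) := by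
      rw [diss, ← Finset.sum_neg_distrib, ← Finset.sum_add_distrib]
      refine Finset.sum_le_sum fun i _ => ?_
      rw [← Finset.sum_neg_distrib, ← Finset.sum_add_distrib]
      refine Finset.sum_le_sum fun j _ => ?_
      rw [← mul_neg, ← mul_add]
      refine mul_le_mul_of_nonneg_left ?_ (m.c_nonneg i j)
      obtain ⟨t, ht, hext⟩ := exists_ext_eq (upW (S n) (Pw n) i j)
      have hW0 := hD.ext_ηw_nonneg (upW (S n) (Pw n) i j)
      have hWB : ext D.ηw (upW (S n) (Pw n) i j) ≤ B := by rw [hext]; exact (hB t ht).1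
      have hO := mul_nonneg (hD.ext_ηo_nonneg (upO (S n) (Po n) i j)) (sq_nonneg (Po n i - Po n j))
      have hO' := mul_nonneg (hD.ext_ηo_nonneg (upO (S n) (Po n) i j)) (sq_nonneg (Po n j - Po n i))
      rw [edgeDiss]
      set W := ext D.ηw (upW (S n) (Pw n) i j)
      nlinarith [mul_nonneg hW0 (sq_nonneg ((Pw n j - Pw n i) + (θ j - θ i))),
        mul_le_mul_of_nonneg_right hWB (sq_nonneg (θ j - θ i)),
        mul_nonneg hW0 (sq_nonneg (θ j - θ i)), mul_nonneg hW0 (sq_nonneg (Pw n j - Pw n i))]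
    rw [m.form_eq fun i j => by rw [upW_comm], h2]
    linarith
  have h2 : m.ip (fun i => D.fw (D.sInH m (D.T / N) n i) * D.qInH m (D.T / N) n i
          - D.fw (S n i) * D.qOutH m (D.T / N) n i) θ ≤
      L * (volume.real (closure D.Ω) + D.rate m (D.T / N) n) := by
    rw [Mesh.ip, ← m.sum_mass, rate, ← Finset.sum_add_distrib, Finset.mul_sum]
    refine Finset.sum_le_sum fun i _ => ?_
    have hx := qInH_nonneg m hD hn hnN i
    have hy := qOutH_nonneg m hD hn hnN i
    have ha := hD.fw_mem (D.sInH m (D.T / N) n i)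
    have hb := hD.fw_mem (S n i)
    set x := D.qInH m (D.T / N) n i
    set y := D.qOutH m (D.T / N) n i
    set a := D.fw (D.sInH m (D.T / N) n i)
    set b := D.fw (S n i)
    have h3 : |a * x - b * y| ≤ 1 + (x ^ 2 + y ^ 2) := by
      have := mul_nonneg ha.1 hx
      have := mul_nonneg hb.1 hy
      have := mul_le_of_le_one_left hx ha.2
      have := mul_le_of_le_one_left hy hb.2
      have := sq_nonneg (x - 1 / 2)
      have := sq_nonneg (y - 1 / 2)
      rw [abs_le]
      constructor <;> nlinarith
    have h4 : (a * x - b * y) * θ i ≤ (1 + (x ^ 2 + y ^ 2)) * L := by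
      refine (le_abs_self _).trans ?_
      rw [abs_mul]
      exact mul_le_mul h3 (hθ i) (abs_nonneg _) (by positivity)
    have h5 := mul_le_mul_of_nonneg_left h4 (m.mass_pos i).le
    linarith
  have h3 : ∑ i, m.mTilde D.φ i * (θ i * (S n i - S (n - 1) i)) =
      D.T / N * (1 / (D.T / N) * m.ipφ D.φ (fun i => S n i - S (n - 1) i) θ) := by
    rw [← mul_assoc, mul_one_div_cancel hτ.ne', one_mul, Mesh.ipφ]
    exact Finset.sum_congr rfl fun i _ => by ring
  rw [h3]
  refine mul_le_mul_of_nonneg_left ?_ hτ.le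
  have h0 := diss_nonneg hD m (S n) (Pw n) (Po n)
  have h0' := rate_nonneg D m (D.T / N) n
  have h0'' : (0 : ℝ) ≤ volume.real (closure D.Ω) := measureReal_nonneg
  rw [budget]
  nlinarith [mul_nonneg hL h0]

/-- The increment of the saturation at a node over a time step. -/
lemma mass_mul_sq_le (h : D.IsDiscreteSolution m N S Pw Po) (hD : D.BasicAssumptions)
    {B a R : ℝ} (hB : ∀ s ∈ Icc (0 : ℝ) 1, D.ηw s ≤ B ∧ D.ηo s ≤ B) (ha : 0 < a)
    (ham : ∀ i, a * m.mass i ≤ m.mTilde D.φ i) (hR : 0 ≤ R) {p : ℕ} (hp : p ≤ N) {i : Fin m.M}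
    (hi : p * (D.T / N) * ∑ j, m.c i j ≤ R * m.mass i) {n : ℕ} (hn : 1 ≤ n) (hnN : n ≤ N) :
    p * (a ^ 2 * (m.mass i * (S n i - S (n - 1) i) ^ 2)) ≤
      2 * (D.T / N) * ((R * B + D.T) * D.nodal m N S Pw Po n i) := by
  have hτ := timeStep_pos hD (hn.trans hnN)
  have hw := h.wetting_node hn hnN i
  have hmass := m.mass_pos i
  have hx := qInH_nonneg m hD hn hnN i
  have hy := qOutH_nonneg m hD hn hnN i
  have hfa := hD.fw_mem (D.sInH m (D.T / N) n i)
  have hfb := hD.fw_mem (S n i)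
  have hT := hD.T_pos
  have hN : (0 : ℝ) < N := Nat.cast_pos.2 (hn.trans hnN)
  have hpT : p * (D.T / N) ≤ D.T := by
    have : (p : ℝ) ≤ N := Nat.cast_le.2 hp
    calc (p : ℝ) * (D.T / N) ≤ N * (D.T / N) := by gcongr
      _ = D.T := by field_simp
  have hnod : D.nodal m N S Pw Po n i = ∑ j, m.c i j * D.edgeDiss (S n) (Pw n) (Po n) i j +
    m.mass i * (D.qInH m (D.T / N) n i ^ 2 + D.qOutH m (D.T / N) n i ^ 2) := rfl
  set τ := D.T / N
  set x := D.qInH m τ n i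
  set y := D.qOutH m τ n i
  set fa := D.fw (D.sInH m τ n i)
  set fb := D.fw (S n i)
  set F := ∑ j, m.c i j * ext D.ηw (upW (S n) (Pw n) i j) * (Pw n j - Pw n i) with hF
  set X := ∑ j, m.c i j * D.edgeDiss (S n) (Pw n) (Po n) i j with hX
  set c := ∑ j, m.c i j with hc
  have hc0 : 0 ≤ c := Finset.sum_nonneg fun j _ => m.c_nonneg i j
  have hX0 : 0 ≤ X :=
    Finset.sum_nonneg fun j _ => mul_nonneg (m.c_nonneg i j) (edgeDiss_nonneg hD _ _ _ i j)
  have hB0 : 0 ≤ B :=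
    (hD.ηw_nonneg 0 (left_mem_Icc.2 zero_le_one)).trans (hB 0 (left_mem_Icc.2 zero_le_one)).1
  -- Cauchy-Schwarz with weights c_ij; one of the two factors W is bounded by B, the other stays in
  -- the dissipation.
  have hFX : F ^ 2 ≤ c * (B * X) := by
    rw [hF, hc, hX, Finset.mul_sum]
    refine Finset.sum_sq_le_sum_mul_sum_of_sq_le_mul _ (fun j _ => m.c_nonneg i j)
      (fun j _ => mul_nonneg hB0 (mul_nonneg (m.c_nonneg i j) (edgeDiss_nonneg hD _ _ _ i j)))
      fun j _ => ?_
    obtain ⟨t, ht, hext⟩ := exists_ext_eq (upW (S n) (Pw n) i j)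
    have hW0 := hD.ext_ηw_nonneg (upW (S n) (Pw n) i j)
    have hWB : ext D.ηw (upW (S n) (Pw n) i j) ≤ B := by rw [hext]; exact (hB t ht).1
    have hO := mul_nonneg (hD.ext_ηo_nonneg (upO (S n) (Po n) i j)) (sq_nonneg (Po n i - Po n j))
    have hO' := mul_nonneg (hD.ext_ηo_nonneg (upO (S n) (Po n) i j)) (sq_nonneg (Po n j - Po n i))
    set W := ext D.ηw (upW (S n) (Pw n) i j) with hWdef
    have h1 : W * (Pw n j - Pw n i) ^ 2 ≤ D.edgeDiss (S n) (Pw n) (Po n) i j := by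
      rw [edgeDiss, ← hWdef]; nlinarith
    have h2 : W * (W * (Pw n j - Pw n i) ^ 2) ≤ B * D.edgeDiss (S n) (Pw n) (Po n) i j :=
      mul_le_mul hWB h1 (mul_nonneg hW0 (sq_nonneg _)) hB0
    calc (m.c i j * W * (Pw n j - Pw n i)) ^ 2
        = m.c i j ^ 2 * (W * (W * (Pw n j - Pw n i) ^ 2)) := by ring
      _ ≤ m.c i j ^ 2 * (B * D.edgeDiss (S n) (Pw n) (Po n) i j) := by gcongr
      _ = _ := by ring
  have hs : (fa * x - fb * y) ^ 2 ≤ x ^ 2 + y ^ 2 := by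
    have h1 := mul_nonneg hfa.1 hx
    have h2 := mul_nonneg hfb.1 hy
    have h3 := pow_le_pow_left₀ h1 (mul_le_of_le_one_left hx hfa.2) 2
    have h4 := pow_le_pow_left₀ h2 (mul_le_of_le_one_left hy hfb.2) 2
    nlinarith [mul_nonneg h1 h2]
  have hJ : (m.mTilde D.φ i * (S n i - S (n - 1) i)) ^ 2 =
      τ ^ 2 * (F + m.mass i * (fa * x - fb * y)) ^ 2 := by
    rw [← mul_pow, ← hw, ← mul_assoc, mul_one_div_cancel hτ.ne', one_mul]
  have hJ1 : (a * m.mass i) ^ 2 * (S n i - S (n - 1) i) ^ 2 ≤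
      (m.mTilde D.φ i * (S n i - S (n - 1) i)) ^ 2 := by
    rw [mul_pow (m.mTilde D.φ i)]
    exact mul_le_mul_of_nonneg_right (pow_le_pow_left₀ (by positivity) (ham i) 2) (sq_nonneg _)
  have hsq : (F + m.mass i * (fa * x - fb * y)) ^ 2 ≤
      2 * (c * (B * X)) + 2 * (m.mass i ^ 2 * (x ^ 2 + y ^ 2)) := by
    have h1 := mul_le_mul_of_nonneg_left hs (sq_nonneg (m.mass i))
    nlinarith [sq_nonneg (F - m.mass i * (fa * x - fb * y))]
  refine le_of_mul_le_mul_left ?_ hmass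
  rw [hnod]
  calc m.mass i * (p * (a ^ 2 * (m.mass i * (S n i - S (n - 1) i) ^ 2)))
      = p * ((a * m.mass i) ^ 2 * (S n i - S (n - 1) i) ^ 2) := by ring
    _ ≤ p * (τ ^ 2 * (2 * (c * (B * X)) + 2 * (m.mass i ^ 2 * (x ^ 2 + y ^ 2)))) := by
        refine mul_le_mul_of_nonneg_left ?_ (Nat.cast_nonneg p)
        rw [hJ] at hJ1
        exact hJ1.trans (mul_le_mul_of_nonneg_left hsq (sq_nonneg _))
    -- The factor p is kept for the later Cauchy-Schwarz over p steps. It forms p τ Σ_j c_ij, which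
    -- is at most R m_i, while in the source term p τ ≤ T.
    _ = 2 * τ * ((p * τ * c) * (B * X) + p * τ * (m.mass i * (m.mass i * (x ^ 2 + y ^ 2)))) := by
        ring
    _ ≤ 2 * τ * ((R * m.mass i) * (B * X) + D.T * (m.mass i * (m.mass i * (x ^ 2 + y ^ 2)))) := by
        gcongr
    _ ≤ m.mass i * (2 * τ * ((R * B + D.T) * (X + m.mass i * (x ^ 2 + y ^ 2)))) := by
        have h1 : 0 ≤ m.mass i * (2 * τ) * (D.T * X) := by positivity
        have h2 : 0 ≤ m.mass i * (2 * τ) * (R * B * (m.mass i * (x ^ 2 + y ^ 2))) := by positivity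
        linarith

end IsDiscreteSolution

end Data

end TwoPhase

/-! ### Increments over several time steps -/

namespace TwoPhase

namespace Data

variable {d : ℕ} {D : Data d}

/-- The budget of `p` time steps from the time level `k`. -/
noncomputable def window (D : Data d) (m : Mesh D.Ω) (N : ℕ) (S Pw Po : ℕ → Fin m.M → ℝ)
    (k p : ℕ) : ℝ :=
  ∑ r ∈ Finset.range p, D.T / N * (D.budget m N S Pw Po (k + r + 1) +
    (D.budget m N S Pw Po k + D.budget m N S Pw Po (k + p)))

lemma window_eq (D : Data d) (m : Mesh D.Ω) (N : ℕ) (S Pw Po : ℕ → Fin m.M → ℝ) (k p : ℕ) :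
    D.window m N S Pw Po k p =
      D.T / N * ∑ r ∈ Finset.range p, D.budget m N S Pw Po (k + r + 1) +
        p * (D.T / N) * (D.budget m N S Pw Po k + D.budget m N S Pw Po (k + p)) := by
  rw [window, ← Finset.mul_sum, Finset.sum_add_distrib, Finset.sum_const, Finset.card_range,
    nsmul_eq_mul]
  ring

lemma sum_range_shift_le {e : ℕ → ℝ} (he : ∀ n, 0 ≤ e n) {N p r : ℕ} (hr : r ≤ p) :
    ∑ k ∈ Finset.range (N - p), e (k + r + 1) ≤ ∑ n ∈ Finset.range N, e (n + 1) := by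
  rcases le_total N p with hp | hp
  · rw [Nat.sub_eq_zero_of_le hp]
    exact Finset.sum_nonneg fun n _ => he _
  have h := Finset.sum_Ico_eq_sum_range (fun n => e (n + 1)) r (N - p + r)
  rw [Nat.add_sub_cancel] at h
  simp only [Nat.add_comm r] at h
  rw [← h]
  refine Finset.sum_le_sum_of_subset_of_nonneg (fun n hn => ?_) fun n _ _ => he _
  rw [Finset.mem_Ico] at hn
  rw [Finset.mem_range]
  omega

/-- Exchanging the sums over k and r leaves 3p shifted sums of budgets, each at most C because every
shift is at most p. The missing factor τ comes from integrating over one time step. -/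
lemma sum_window_le (hD : D.BasicAssumptions) (m : Mesh D.Ω) {N : ℕ} (hN : 1 ≤ N)
    (S Pw Po : ℕ → Fin m.M → ℝ) {C : ℝ}
    (hC : ∑ k ∈ Finset.range N, D.T / N * D.budget m N S Pw Po (k + 1) ≤ C) (p : ℕ) :
    ∑ k ∈ Finset.range (N - p), D.window m N S Pw Po (k + 1) p ≤ 3 * C * p := by
  have hτ := timeStep_pos hD hN
  set e : ℕ → ℝ := fun n => D.T / N * D.budget m N S Pw Po n with he
  have he0 : ∀ n, 0 ≤ e n := fun n => mul_nonneg hτ.le (budget_nonneg hD m N S Pw Po n)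
  have h1 : ∑ k ∈ Finset.range (N - p), D.window m N S Pw Po (k + 1) p =
      ∑ r ∈ Finset.range p, (∑ k ∈ Finset.range (N - p), e (k + (r + 1) + 1) +
        (∑ k ∈ Finset.range (N - p), e (k + 0 + 1) +
          ∑ k ∈ Finset.range (N - p), e (k + p + 1))) := by
    simp only [window, ← Finset.sum_add_distrib]
    rw [Finset.sum_comm]
    refine Finset.sum_congr rfl fun r _ => Finset.sum_congr rfl fun k _ => ?_
    rw [he, show k + 1 + r + 1 = k + (r + 1) + 1 by ring, show k + 1 + p = k + p + 1 by ring]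
    ring
  rw [h1]
  have h2 : ∀ r ∈ Finset.range p, (∑ k ∈ Finset.range (N - p), e (k + (r + 1) + 1) +
        (∑ k ∈ Finset.range (N - p), e (k + 0 + 1) +
          ∑ k ∈ Finset.range (N - p), e (k + p + 1))) ≤ 3 * C := by
    intro r hr
    have := sum_range_shift_le he0 (N := N) (p := p) (r := r + 1) (Finset.mem_range.1 hr)
    have := sum_range_shift_le he0 (N := N) (p := p) (r := 0) (Nat.zero_le p)
    have := sum_range_shift_le he0 (N := N) (p := p) (r := p) le_rfl
    linarith
  refine (Finset.sum_le_sum h2).trans ?_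
  rw [Finset.sum_const, Finset.card_range, nsmul_eq_mul, mul_comm]

namespace IsDiscreteSolution

variable {m : Mesh D.Ω} {N : ℕ} {S Pw Po : ℕ → Fin m.M → ℝ}

/-- The increments of the nodal values of `g`. -/
lemma sum_mass_mul_sq_le [NeZero d] (h : D.IsDiscreteSolution m N S Pw Po)
    (hD : D.BasicAssumptions) (hP : D.PowerLaw) (hm : m.Nonobtuse) {B L G a : ℝ}
    (hB : ∀ s ∈ Icc (0 : ℝ) 1, D.ηw s ≤ B ∧ D.ηo s ≤ B) (hL0 : 0 ≤ L)
    (hL : ∀ a ∈ Icc (0 : ℝ) 1, ∀ b ∈ Icc (0 : ℝ) 1, |D.g a - D.g b| ≤ L * |a - b|)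
    (ham : ∀ i, a * m.mass i ≤ m.mTilde D.φ i)
    (hG : ∀ n, 1 ≤ n → n ≤ N →
      2 * m.dirichlet (fun i => D.g (S n i)) ≤ G * D.budget m N S Pw Po n)
    {k p : ℕ} (hk : 1 ≤ k) (hp : k + p ≤ N) :
    a * ∑ i, m.mass i * (D.g (S (k + p) i) - D.g (S k i)) ^ 2 ≤
      L * (1 + L + B * G) * D.window m N S Pw Po k p := by
  have hN : 1 ≤ N := hk.trans ((Nat.le_add_right k p).trans hp)
  have hτ := timeStep_pos hD hN
  have hS := h.saturation_mem hD hP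
  have hkN : k ≤ N := (Nat.le_add_right k p).trans hp
  have hB0 : 0 ≤ B :=
    (hD.ηw_nonneg 0 (left_mem_Icc.2 zero_le_one)).trans (hB 0 (left_mem_Icc.2 zero_le_one)).1
  set e := D.budget m N S Pw Po with hedef
  have he0 : ∀ n, 0 ≤ e n := budget_nonneg hD m N S Pw Po
  set θ : Fin m.M → ℝ := fun i => D.g (S (k + p) i) - D.g (S k i) with hθ
  have hθL : ∀ i, |θ i| ≤ L := fun i => by
    refine (hL _ (hS _ hp i) _ (hS _ hkN i)).trans (mul_le_of_le_one_right hL0 ?_)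
    have h1 := hS _ hp i
    have h2 := hS _ hkN i
    rw [abs_le]
    constructor <;> linarith [h1.1, h1.2, h2.1, h2.2]
  -- Here monotonicity gives the product a sign and the Lipschitz bound compares the two factors.
  have hsq : ∀ i, θ i ^ 2 ≤ L * (θ i * (S (k + p) i - S k i)) := by
    intro i
    have h1 := hL _ (hS _ hp i) _ (hS _ hkN i)
    have h2 : θ i * (S (k + p) i - S k i) = |θ i| * |S (k + p) i - S k i| := by
      rw [← abs_mul, abs_of_nonneg]
      rcases le_total (S k i) (S (k + p) i) with h3 | h3
      · exact mul_nonneg (g_sub_nonneg hD hP (hS _ hkN i) (hS _ hp i) h3) (sub_nonneg.2 h3)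
      · refine mul_nonneg_of_nonpos_of_nonpos ?_ (sub_nonpos.2 h3)
        have := g_sub_nonneg hD hP (hS _ hp i) (hS _ hkN i) h3
        simp only [hθ]
        linarith
    rw [h2, ← sq_abs]
    nlinarith [mul_le_mul_of_nonneg_left h1 (abs_nonneg (θ i))]
  have htel : ∀ i, S (k + p) i - S k i =
      ∑ r ∈ Finset.range p, (S (k + r + 1) i - S (k + r + 1 - 1) i) := fun i => by
    have := Finset.sum_range_sub (fun r => S (k + r) i) p
    simpa [add_assoc] using this.symm
  -- The test function is the same at all p steps, so its Dirichlet integral involves only the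
  -- levels k and k + p; this explains the two end budgets in `window`. Level 0, where there are no
  -- pressures to bound I_h g(S), is excluded by k ≥ 1.
  have hdir : m.dirichlet θ ≤ G * (e k + e (k + p)) := by
    have h1 := m.dirichlet_sub_le (fun i => D.g (S (k + p) i)) fun i => D.g (S k i)
    have h2 := hG k hk hkN
    have h3 := hG (k + p) (hk.trans (Nat.le_add_right k p)) hp
    linarith
  have hstep : ∀ r ∈ Finset.range p,
      ∑ i, m.mTilde D.φ i * (θ i * (S (k + r + 1) i - S (k + r + 1 - 1) i)) ≤
        (1 + L + B * G) * (D.T / N * (e (k + r + 1) + (e k + e (k + p)))) := by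
    intro r hr
    have hr' := Finset.mem_range.1 hr
    refine (h.sum_mTilde_mul_le hD hm hB hL0 hθL (Nat.le_add_left 1 _) (by omega)).trans ?_
    rw [mul_left_comm]
    refine mul_le_mul_of_nonneg_left ?_ hτ.le
    have h1 := mul_le_mul_of_nonneg_left hdir hB0
    have h2 : 0 ≤ G * e k := (mul_nonneg zero_le_two (m.dirichlet_nonneg _)).trans (hG k hk hkN)
    have h3 : 0 ≤ (1 + L) * (e k + e (k + p)) :=
      mul_nonneg (by linarith) (add_nonneg (he0 _) (he0 _))
    have h4 : 0 ≤ B * (G * e (k + r + 1)) := mul_nonneg hB0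
      ((mul_nonneg zero_le_two (m.dirichlet_nonneg _)).trans
        (hG (k + r + 1) (Nat.le_add_left 1 _) (by omega)))
    linarith
  calc a * ∑ i, m.mass i * θ i ^ 2 = ∑ i, (a * m.mass i) * θ i ^ 2 := by
        rw [Finset.mul_sum]; exact Finset.sum_congr rfl fun i _ => (mul_assoc _ _ _).symm
    _ ≤ ∑ i, m.mTilde D.φ i * (L * (θ i * (S (k + p) i - S k i))) :=
        Finset.sum_le_sum fun i _ =>
          mul_le_mul (ham i) (hsq i) (sq_nonneg _) (mTilde_pos m hD i).le
    _ = L * ∑ r ∈ Finset.range p,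
          ∑ i, m.mTilde D.φ i * (θ i * (S (k + r + 1) i - S (k + r + 1 - 1) i)) := by
        rw [Finset.sum_comm, Finset.mul_sum]
        refine Finset.sum_congr rfl fun i _ => ?_
        rw [htel i, ← Finset.mul_sum, ← Finset.mul_sum]
        ring
    _ ≤ L * ∑ r ∈ Finset.range p,
          (1 + L + B * G) * (D.T / N * (e (k + r + 1) + (e k + e (k + p)))) :=
        mul_le_mul_of_nonneg_left (Finset.sum_le_sum hstep) hL0
    _ = _ := by rw [← Finset.mul_sum, window, mul_assoc]

/-- Cauchy-Schwarz over the p steps costs the factor p carried by `mass_mul_sq_le`. -/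
lemma mass_mul_sub_sq_le (h : D.IsDiscreteSolution m N S Pw Po) (hD : D.BasicAssumptions)
    {B a R : ℝ} (hB : ∀ s ∈ Icc (0 : ℝ) 1, D.ηw s ≤ B ∧ D.ηo s ≤ B) (ha : 0 < a)
    (ham : ∀ i, a * m.mass i ≤ m.mTilde D.φ i) (hR : 0 ≤ R) {k p : ℕ} (hp : k + p ≤ N)
    {i : Fin m.M} (hi : p * (D.T / N) * ∑ j, m.c i j ≤ R * m.mass i) :
    (S (k + p) i - S k i) ^ 2 ≤ 2 * (R * B + D.T) / a ^ 2 *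
      (D.T / N * ∑ r ∈ Finset.range p, D.nodal m N S Pw Po (k + r + 1) i) / m.mass i := by
  have hmass := m.mass_pos i
  have htel : S (k + p) i - S k i =
      ∑ r ∈ Finset.range p, (S (k + r + 1) i - S (k + r + 1 - 1) i) := by
    have := Finset.sum_range_sub (fun r => S (k + r) i) p
    simpa [add_assoc] using this.symm
  have hcs := sq_sum_le_card_mul_sum_sq (s := Finset.range p)
    (f := fun r => S (k + r + 1) i - S (k + r + 1 - 1) i)
  rw [← htel, Finset.card_range] at hcs
  have hstep : ∀ r ∈ Finset.range p,
      p * (a ^ 2 * (m.mass i * (S (k + r + 1) i - S (k + r + 1 - 1) i) ^ 2)) ≤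
        2 * (D.T / N) * ((R * B + D.T) * D.nodal m N S Pw Po (k + r + 1) i) := fun r hr => by
    have hr' := Finset.mem_range.1 hr
    exact h.mass_mul_sq_le hD hB ha ham hR (by omega) hi (Nat.le_add_left 1 _) (by omega)
  have hsum := Finset.sum_le_sum hstep
  simp only [← Finset.mul_sum] at hsum
  have hcs' := mul_le_mul_of_nonneg_left hcs (mul_pos (pow_pos ha 2) hmass).le
  rw [div_mul_eq_mul_div, div_div, le_div_iff₀ (by positivity)]
  linarith

end IsDiscreteSolution

/-- The increments of `g(S_h)` and of its interpolate between two time levels. -/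
theorem exists_increment_bound [NeZero d] (hd : 2 ≤ d) (hD : D.BasicAssumptions) (hP : D.PowerLaw)
    (σ : ℝ) : ∃ C : ℝ, 0 ≤ C ∧ ∀ m : Mesh D.Ω, m.Regular σ → m.Nonobtuse → ∀ N : ℕ,
      ∀ S Pw Po : ℕ → Fin m.M → ℝ, D.IsDiscreteSolution m N S Pw Po →
        ∀ k p : ℕ, 1 ≤ k → k + p ≤ N →
          eLpNorm (fun x => D.g (m.fn (S (k + p)) x) - D.g (m.fn (S k) x)) 2
              (volume.restrict D.Ω) ^ 2 ≤ ENNReal.ofReal (C * D.window m N S Pw Po k p) ∧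
          eLpNorm (m.fn fun i => D.g (S (k + p) i) - D.g (S k i)) 2
              (volume.restrict D.Ω) ^ 2 ≤ ENNReal.ofReal (C * D.window m N S Pw Po k p) := by
  obtain ⟨η, hη, hηs⟩ := hD.η_lower
  obtain ⟨B, hB0, hB⟩ := exists_η_bound hD
  obtain ⟨L, hL0, hL⟩ := exists_g_lipschitz hD hP
  obtain ⟨a, b, ha, -, hab⟩ := exists_mTilde_bounds hD
  set G : ℝ := B + 2 * B ^ 3 / η ^ 2 with hGdef
  have hG0 : 0 ≤ G := by positivity
  -- The absolute value provides a nonnegative constant before any mesh forces σ to be positive.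
  set R : ℝ := |Mesh.rowBound d σ| with hR
  have hR0 : 0 ≤ R := abs_nonneg _
  have hT := hD.T_pos
  set Cn : ℝ := L * (1 + L + B * G) / a with hCn
  have hCn0 : 0 ≤ Cn := by positivity
  set Cj : ℝ := L ^ 2 * (2 * (R * B + D.T) / a ^ 2) with hCj
  have hCj0 : 0 ≤ Cj := by positivity
  refine ⟨2 * G + (d + 1) * (3 * Cn + Cj), by positivity,
    fun m hreg hm N S Pw Po h k p hk hp => ?_⟩
  have hkN : k ≤ N := (Nat.le_add_right k p).trans hp
  have hN : 1 ≤ N := hk.trans hkN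
  have hτ := timeStep_pos hD hN
  have hS := h.saturation_mem hD hP
  have hmono := g_monotoneOn hD hP
  have he0 := budget_nonneg hD m N S Pw Po
  have hG : ∀ n, 1 ≤ n → n ≤ N →
      2 * m.dirichlet (fun i => D.g (S n i)) ≤ G * D.budget m N S Pw Po n := fun n hn hnN =>
    (h.dirichlet_g_le hD hP hm hη hηs hB hn hnN).trans (mul_le_mul_of_nonneg_left
      (le_add_of_nonneg_right (add_nonneg measureReal_nonneg (rate_nonneg _ _ _ _))) hG0)
  have hnodal := h.sum_mass_mul_sq_le hD hP hm hB hL0 hL (fun i => (hab m i).1) hG hk hp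
  set θ : Fin m.M → ℝ := fun i => D.g (S (k + p) i) - D.g (S k i) with hθ
  set W := D.window m N S Pw Po k p with hW
  have hWeq := D.window_eq m N S Pw Po k p
  rw [← hW] at hWeq
  have hW1 : 0 ≤ D.T / N * ∑ r ∈ Finset.range p, D.budget m N S Pw Po (k + r + 1) :=
    mul_nonneg hτ.le (Finset.sum_nonneg fun r _ => he0 _)
  have hW2 : 0 ≤ p * (D.T / N) * (D.budget m N S Pw Po k + D.budget m N S Pw Po (k + p)) :=
    mul_nonneg (by positivity) (add_nonneg (he0 _) (he0 _))
  have hW0 : 0 ≤ W := by rw [hWeq]; exact add_nonneg hW1 hW2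
  have hnodal' : ∑ i, m.mass i * θ i ^ 2 ≤ Cn * W := by
    rw [hCn, div_mul_eq_mul_div, le_div_iff₀ ha, mul_comm]
    exact hnodal
  constructor
  · set τ := D.T / N with hτdef
    set y : Fin m.M → ℝ := fun i =>
      τ * ∑ r ∈ Finset.range p, D.nodal m N S Pw Po (k + r + 1) i with hy
    have hy0 : ∀ i, 0 ≤ y i := fun i =>
      mul_nonneg hτ.le (Finset.sum_nonneg fun r _ => nodal_nonneg hD m N S Pw Po _ i)
    -- The first term serves the small elements, where nodal increments of g are used, and the
    -- second the large ones, where the increments of S are bounded by fluxes. Using the sum on all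
    -- elements avoids splitting the mesh.
    set w : Fin m.M → ℝ := fun i => 3 * θ i ^ 2 + Cj * y i / m.mass i with hw
    have hw0 : ∀ i, 0 ≤ Cj * y i / m.mass i := fun i =>
      div_nonneg (mul_nonneg hCj0 (hy0 i)) (m.mass_pos i).le
    refine (m.eLpNorm_sq_le (b := fun K => 3 * (p * τ) *
      (‖m.grad K fun i => D.g (S (k + p) i)‖ ^ 2 + ‖m.grad K fun i => D.g (S k i)‖ ^ 2) +
        ∑ a, w (m.vert K a)) ?_).trans (ENNReal.ofReal_le_ofReal ?_)
    · intro K x hx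
      have hx1 := m.fn_mem_Icc hx (hS _ hp)
      have hx2 := m.fn_mem_Icc hx (hS _ hkN)
      have hpτ : 0 ≤ (p : ℝ) * τ := by positivity
      -- Small elements: both values of g(S_h) are replaced by those at vertex 0, at the cost of h_K
      -- |∇I_h g(S)| each, and h_K² ≤ pτ turns the squares into the dissipative term.
      rcases le_or_gt (m.diam K ^ 2) (p * τ) with hsmall | hlarge
      · have h1 := m.abs_comp_fn_sub_le hx (hS _ hp) hmono 0
        have h2 := m.abs_comp_fn_sub_le hx (hS _ hkN) hmono 0
        have h3 : 3 * θ (m.vert K 0) ^ 2 ≤ ∑ a, w (m.vert K a) := by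
          refine le_trans ?_ (Finset.single_le_sum (f := fun a => w (m.vert K a))
            (fun a _ => add_nonneg (by positivity) (hw0 _)) (Finset.mem_univ 0))
          exact le_add_of_nonneg_right (hw0 _)
        set A1 := ‖m.grad K fun i => D.g (S (k + p) i)‖
        set A2 := ‖m.grad K fun i => D.g (S k i)‖
        have h4 := pow_le_pow_left₀ (abs_nonneg _) h1 2
        have h5 := pow_le_pow_left₀ (abs_nonneg _) h2 2
        rw [sq_abs, mul_pow] at h4 h5
        have h6 := mul_le_mul_of_nonneg_left hsmall (sq_nonneg A1)
        have h7 := mul_le_mul_of_nonneg_left hsmall (sq_nonneg A2)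
        have h8 : D.g (m.fn (S (k + p)) x) - D.g (m.fn (S k) x) =
            (D.g (m.fn (S (k + p)) x) - D.g (S (k + p) (m.vert K 0))) + θ (m.vert K 0) -
            (D.g (m.fn (S k) x) - D.g (S k (m.vert K 0))) := by simp only [hθ]; ring
        rw [h8]
        set u := D.g (m.fn (S (k + p)) x) - D.g (S (k + p) (m.vert K 0))
        set v := D.g (m.fn (S k) x) - D.g (S k (m.vert K 0))
        set z := θ (m.vert K 0)
        nlinarith [sq_nonneg (u - z), sq_nonneg (u + v), sq_nonneg (z + v)]
      -- Large elements: g is Lipschitz and the increment of S_h is bounded by its vertex values. As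
      -- pτ < h_K², the row sum bound meets the stability condition at every vertex of K.
      · have h1 := hL _ hx1 _ hx2
        have h2 := pow_le_pow_left₀ (abs_nonneg _) h1 2
        rw [sq_abs, mul_pow, sq_abs, ← m.fn_sub] at h2
        have h3 := m.fn_sq_le hx fun i => S (k + p) i - S k i
        have h4 : ∀ c, L ^ 2 * (S (k + p) (m.vert K c) - S k (m.vert K c)) ^ 2 ≤
            w (m.vert K c) := by
          intro c
          have hi : p * τ * ∑ j, m.c (m.vert K c) j ≤ R * m.mass (m.vert K c) := by
            have hsum : 0 ≤ ∑ j, m.c (m.vert K c) j := Finset.sum_nonneg fun j _ => m.c_nonneg _ j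
            calc p * τ * ∑ j, m.c (m.vert K c) j ≤ m.diam K ^ 2 * ∑ j, m.c (m.vert K c) j := by
                  gcongr
              _ ≤ Mesh.rowBound d σ * m.mass (m.vert K c) :=
                  hreg.diam_sq_mul_sum_c_le hd ⟨c, rfl⟩
              _ ≤ R * m.mass (m.vert K c) :=
                  mul_le_mul_of_nonneg_right (le_abs_self _) (m.mass_pos _).le
          have h5 := mul_le_mul_of_nonneg_left
            (h.mass_mul_sub_sq_le hD hB ha (fun i => (hab m i).1) hR0 hp hi) (sq_nonneg L)
          refine h5.trans ?_
          rw [mul_div_assoc', ← mul_assoc, ← hCj]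
          exact le_add_of_nonneg_left (by positivity)
        refine h2.trans ((mul_le_mul_of_nonneg_left h3 (sq_nonneg L)).trans ?_)
        rw [Finset.mul_sum]
        exact (Finset.sum_le_sum fun c _ => h4 c).trans
          (le_add_of_nonneg_left (by positivity))
    · simp only [mul_add, Finset.sum_add_distrib]
      have h1 : ∀ U : Fin m.M → ℝ, ∑ K, m.vol K * (3 * (p * τ) * ‖m.grad K U‖ ^ 2) =
          3 * (p * τ) * m.dirichlet U := fun U => by
        rw [Mesh.dirichlet, Finset.mul_sum]
        exact Finset.sum_congr rfl fun K _ => by ring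
      rw [h1, h1, m.sum_vol_mul_sum]
      have h2 : ∑ i, m.mass i * w i = 3 * ∑ i, m.mass i * θ i ^ 2 + Cj * ∑ i, y i := by
        rw [Finset.mul_sum, Finset.mul_sum, ← Finset.sum_add_distrib]
        refine Finset.sum_congr rfl fun i _ => ?_
        have := m.mass_pos i
        simp only [hw]
        field_simp
      have h3 : ∑ i, y i ≤ W := by
        have h4 : ∑ i, y i = τ * ∑ r ∈ Finset.range p, ∑ i, D.nodal m N S Pw Po (k + r + 1) i := by
          rw [Finset.sum_comm, Finset.mul_sum]
        have h5 : ∑ r ∈ Finset.range p, ∑ i, D.nodal m N S Pw Po (k + r + 1) i ≤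
            ∑ r ∈ Finset.range p, D.budget m N S Pw Po (k + r + 1) :=
          Finset.sum_le_sum fun r _ => sum_nodal_le m N S Pw Po _
        have h6 := mul_le_mul_of_nonneg_left h5 hτ.le
        linarith
      have h4 : ∑ i, m.mass i * w i ≤ (3 * Cn + Cj) * W := by
        rw [h2]
        have := mul_le_mul_of_nonneg_left h3 hCj0
        linarith
      have h5 : p * τ * (2 * m.dirichlet (fun i => D.g (S (k + p) i)) +
          2 * m.dirichlet fun i => D.g (S k i)) ≤ G * W := by
        have h6 := hG k hk hkN
        have h7 := hG (k + p) (hk.trans (Nat.le_add_right k p)) hp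
        have h8 : 0 ≤ (p : ℝ) * τ := by positivity
        have h9 := mul_le_mul_of_nonneg_left (add_le_add h7 h6) h8
        have h10 := mul_nonneg hG0 hW1
        rw [hWeq]
        linarith
      have h6 := mul_le_mul_of_nonneg_left h4 (by positivity : (0 : ℝ) ≤ (d : ℝ) + 1)
      have h7 := mul_nonneg hG0 hW0
      linarith
  -- For the interpolate, the nodal estimate suffices: the L² norm squared is at most d+1 times the
  -- lumped one.
  · refine (m.eLpNorm_sq_le fun K x hx => m.fn_sq_le hx θ).trans (ENNReal.ofReal_le_ofReal ?_)
    rw [m.sum_vol_mul_sum fun i => θ i ^ 2]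
    have h6 := mul_le_mul_of_nonneg_left hnodal' (by positivity : (0 : ℝ) ≤ (d : ℝ) + 1)
    have h7 : 0 ≤ (2 * G + (d + 1) * (2 * Cn + Cj)) * W := mul_nonneg (by positivity) hW0
    linarith

end Data

end TwoPhase

/-! ### Time translates of functions piecewise constant in time -/

namespace TwoPhase

lemma lintegral_Ioc_mul_le (f : ℝ → ℝ≥0∞) (τ : ℝ) (n : ℕ) :
    ∫⁻ t in Ioc 0 (n * τ), f t ≤
      ∑ k ∈ Finset.range n, ∫⁻ t in Ioc 0 τ, f (t + k * τ) := by
  induction n with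
  | zero => simp
  | succ n ih =>
    have h1 : Ioc 0 (((n + 1 : ℕ) : ℝ) * τ) ⊆ Ioc 0 (n * τ) ∪ Ioc (n * τ) ((n + 1 : ℕ) * τ) :=
      Ioc_subset_Ioc_union_Ioc
    have h2 : ∫⁻ t in Ioc (n * τ) ((n + 1 : ℕ) * τ), f t = ∫⁻ t in Ioc 0 τ, f (t + n * τ) := by
      rw [← lintegral_indicator measurableSet_Ioc, ← lintegral_indicator measurableSet_Ioc,
        ← lintegral_add_right_eq_self _ ((n : ℝ) * τ)]
      refine lintegral_congr fun t => ?_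
      have : t + n * τ ∈ Ioc (n * τ) ((n + 1 : ℕ) * τ) ↔ t ∈ Ioc 0 τ := by
        push_cast
        constructor <;> rintro ⟨h, h'⟩ <;> constructor <;> linarith
      by_cases ht : t ∈ Ioc 0 τ
      · rw [indicator_of_mem ht, indicator_of_mem (this.2 ht)]
      · rw [indicator_of_notMem ht, indicator_of_notMem (mt this.1 ht)]
    rw [Finset.sum_range_succ, ← h2]
    exact (lintegral_mono_set h1).trans ((lintegral_union_le _ _ _).trans (by gcongr))

/-- For functions which are piecewise constant in time, bounds of the increments between discrete
time levels imply bounds of all time translates. -/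
theorem lintegral_time_translate_le {T C δ : ℝ} {N : ℕ} (hT : 0 < T) (hN : 1 ≤ N) (hC : 0 ≤ C)
    (hδ : 0 < δ) {F : ℕ → ℕ → ℝ≥0∞}
    (hF : ∀ p, ∑ k ∈ Finset.range (N - p), F (k + 1) (k + 1 + p) ≤ ENNReal.ofReal (C * p)) :
    ∫⁻ t in Ioc 0 (T - δ), F ⌈t / (T / N)⌉₊ ⌈(t + δ) / (T / N)⌉₊ ≤ ENNReal.ofReal (C * δ) := by
  have hN0 : (0 : ℝ) < N := Nat.cast_pos.2 hN
  have hNτ : (N : ℝ) * (T / N) = T := by field_simp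
  have hτ : 0 < T / N := by positivity
  set τ := T / N
  set H : ℝ → ℝ≥0∞ := fun t => F ⌈t / τ⌉₊ ⌈(t + δ) / τ⌉₊ with hH
  have hHm : Measurable H := by
    have h1 : Measurable fun t : ℝ => (⌈t / τ⌉₊, ⌈(t + δ) / τ⌉₊) :=
      (Nat.measurable_ceil.comp (by fun_prop)).prodMk (Nat.measurable_ceil.comp (by fun_prop))
    exact (measurable_of_countable fun p : ℕ × ℕ => F p.1 p.2).comp h1
  set J : ℝ → ℝ≥0∞ := (Iic (T - δ)).indicator H with hJ
  have hJm : Measurable J := hHm.indicator measurableSet_Iic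
  -- At t + kτ the two time indices are k+1 and k+1+p, with p independent of k. The cut-off at T - δ
  -- removes every k with k + p ≥ N.
  have hpt : ∀ p : ℕ, ∀ t ∈ Ioc 0 τ, p * τ < t + δ → t + δ ≤ (p + 1) * τ →
      ∑ k ∈ Finset.range N, J (t + k * τ) ≤ ENNReal.ofReal (C * p) := by
    intro p t ht h1 h2
    refine le_trans ?_ (hF p)
    have h3 : ∀ k : ℕ, ⌈(t + k * τ) / τ⌉₊ = k + 1 := fun k => by
      rw [Nat.ceil_eq_iff k.succ_ne_zero, lt_div_iff₀ hτ, div_le_iff₀ hτ]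
      push_cast [Nat.add_sub_cancel]
      constructor <;> linarith [ht.1, ht.2]
    have h4 : ∀ k : ℕ, ⌈(t + k * τ + δ) / τ⌉₊ = k + 1 + p := fun k => by
      rw [Nat.ceil_eq_iff (by omega), lt_div_iff₀ hτ, div_le_iff₀ hτ,
        show k + 1 + p - 1 = k + p by omega]
      push_cast
      constructor <;> linarith
    have h5 : ∀ k ∈ Finset.range N, J (t + k * τ) ≠ 0 → k ∈ Finset.range (N - p) := by
      intro k _ hne
      have h6 : t + k * τ ≤ T - δ := by
        by_contra h
        exact hne (indicator_of_notMem (s := Iic (T - δ)) h _)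
      have h7 : ((k + p : ℕ) : ℝ) * τ < N * τ := by
        push_cast
        rw [hNτ]; linarith
      have h8 : k + p < N := Nat.cast_lt.1 (lt_of_mul_lt_mul_right h7 hτ.le)
      rw [Finset.mem_range]
      omega
    have hsub : Finset.range (N - p) ⊆ Finset.range N := Finset.range_mono (Nat.sub_le _ _)
    rw [← Finset.sum_subset hsub fun k hk hk' => by
      by_contra h; exact hk' (h5 k hk h)]
    refine Finset.sum_le_sum fun k _ => (indicator_le_self _ _ _).trans ?_
    rw [hH]
    simp only [h3, h4, le_refl]
  set q := ⌊δ / τ⌋₊ with hq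
  have hq1 : q * τ ≤ δ := (le_div_iff₀ hτ).1 (Nat.floor_le (by positivity))
  have hq2 : δ < (q + 1) * τ := (div_lt_iff₀ hτ).1 (Nat.lt_floor_add_one _)
  set r := δ - q * τ with hr
  have hr0 : 0 ≤ r := sub_nonneg.2 hq1
  have hrτ : r ≤ τ := by linarith
  calc ∫⁻ t in Ioc 0 (T - δ), H t ≤ ∫⁻ t in Ioc 0 (N * τ), J t := by
        rw [hNτ, hJ, lintegral_indicator measurableSet_Iic, Measure.restrict_restrict
          measurableSet_Iic]
        exact lintegral_mono_set fun t ht => ⟨ht.2, ht.1, by linarith [ht.2]⟩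
    _ ≤ ∑ k ∈ Finset.range N, ∫⁻ t in Ioc 0 τ, J (t + k * τ) := lintegral_Ioc_mul_le J τ N
    _ = ∫⁻ t in Ioc 0 τ, ∑ k ∈ Finset.range N, J (t + k * τ) :=
        (lintegral_finsetSum _ fun k _ => hJm.comp (by fun_prop)).symm
    _ ≤ (∫⁻ t in Ioc 0 (τ - r), ∑ k ∈ Finset.range N, J (t + k * τ)) +
          ∫⁻ t in Ioc (τ - r) τ, ∑ k ∈ Finset.range N, J (t + k * τ) :=
        (lintegral_mono_set Ioc_subset_Ioc_union_Ioc).trans (lintegral_union_le _ _ _)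
    -- With δ = qτ + r, the index gap is q when t ≤ τ - r and q + 1 otherwise.
    _ ≤ (∫⁻ _ in Ioc 0 (τ - r), ENNReal.ofReal (C * q)) +
          ∫⁻ _ in Ioc (τ - r) τ, ENNReal.ofReal (C * (q + 1 : ℕ)) := by
        refine add_le_add (setLIntegral_mono' measurableSet_Ioc fun t ht => ?_)
          (setLIntegral_mono' measurableSet_Ioc fun t ht => ?_)
        · exact hpt q t ⟨ht.1, by linarith [ht.2]⟩ (by linarith [ht.1]) (by linarith [ht.2])
        · refine hpt (q + 1) t ⟨by linarith [ht.1], ht.2⟩ ?_ ?_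
          · push_cast; linarith [ht.1]
          · push_cast; linarith [ht.2]
    -- The weighted mean of the two gaps is exact: (τ - r) q + r (q + 1) = qτ + r = δ. No term of
    -- order τ is lost when δ < τ.
    _ = ENNReal.ofReal (C * δ) := by
        rw [setLIntegral_const, setLIntegral_const, Real.volume_Ioc, Real.volume_Ioc,
          ← ENNReal.ofReal_mul (by positivity), ← ENNReal.ofReal_mul (by positivity),
          ← ENNReal.ofReal_add (mul_nonneg (by positivity) (by linarith))
            (mul_nonneg (by positivity) (by linarith))]
        congr 1
        rw [hr]; push_cast; ring

end TwoPhase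

/-! ### The two translate estimates -/

theorem mainTheorem7 (d : ℕ) [NeZero d] (hd : d = 2 ∨ d = 3) (D : TwoPhase.Data d)
    (hD : D.BasicAssumptions) (hP : D.PowerLaw) (σ : ℝ) :
    ∃ C : ℝ, ∀ m : TwoPhase.Mesh D.Ω, m.Regular σ → m.Nonobtuse → m.PorosityCompatible D.φ →
      ∀ N : ℕ, 1 ≤ N → ∀ S Pw Po : ℕ → Fin m.M → ℝ, D.IsDiscreteSolution m N S Pw Po →
        ∀ δ : ℝ, 0 < δ → δ < D.T →
          (∫⁻ t in Ioc 0 (D.T - δ),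
              eLpNorm (fun x => D.g (D.Shτ m N S (t + δ) x) - D.g (D.Shτ m N S t x)) 2
                (volume.restrict D.Ω) ^ 2
            ≤ ENNReal.ofReal (C * δ)) ∧
          (∫⁻ t in Ioc 0 (D.T - δ),
              eLpNorm (m.interp fun x => D.g (D.Shτ m N S (t + δ) x) - D.g (D.Shτ m N S t x)) 2
                (volume.restrict D.Ω) ^ 2
            ≤ ENNReal.ofReal (C * δ)) := by
  have hd2 : 2 ≤ d := by omega
  obtain ⟨C₁, hC₁, h₁⟩ := TwoPhase.Data.exists_energy_bound hD hP
  obtain ⟨C₂, hC₂, h₂⟩ := TwoPhase.Data.exists_increment_bound hd2 hD hP σ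
  refine ⟨C₂ * (3 * C₁), fun m hreg hm _ N hN S Pw Po h δ hδ _ => ?_⟩
  have hC : 0 ≤ C₂ * (3 * C₁) := by positivity
  -- Both norms depend on time only through the two indices. For t > 0 the first index is at least
  -- 1, so bounds for k ≥ 1 are enough.
  have key : ∀ (F : ℕ → ℕ → ℝ≥0∞),
      (∀ k p, 1 ≤ k → k + p ≤ N →
        F k (k + p) ≤ ENNReal.ofReal (C₂ * D.window m N S Pw Po k p)) →
      ∫⁻ t in Ioc 0 (D.T - δ), F ⌈t / (D.T / N)⌉₊ ⌈(t + δ) / (D.T / N)⌉₊ ≤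
        ENNReal.ofReal (C₂ * (3 * C₁) * δ) := by
    intro F hF
    refine TwoPhase.lintegral_time_translate_le hD.T_pos hN hC hδ fun p => ?_
    have hW : ∀ k, 0 ≤ D.window m N S Pw Po k p := fun k =>
      Finset.sum_nonneg fun r _ => mul_nonneg (TwoPhase.Data.timeStep_pos hD hN).le
        (add_nonneg (TwoPhase.Data.budget_nonneg hD m N S Pw Po _)
          (add_nonneg (TwoPhase.Data.budget_nonneg hD m N S Pw Po _)
            (TwoPhase.Data.budget_nonneg hD m N S Pw Po _)))
    calc ∑ k ∈ Finset.range (N - p), F (k + 1) (k + 1 + p)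
        ≤ ∑ k ∈ Finset.range (N - p),
            ENNReal.ofReal (C₂ * D.window m N S Pw Po (k + 1) p) := by
          refine Finset.sum_le_sum fun k hk => hF _ _ (Nat.le_add_left 1 k) ?_
          have := Finset.mem_range.1 hk
          omega
      _ = ENNReal.ofReal (C₂ * ∑ k ∈ Finset.range (N - p), D.window m N S Pw Po (k + 1) p) := by
          rw [Finset.mul_sum, ENNReal.ofReal_sum_of_nonneg fun k _ => mul_nonneg hC₂ (hW _)]
      _ ≤ ENNReal.ofReal (C₂ * (3 * C₁) * p) := by
          refine ENNReal.ofReal_le_ofReal ?_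
          rw [mul_assoc]
          exact mul_le_mul_of_nonneg_left
            (TwoPhase.Data.sum_window_le hD m hN S Pw Po (h₁ m hm N hN S Pw Po h) p) hC₂
  constructor
  · exact key (fun k l => eLpNorm (fun x => D.g (m.fn (S l) x) - D.g (m.fn (S k) x)) 2
      (volume.restrict D.Ω) ^ 2) fun k p hk hp => (h₂ m hreg hm N S Pw Po h k p hk hp).1
  · have hint : ∀ k l : ℕ, m.interp (fun x => D.g (m.fn (S l) x) - D.g (m.fn (S k) x)) =
        m.fn fun i => D.g (S l i) - D.g (S k i) := fun k l => by
      simp only [TwoPhase.Mesh.interp, m.fn_node]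
    refine key (fun k l => eLpNorm (m.interp fun x => D.g (m.fn (S l) x) - D.g (m.fn (S k) x)) 2
      (volume.restrict D.Ω) ^ 2) fun k p hk hp => ?_
    simp only [hint]
    exact (h₂ m hreg hm N S Pw Po h k p hk hp).2
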